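/- **Setting.** All Hilbert spaces are finite dimensional, $\log=\log_2$, and a channel is a completely positive trace-preserving map. Let $\Lambda:\mathcal B(\bigotimes_{i=1}^k\mathcal H_{in,i})\to\mathcal B(\bigotimes_{j=1}^m\mathcal H_{out,j})$ be a channel from $k$ senders to $m$ receivers ($m=1$: multiple access channel; $k=1$: broadcast channel). There are $L$ transmissions. Transmission $e$ has a sender $s(e)$, a receiver $r(e)$ and a particle space $\mathcal H_e$; put $\mathcal H_e^{n}=\mathcal H_e^{\otimes n}$. For a kind of classical communication $C\in\{\emptyset,\rightarrow,\leftarrow,\leftrightarrow\}$ between the group of senders and the group of receivers, a $C$-protocol for block length $n$ turns $\Lambda^{\otimes n}$ into a map $\hat\Lambda^{(n)}$ on $\mathcal B(\bigotimes_e\mathcal H_e^{n})$ (with $\bigotimes_{s(e)=i}\mathcal H^n_e$ initially at sender $i$ and $\bigotimes_{r(e)=j}\mathcal H_e^n$ finally at receiver $j$) as follows. * $C=\emptyset$: $\hat\Lambda^{(n)}=(\bigotimes_j D_j)\,\Lambda^{\otimes n}\,(\bigotimes_iE_i)$ with channels $E_i$, $D_j$. * $C=\rightarrow$: $\hat\Lambda^{(n)}=\sum_{o=(o_1,\dots,o_k)}(\bigotimes_jD_{j}^{o})\,\Lambda^{\otimes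 n}\,(\bigotimes_iE_i^{o_i})$, where the $E_i^{o_i}$ are completely positive, $\sum_{o_i}E_i^{o_i}$ is trace preserving, and the $D_j^o$ are channels. * $C=\leftarrow,\leftrightarrow$: finitely many rounds, $n$ of which contain one use of $\Lambda$. In every round each party (with a finite-dimensional local quantum memory) performs a local measurement, chosen according to the outcomes of earlier rounds known to it: its own outcomes and, for $\leftarrow$, if it is a sender, those of all receivers; for $\leftrightarrow$, the outcomes of all parties. In the $n$ rounds with a channel use the senders moreover emit the inputs of $\Lambda$ and the receivers process its outputs. At the end the receivers apply channels, depending on what they know, that produce the delivered material. *Subspace transmission.* For subspaces $H_e\subseteq\mathcal H_e^n$ let $$F_s\Big(\bigotimes_eH_e,N\Big)=\min\langle\psi|N(|\psi\rangle\langle\psi|)|\psi\rangle,\qquad \psi=\bigotimes_e\psi_e,\ \psi_e\in H_e,\ \|\psi_e\|=1 .$$ A tuple $R\in\mathbb R^L$ is achievable if there are a sequence of $C$-protocols, giving maps $\hat\Lambda^{(n)}$, and nonzero subspaces $H_e^{(n)}\subseteq\mathcal H_e^n$ such that $\lim_n\frac1n\log\dim H^{(n)}_e=R_e$ for all $e$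 and $F_s(\bigotimes_eH^{(n)}_e,\hat\Lambda^{(n)})\to1$. *Entanglement transmission.* For unit vectors $\Psi_e\in\mathcal K_e\otimes\mathcal H_e^n$ (with finite-dimensional reference spaces $\mathcal K_e$) and $\Psi=\bigotimes_e\Psi_e$, let $F_e(\Psi,N)=\langle\Psi|(\mathrm{id}\otimes N)(|\Psi\rangle\langle\Psi|)|\Psi\rangle$. A tuple $R$ is achievable if there are a sequence of $C$-protocols and unit vectors $\Psi_e^{(n)}$, with reduced states $\varrho_e^{(n)}$ on $\mathcal H_e^n$, such that $\lim_n\frac1nS(\varrho^{(n)}_e)=R_e$, each source $(\varrho_e^{(n)})_n$ satisfies QAEP, and $F_e(\Psi^{(n)},\hat\Lambda^{(n)})\to1$. Here $S$ is the von Neumann entropy, and QAEP means: for all $\varepsilon,\delta>0$ and all sufficiently large $n$, $\operatorname{tr}\Pi\varrho_e^{(n)}\Pi>1-\delta$, where $\Pi$ projects onto the span of the eigenvectors of $\varrho_e^{(n)}$ with eigenvalue in $[2^{-n(R_e+\varepsilon)},2^{-n(R_e-\varepsilon)}]$. **Theorem.** For all $k,m,L$, every assignment of senders and receivers to the transmissions,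 every channel $\Lambda$ and every $C\in\{\emptyset,\rightarrow,\leftarrow,\leftrightarrow\}$, the capacity region for subspace transmission (the set of tuples $R\in\mathbb R^L$ achievable for some choice of the spaces $\mathcal H_e$) equals the capacity region for entanglement transmission with QAEP sources. Moreover, for each fixed choice of the spaces $\mathcal H_e$ the two sets of achievable tuples coincide. -/

import Mathlib

open Filter Topology Matrix

noncomputable section

namespace QNet

/-! ### Linear maps between matrix algebras, and channels -/

/-- Superoperators `B(ℂ^X) → B(ℂ^Y)`, the spaces carrying the standard bases `X` and `Y`. -/
abbrev SuperOp (X Y : Type) : Type := Matrix X X ℂ →ₗ[ℂ] Matrix Y Y ℂ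

/-- The superoperator `ρ ↦ K ρ K†`. -/
def conjMap {X Y : Type} [Fintype X] (K : Matrix Y X ℂ) : SuperOp X Y where
  toFun ρ := K * ρ * Kᴴ
  map_add' ρ σ := by rw [Matrix.mul_add, Matrix.add_mul]
  map_smul' c ρ := by simp

/-- Complete positivity, by a Kraus representation. -/
def IsCP {X Y : Type} [Fintype X] (Φ : SuperOp X Y) : Prop :=
  ∃ (r : ℕ) (K : Fin r → Matrix Y X ℂ), Φ = ∑ a, conjMap (K a)

/-- Trace preservation. -/
def IsTP {X Y : Type} [Fintype X] [Fintype Y] (Φ : SuperOp X Y) : Prop :=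
  ∀ ρ, (Φ ρ).trace = ρ.trace

/-- A quantum channel: a completely positive trace-preserving map. -/
def IsChannel {X Y : Type} [Fintype X] [Fintype Y] (Φ : SuperOp X Y) : Prop :=
  IsCP Φ ∧ IsTP Φ

/-- Relabelling of basis vectors; it is used only along bijections `f`. -/
def relabel {X Y : Type} (f : Y → X) : SuperOp X Y where
  toFun ρ := ρ.submatrix f f
  map_add' _ _ := rfl
  map_smul' _ _ := rfl

/-- The extension `id_R ⊗ Φ` of a superoperator by an idle reference system `R`. -/
def amplify (R : Type) {X Y : Type} (Φ : SuperOp X Y) : SuperOp (R × X) (R × Y) where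
  toFun M := Matrix.of fun u v => Φ (Matrix.of fun x x' => M (u.1, x) (v.1, x')) u.2 v.2
  map_add' M M' := by
    ext u v
    exact congrFun (congrFun (Φ.map_add (Matrix.of fun x x' => M (u.1, x) (v.1, x'))
      (Matrix.of fun x x' => M' (u.1, x) (v.1, x'))) u.2) v.2
  map_smul' c M := by
    ext u v
    exact congrFun (congrFun (Φ.map_smul c
      (Matrix.of fun x x' => M (u.1, x) (v.1, x'))) u.2) v.2

/-- The tensor product `⨂ i, Φ i`, given through its matrix elements. -/
def tensorMap {ι : Type} [Fintype ι] [DecidableEq ι] {X Y : ι → Type}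
    [∀ i, Fintype (X i)] [∀ i, DecidableEq (X i)] (Φ : ∀ i, SuperOp (X i) (Y i)) :
    SuperOp (∀ i, X i) (∀ i, Y i) where
  toFun ρ := Matrix.of fun y y' =>
    ∑ x, ∑ x', (∏ i, Φ i (Matrix.single (x i) (x' i) 1) (y i) (y' i)) * ρ x x'
  map_add' ρ σ := by
    ext y y'
    simp [mul_add, Finset.sum_add_distrib]
  map_smul' c ρ := by
    ext y y'
    simp [Finset.mul_sum, mul_left_comm]

/-! ### The network

`k` senders, `m` receivers; sender `i` feeds a channel input of dimension `a i`, receiver `j` obtains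
a channel output of dimension `b j`. -/

/-- Channels from `k` senders to `m` receivers (one use). -/
abbrev NetMap {k m : ℕ} (a : Fin k → ℕ) (b : Fin m → ℕ) : Type :=
  SuperOp (∀ i, Fin (a i)) (∀ j, Fin (b j))

/-- `Λ^{⊗n}`, with the `n` input (output) systems of each sender (receiver) collected. -/
def blockMap {k m : ℕ} {a : Fin k → ℕ} {b : Fin m → ℕ} (Λ : NetMap a b) (n : ℕ) :
    SuperOp (∀ i, Fin n → Fin (a i)) (∀ j, Fin n → Fin (b j)) :=
  relabel (fun y t j => y j t) ∘ₗ tensorMap (fun _ : Fin n => Λ) ∘ₗ relabel (fun x i t => x t i)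

/-- There are `L` transmissions. Transmission `e` goes from sender `snd e` to receiver `rcv e`; the
particles of the transmission have Hilbert space of dimension `d e`. -/
structure Layout (k m L : ℕ) where
  snd : Fin L → Fin k
  rcv : Fin L → Fin m

/-- Basis of the `n`-block space of a `d`-dimensional particle. -/
abbrev Blk (n d : ℕ) : Type := Fin n → Fin d

/-- Basis of all the transmitted material, `⨂ e, (ℂ^{d e})^{⊗n}`. -/
abbrev Mat {L : ℕ} (n : ℕ) (d : Fin L → ℕ) : Type := ∀ e, Blk n (d e)

/-- Basis of the material held by sender `i` at the beginning. -/
abbrev Src {k m L : ℕ} (l : Layout k m L) (n : ℕ) (d : Fin L → ℕ) (i : Fin k) : Type :=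
  ∀ e : {e : Fin L // l.snd e = i}, Blk n (d e)

/-- Basis of the material held by receiver `j` at the end. -/
abbrev Dst {k m L : ℕ} (l : Layout k m L) (n : ℕ) (d : Fin L → ℕ) (j : Fin m) : Type :=
  ∀ e : {e : Fin L // l.rcv e = j}, Blk n (d e)

/-- A map from the senders' to the receivers' material, read as a map on `⨂ e, (ℂ^{d e})^{⊗n}`. -/
def route {k m L : ℕ} (l : Layout k m L) (n : ℕ) (d : Fin L → ℕ)
    (T : SuperOp (∀ i, Src l n d i) (∀ j, Dst l n d j)) : SuperOp (Mat n d) (Mat n d) :=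
  relabel (fun (y : Mat n d) j (e : {e : Fin L // l.rcv e = j}) => y e.1) ∘ₗ T ∘ₗ
    relabel (fun (x : ∀ i, Src l n d i) e => x (l.snd e) ⟨e, rfl⟩)

/-! ### Protocols -/

/-- Kinds of classical side communication between the group of senders and the group of receivers. -/
inductive Comm
  | none
  | forward
  | backward
  | twoWay

/-- No communication: local encodings, local decodings. -/
def IsPlainProtocol {k m L : ℕ} {a : Fin k → ℕ} {b : Fin m → ℕ} (l : Layout k m L)
    (Λ : NetMap a b) (n : ℕ) (d : Fin L → ℕ)
    (T : SuperOp (∀ i, Src l n d i) (∀ j, Dst l n d j)) : Prop :=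
  ∃ (E : ∀ i, SuperOp (Src l n d i) (Fin n → Fin (a i)))
    (D : ∀ j, SuperOp (Fin n → Fin (b j)) (Dst l n d j)),
    (∀ i, IsChannel (E i)) ∧ (∀ j, IsChannel (D j)) ∧
    T = tensorMap D ∘ₗ blockMap Λ n ∘ₗ tensorMap E

/-- Forward communication: sender `i` applies an instrument `(E i o)_o` and announces its outcome to
all receivers, whose decodings depend on the list of all announced outcomes. -/
def IsForwardProtocol {k m L : ℕ} {a : Fin k → ℕ} {b : Fin m → ℕ} (l : Layout k m L)
    (Λ : NetMap a b) (n : ℕ) (d : Fin L → ℕ)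
    (T : SuperOp (∀ i, Src l n d i) (∀ j, Dst l n d j)) : Prop :=
  ∃ (N : ℕ) (E : ∀ i, Fin N → SuperOp (Src l n d i) (Fin n → Fin (a i)))
    (D : ∀ j, (Fin k → Fin N) → SuperOp (Fin n → Fin (b j)) (Dst l n d j)),
    (∀ i o, IsCP (E i o)) ∧ (∀ i, IsTP (∑ o, E i o)) ∧ (∀ j o, IsChannel (D j o)) ∧
    T = ∑ o : Fin k → Fin N,
      tensorMap (fun j => D j o) ∘ₗ blockMap Λ n ∘ₗ tensorMap (fun i => E i (o i))

/-- The parties: senders (left) and receivers (right). -/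
abbrev Party (k m : ℕ) : Type := Fin k ⊕ Fin m

/-- `BackwardSees p q`: the measurement outcomes of `q` are known to `p` when only the receivers may
send messages, to the senders. -/
def BackwardSees {k m : ℕ} (p q : Party k m) : Prop :=
  p = q ∨ (p.isLeft = true ∧ q.isRight = true)

/-- With two-way communication all outcomes are known to everybody. -/
def TwoWaySees {k m : ℕ} (_ _ : Party k m) : Prop := True

/-- What a party knows of the outcomes of all earlier rounds. -/
abbrev View {k m : ℕ} (Sees : Party k m → Party k m → Prop) (N : ℕ) (p : Party k m) : Type :=
  List ({q : Party k m // Sees p q} → Fin N)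

/-- The part of the full record of outcomes (latest round first) that is visible to `p`. -/
def view {k m : ℕ} (Sees : Party k m → Party k m → Prop) {N : ℕ} (p : Party k m)
    (h : List (Party k m → Fin N)) : View Sees N p :=
  h.map fun o q => o q.1

/-- Dimension of a channel port in a round: a genuine port in transmission rounds (`true`), a trivial
one in rounds in which the parties only measure and exchange outcomes (`false`). -/
abbrev port (u : Bool) (d : ℕ) : ℕ := bif u then d else 1

/-- One use of the channel in transmission rounds, nothing (on the trivial ports) otherwise. -/
def portMap {k m : ℕ} {a : Fin k → ℕ} {b : Fin m → ℕ} (Λ : NetMap a b) :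
    (u : Bool) → NetMap (fun i => port u (a i)) (fun j => port u (b j))
  | true => Λ
  | false => (Matrix.traceLinearMap _ ℂ ℂ).smulRight 1

/-- An interactive protocol for `n` channel uses. The lab of every party is a quantum memory of
dimension `M`; senders load their material into it, receivers start in a fixed state. In each round
each party performs a measurement (given by its Kraus operators) which depends on the outcomes of
earlier rounds known to it. In a transmission round senders in addition emit a channel input,
and receivers process the channel output. Finally, receivers
map their memory, by a channel depending on the outcomes known to them, to the material they deliver,
and everything else is discarded. -/
structure Strategy {k m L : ℕ} (Sees : Party k m → Party k m → Prop) (a : Fin k → ℕ)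
    (b : Fin m → ℕ) (l : Layout k m L) (n : ℕ) (d : Fin L → ℕ) where
  M : ℕ
  N : ℕ
  rounds : List Bool
  uses : rounds.count true = n
  load : ∀ i, Matrix (Fin M) (Src l n d i) ℂ
  load_isometry : ∀ i, (load i)ᴴ * load i = 1
  start : Fin m → EuclideanSpace ℂ (Fin M)
  start_unit : ∀ j, ‖start j‖ = 1
  send : ∀ (i : Fin k) (u : Bool), View Sees N (.inl i) → Fin N →
    Matrix (Fin M × Fin (port u (a i))) (Fin M) ℂ
  send_complete : ∀ i u h, ∑ o, (send i u h o)ᴴ * send i u h o = 1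
  receive : ∀ (j : Fin m) (u : Bool), View Sees N (.inr j) → Fin N →
    Matrix (Fin M) (Fin M × Fin (port u (b j))) ℂ
  receive_complete : ∀ j u h, ∑ o, (receive j u h o)ᴴ * receive j u h o = 1
  deliver : ∀ j : Fin m, View Sees N (.inr j) → SuperOp (Fin M) (Dst l n d j)
  deliver_channel : ∀ j h, IsChannel (deliver j h)

namespace Strategy

variable {k m L : ℕ} {Sees : Party k m → Party k m → Prop} {a : Fin k → ℕ} {b : Fin m → ℕ}
  {l : Layout k m L} {n : ℕ} {d : Fin L → ℕ}

/-- Basis of the joint memory of all parties. -/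
abbrev Joint (S : Strategy Sees a b l n d) : Type := (Fin k → Fin S.M) × (Fin m → Fin S.M)

/-- Initial preparation: all senders load, all receivers take their fixed starting state. -/
def init (S : Strategy Sees a b l n d) : Matrix S.Joint (∀ i, Src l n d i) ℂ :=
  Matrix.of fun s x => (∏ i, S.load i (s.1 i) (x i)) * ∏ j, S.start j (s.2 j)

/-- Joint Kraus operator of the senders, `⨂ i, send i`, receivers being idle. -/
def sendKraus (S : Strategy Sees a b l n d) (u : Bool) (h : List (Party k m → Fin S.N))
    (o : Party k m → Fin S.N) : Matrix (S.Joint × ∀ i, Fin (port u (a i))) S.Joint ℂ :=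
  Matrix.of fun s s' =>
    (∏ i, S.send i u (view Sees (.inl i) h) (o (.inl i)) (s.1.1 i, s.2 i) (s'.1 i)) *
      if s.1.2 = s'.2 then 1 else 0

/-- Joint Kraus operator of the receivers, `⨂ j, receive j`, senders being idle. -/
def receiveKraus (S : Strategy Sees a b l n d) (u : Bool) (h : List (Party k m → Fin S.N))
    (o : Party k m → Fin S.N) : Matrix S.Joint (S.Joint × ∀ j, Fin (port u (b j))) ℂ :=
  Matrix.of fun s s' =>
    (∏ j, S.receive j u (view Sees (.inr j) h) (o (.inr j)) (s.2 j) (s'.1.2 j, s'.2 j)) *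
      if s.1 = s'.1.1 then 1 else 0

/-- The (unnormalised) effect of a round with outcomes `o` after the record `h`. -/
def round (S : Strategy Sees a b l n d) (Λ : NetMap a b) (u : Bool)
    (h : List (Party k m → Fin S.N)) (o : Party k m → Fin S.N) : SuperOp S.Joint S.Joint :=
  conjMap (S.receiveKraus u h o) ∘ₗ amplify S.Joint (portMap Λ u) ∘ₗ conjMap (S.sendKraus u h o)

/-- Partial trace over the memories of the senders. -/
def discard (S : Strategy Sees a b l n d) : SuperOp S.Joint (Fin m → Fin S.M) where
  toFun ρ := Matrix.of fun r r' => ∑ s, ρ (s, r) (s, r')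
  map_add' ρ σ := by
    ext r r'
    simp [Finset.sum_add_distrib]
  map_smul' c ρ := by
    ext r r'
    simp [Finset.mul_sum]

/-- The remaining rounds after the record `h`, summed over all outcomes, and the delivery. -/
def run (S : Strategy Sees a b l n d) (Λ : NetMap a b) :
    List Bool → List (Party k m → Fin S.N) → SuperOp S.Joint (∀ j, Dst l n d j)
  | [], h => tensorMap (fun j => S.deliver j (view Sees (.inr j) h)) ∘ₗ S.discard
  | u :: us, h => ∑ o, S.run Λ us (o :: h) ∘ₗ S.round Λ u h o

/-- The map implemented by the protocol. -/
def total (S : Strategy Sees a b l n d) (Λ : NetMap a b) :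
    SuperOp (∀ i, Src l n d i) (∀ j, Dst l n d j) :=
  S.run Λ S.rounds [] ∘ₗ conjMap S.init

end Strategy

/-- `T` can be obtained from `n` uses of `Λ` by a protocol with side communication of kind `C`. -/
def IsProtocol {k m L : ℕ} {a : Fin k → ℕ} {b : Fin m → ℕ} (l : Layout k m L)
    (Λ : NetMap a b) (n : ℕ) (d : Fin L → ℕ)
    (T : SuperOp (∀ i, Src l n d i) (∀ j, Dst l n d j)) : Comm → Prop
  | .none => IsPlainProtocol l Λ n d T
  | .forward => IsForwardProtocol l Λ n d T
  | .backward => ∃ S : Strategy BackwardSees a b l n d, T = S.total Λ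
  | .twoWay => ∃ S : Strategy TwoWaySees a b l n d, T = S.total Λ

/-! ### Fidelities -/

/-- `⟨ψ|σ|ψ⟩`. -/
def overlap {X : Type} [Fintype X] (ψ : X → ℂ) (σ : Matrix X X ℂ) : ℝ :=
  (star ψ ⬝ᵥ σ *ᵥ ψ).re

/-- `|ψ⟩⟨ψ|`. -/
def pureState {X : Type} (ψ : X → ℂ) : Matrix X X ℂ := vecMulVec ψ (star ψ)

/-- The product vector `⨂ e, ψ e`. -/
def prodVec {L n : ℕ} {d : Fin L → ℕ} (ψ : ∀ e, EuclideanSpace ℂ (Blk n (d e))) :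
    Mat n d → ℂ := fun x => ∏ e, ψ e (x e)

/-- Minimal subspace fidelity: the minimum, over product unit vectors from `⨂ e, H e`, of the
fidelity of transmission of that vector. -/
def subspaceFidelity {L n : ℕ} {d : Fin L → ℕ}
    (H : ∀ e, Submodule ℂ (EuclideanSpace ℂ (Blk n (d e)))) (N : SuperOp (Mat n d) (Mat n d)) : ℝ :=
  ⨅ ψ : {ψ : ∀ e, EuclideanSpace ℂ (Blk n (d e)) // ∀ e, ψ e ∈ H e ∧ ‖ψ e‖ = 1},
    overlap (prodVec ψ.1) (N (pureState (prodVec ψ.1)))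

/-- The vector `⨂ e, Ψ e`, reference systems first. -/
def prodBip {L n : ℕ} {d c : Fin L → ℕ} (Ψ : ∀ e, EuclideanSpace ℂ (Fin (c e) × Blk n (d e))) :
    (∀ e, Fin (c e)) × Mat n d → ℂ := fun x => ∏ e, Ψ e (x.1 e, x.2 e)

/-- Entanglement fidelity of bipartite states `Ψ e`, all second subsystems being sent. -/
def entanglementFidelity {L n : ℕ} {d c : Fin L → ℕ}
    (Ψ : ∀ e, EuclideanSpace ℂ (Fin (c e) × Blk n (d e))) (N : SuperOp (Mat n d) (Mat n d)) : ℝ :=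
  overlap (prodBip Ψ) (amplify (∀ e, Fin (c e)) N (pureState (prodBip Ψ)))

/-! ### Sources -/

/-- Reduced state of the second subsystem. -/
def reduced {R X : Type} [Fintype R] [Fintype X] (Ψ : EuclideanSpace ℂ (R × X)) : Matrix X X ℂ :=
  Matrix.of fun x x' => ∑ r, Ψ (r, x) * star (Ψ (r, x'))

theorem reduced_isHermitian {R X : Type} [Fintype R] [Fintype X] (Ψ : EuclideanSpace ℂ (R × X)) :
    (reduced Ψ).IsHermitian := by
  ext x x'
  simp [reduced, mul_comm]

/-- Von Neumann entropy, logarithm to base 2. -/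
def entropy {X : Type} [Fintype X] [DecidableEq X] {ρ : Matrix X X ℂ} (h : ρ.IsHermitian) : ℝ :=
  ∑ x, Real.negMulLog (h.eigenvalues x) / Real.log 2

/-- The `ε`-typical subspace of an `n`-block state of a source of entropy rate `S`. -/
def typicalSubspace {X : Type} [Fintype X] [DecidableEq X] (ρ : Matrix X X ℂ) (n : ℕ) (S ε : ℝ) :
    Submodule ℂ (EuclideanSpace ℂ X) :=
  Submodule.span ℂ {v | ∃ t : ℝ, (2 : ℝ) ^ (-(n * (S + ε))) ≤ t ∧ t ≤ (2 : ℝ) ^ (-(n * (S - ε))) ∧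
    toEuclideanLin ρ v = (t : ℂ) • v}

/-- `tr Π ρ Π`, with `Π` the projection onto the typical subspace. -/
def typicalWeight {X : Type} [Fintype X] [DecidableEq X] (ρ : Matrix X X ℂ) (n : ℕ) (S ε : ℝ) : ℝ :=
  (LinearMap.trace ℂ (EuclideanSpace ℂ X)
    ((typicalSubspace ρ n S ε).starProjection.toLinearMap ∘ₗ toEuclideanLin ρ ∘ₗ
      (typicalSubspace ρ n S ε).starProjection.toLinearMap)).re

/-- Quantum asymptotic equipartition property of a source with block states `ρ n` and entropy
rate `S`. -/
def IsQAEP {d : ℕ} (ρ : ∀ n, Matrix (Blk n d) (Blk n d) ℂ) (S : ℝ) : Prop :=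
  ∀ ε > 0, ∀ δ > 0, ∀ᶠ n in atTop, typicalWeight (ρ n) n S ε > 1 - δ

/-! ### Capacity regions -/

/-- Rate tuples achievable for subspace transmission with particles of dimensions `d`. -/
def subspaceRates {k m L : ℕ} {a : Fin k → ℕ} {b : Fin m → ℕ} (l : Layout k m L) (C : Comm)
    (Λ : NetMap a b) (d : Fin L → ℕ) : Set (Fin L → ℝ) :=
  {R | ∃ (T : ∀ n, SuperOp (∀ i, Src l n d i) (∀ j, Dst l n d j))
      (H : ∀ n e, Submodule ℂ (EuclideanSpace ℂ (Blk n (d e)))),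
      (∀ n, IsProtocol l Λ n d (T n) C) ∧ (∀ n e, H n e ≠ ⊥) ∧
      (∀ e, Tendsto (fun n : ℕ => Real.logb 2 (Module.finrank ℂ (H n e)) / n) atTop (𝓝 (R e))) ∧
      Tendsto (fun n => subspaceFidelity (H n) (route l n d (T n))) atTop (𝓝 1)}

/-- Rate tuples achievable for entanglement transmission, with QAEP sources of particles of
dimensions `d`. The `n`-block state of source `e` is the reduced state of the pure state `Ψ n e`. -/
def entanglementRates {k m L : ℕ} {a : Fin k → ℕ} {b : Fin m → ℕ} (l : Layout k m L) (C : Comm)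
    (Λ : NetMap a b) (d : Fin L → ℕ) : Set (Fin L → ℝ) :=
  {R | ∃ (T : ∀ n, SuperOp (∀ i, Src l n d i) (∀ j, Dst l n d j)) (c : ℕ → Fin L → ℕ)
      (Ψ : ∀ n e, EuclideanSpace ℂ (Fin (c n e) × Blk n (d e))),
      (∀ n, IsProtocol l Λ n d (T n) C) ∧ (∀ n e, ‖Ψ n e‖ = 1) ∧
      (∀ e, Tendsto (fun n : ℕ => entropy (reduced_isHermitian (Ψ n e)) / n) atTop (𝓝 (R e))) ∧
      (∀ e, IsQAEP (fun n => reduced (Ψ n e)) (R e)) ∧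
      Tendsto (fun n => entanglementFidelity (Ψ n) (route l n d (T n))) atTop (𝓝 1)}

/-- Capacity region for subspace transmission. -/
def subspaceRegion {k m L : ℕ} {a : Fin k → ℕ} {b : Fin m → ℕ} (l : Layout k m L) (C : Comm)
    (Λ : NetMap a b) : Set (Fin L → ℝ) := ⋃ d, subspaceRates l C Λ d

/-- Capacity region for entanglement transmission with QAEP sources. -/
def entanglementRegion {k m L : ℕ} {a : Fin k → ℕ} {b : Fin m → ℕ} (l : Layout k m L) (C : Comm)
    (Λ : NetMap a b) : Set (Fin L → ℝ) := ⋃ d, entanglementRates l C Λ d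

end QNet

end

/-!
Both inclusions keep the protocol. A protocol, of whatever kind of communication, enters only
through the fact that the map `N` it implements is a channel (`IsProtocol.isChannel`), so `N` has
Kraus operators `K a`. The fidelity of a vector `ψ` is the squared norm of its vector of
amplitudes `(⟨ψ|K a|ψ⟩)_a` (`overlap_prodVec`), and the entanglement fidelity of a product source
is the squared norm of the average of the amplitude vectors of the products of eigenvectors
(`entanglementFidelity_eq`). Amplitude vectors have norm at most one for unit `ψ`.

From subspaces to entanglement (`subspaceRates_subset`): the sources are the maximally entangled
states of the given subspaces, whose spectrum is flat, so that entropy and the equipartition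
property are immediate. If `x ⊥ y` are unit vectors and `x`, `y` and `(x + y)/√2` are transmitted
well, then the amplitude vectors of `x` and `y` are close (`norm_sq_amplitude_sub_le`). This
applies to products `x`, `y` which differ in one factor, since `(x + y)/√2` is then a product,
too. Exchanging basis vectors one factor at a time, all amplitude vectors of product basis vectors
are close to each other; their average therefore has norm near one.

From entanglement to subspaces (`entanglementRates_subset`): a superposition of the Kraus
operators is a contraction `A` such that `M ψ = (1 - A) (⨂ e, ψ e) / 2` is small in mean square
over the products of eigenvectors of the sources, weighted by the eigenvalues
(`exists_contraction_of_entanglementFidelity`). If `M` is uniformly small on the product unit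
vectors of `⨂ e, H e`, then these are transmitted well. Such subspaces are found at random
(`exists_product_subspaces`): `H e` is spanned by vectors `∑ x, ± √(p x) u x` with independent
random signs, `u` the eigenbasis and `p` the eigenvalues, cut off above the typical range and
normalised. With the other factors fixed, `‖M ψ‖ ^ 2` is a quadratic form in the signs, with mean
bounded by the average above, and it is concentrated exponentially (`exists_signs`), at a scale
given by the inverse of the largest eigenvalue, `2 ^ (n (R - η))`. This beats the number of points
in a net of the product unit sphere as soon as the dimensions are at most `2 ^ (n (R - 2η))`
(`eventually_net_lt_exp`). The factors are randomised one after the other. The random vectors are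
not orthonormal, but the part of their span on which the embedding is bounded below has dimension
proportional to theirs (`exists_subspace_bounded_below`). A transmission whose rate is too small
for this argument uses a single eigenvector, chosen by averaging (`exists_single_of_sum_prod`).
This gives rates within a multiple of `η` for each `η > 0`, and `η` is finally sent to zero
slowly.
-/

noncomputable section

namespace QNet

/-! ### Protocols implement channels -/

section CP

variable {X Y Z : Type}

theorem isCP_sum_conjMap [Fintype X] {κ : Type} [Fintype κ] (K : κ → Matrix Y X ℂ) :
    IsCP (∑ a, conjMap (K a)) :=
  ⟨Fintype.card κ, fun a => K ((Fintype.equivFin κ).symm a),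
    ((Fintype.equivFin κ).symm.sum_comp fun a => conjMap (K a)).symm⟩

theorem isCP_conjMap [Fintype X] (K : Matrix Y X ℂ) : IsCP (conjMap K) := by
  simpa using isCP_sum_conjMap fun _ : Unit => K

theorem IsCP.sum [Fintype X] {κ : Type} [Fintype κ] {Φ : κ → SuperOp X Y}
    (h : ∀ a, IsCP (Φ a)) : IsCP (∑ a, Φ a) := by
  choose r K hK using h
  have := isCP_sum_conjMap fun q : (Σ a, Fin (r a)) => K q.1 q.2
  rw [Fintype.sum_sigma] at this
  simpa only [← hK] using this

theorem conjMap_comp [Fintype X] [Fintype Y] (K : Matrix Z Y ℂ) (K' : Matrix Y X ℂ) :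
    conjMap K ∘ₗ conjMap K' = conjMap (K * K') := by
  ext1 ρ
  simp [conjMap, Matrix.conjTranspose_mul, Matrix.mul_assoc]

theorem IsCP.comp [Fintype X] [Fintype Y] {Φ : SuperOp Y Z} {Φ' : SuperOp X Y} (h : IsCP Φ)
    (h' : IsCP Φ') : IsCP (Φ ∘ₗ Φ') := by
  obtain ⟨r, K, rfl⟩ := h
  obtain ⟨r', K', rfl⟩ := h'
  have : (∑ a, conjMap (K a)) ∘ₗ (∑ a, conjMap (K' a)) =
      ∑ q : Fin r × Fin r', conjMap (K q.1 * K' q.2) := by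
    ext1 ρ
    simp_rw [← conjMap_comp]
    rw [Fintype.sum_prod_type]
    simp only [LinearMap.comp_apply, LinearMap.sum_apply, map_sum]
    rw [Finset.sum_comm]
  rw [this]
  exact isCP_sum_conjMap _

theorem IsTP.comp [Fintype X] [Fintype Y] [Fintype Z] {Φ : SuperOp Y Z} {Φ' : SuperOp X Y}
    (h : IsTP Φ) (h' : IsTP Φ') : IsTP (Φ ∘ₗ Φ') := fun ρ => (h _).trans (h' ρ)

theorem IsChannel.comp [Fintype X] [Fintype Y] [Fintype Z] {Φ : SuperOp Y Z} {Φ' : SuperOp X Y}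
    (h : IsChannel Φ) (h' : IsChannel Φ') : IsChannel (Φ ∘ₗ Φ') :=
  ⟨h.1.comp h'.1, h.2.comp h'.2⟩

/-- A relabelling is completely positive along any map `f`, with a single Kraus operator;
bijectivity of `f` matters for the preservation of the trace only. -/
theorem relabel_eq_conjMap [Fintype X] [DecidableEq X] (f : Y → X) :
    relabel f = conjMap (Matrix.of fun y x => if f y = x then (1 : ℂ) else 0) := by
  ext1 ρ
  ext y y'
  change ρ (f y) (f y') = _
  simp [conjMap, Matrix.mul_apply]

theorem isChannel_relabel [Fintype X] [Fintype Y] [DecidableEq X] {f : Y → X}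
    (hf : f.Bijective) : IsChannel (relabel f) := by
  refine ⟨?_, fun ρ => ?_⟩
  · rw [relabel_eq_conjMap]
    exact isCP_conjMap _
  · exact (Equiv.ofBijective f hf).sum_comp fun x => ρ x x

theorem IsCP.amplify {R : Type} [Fintype R] [DecidableEq R] [Fintype X] {Φ : SuperOp X Y}
    (h : IsCP Φ) : IsCP (amplify R Φ) := by
  obtain ⟨r, K, rfl⟩ := h
  have : QNet.amplify R (∑ a, conjMap (K a)) =
      ∑ a, conjMap (Matrix.of fun (u : R × Y) (v : R × X) =>
        if u.1 = v.1 then K a u.2 v.2 else 0) := by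
    ext1 ρ
    ext u v
    simp only [QNet.amplify, LinearMap.coe_mk, AddHom.coe_mk, Matrix.of_apply, LinearMap.sum_apply,
      Matrix.sum_apply]
    refine Finset.sum_congr rfl fun a _ => ?_
    simp [conjMap, Matrix.mul_apply, Fintype.sum_prod_type, apply_ite]
  rw [this]
  exact isCP_sum_conjMap _

theorem IsTP.amplify {R : Type} [Fintype R] [Fintype X] [Fintype Y] {Φ : SuperOp X Y}
    (h : IsTP Φ) : IsTP (amplify R Φ) := by
  intro ρ
  simp only [Matrix.trace, Matrix.diag_apply, Fintype.sum_prod_type, QNet.amplify,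
    LinearMap.coe_mk, AddHom.coe_mk, Matrix.of_apply]
  exact Finset.sum_congr rfl fun r _ => h _

theorem trace_conjMap [Fintype X] [Fintype Y] (K : Matrix Y X ℂ) (ρ : Matrix X X ℂ) :
    (conjMap K ρ).trace = (Kᴴ * K * ρ).trace := by
  simp only [conjMap, LinearMap.coe_mk, AddHom.coe_mk]
  rw [Matrix.trace_mul_comm, Matrix.mul_assoc]

end CP

section Tensor

variable {ι : Type} [Fintype ι] [DecidableEq ι] {X Y : ι → Type} [∀ i, Fintype (X i)]
  [∀ i, DecidableEq (X i)]

theorem sum_conjMap_single_apply {X Y : Type} [Fintype X] [DecidableEq X] {r : ℕ}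
    (K : Fin r → Matrix Y X ℂ) (x x' : X) (y y' : Y) :
    (∑ a, conjMap (K a)) (Matrix.single x x' 1) y y' = ∑ a, K a y x * star (K a y' x') := by
  simp only [LinearMap.sum_apply, Matrix.sum_apply]
  refine Finset.sum_congr rfl fun a _ => ?_
  simp [conjMap, Matrix.mul_apply, Matrix.single_apply, ite_and]

theorem sum_tensorMap {κ : Type} [Fintype κ] (Φ : ∀ i, κ → SuperOp (X i) (Y i)) :
    ∑ o : ι → κ, tensorMap (fun i => Φ i (o i)) = tensorMap fun i => ∑ o, Φ i o := by
  ext1 ρ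
  ext y y'
  simp only [tensorMap, LinearMap.sum_apply, Matrix.sum_apply, LinearMap.coe_mk, AddHom.coe_mk,
    Matrix.of_apply]
  rw [Finset.sum_comm]
  refine Finset.sum_congr rfl fun x _ => ?_
  rw [Finset.sum_comm]
  refine Finset.sum_congr rfl fun x' _ => ?_
  rw [← Finset.sum_mul, Finset.prod_univ_sum, Fintype.piFinset_univ]

theorem isCP_tensorMap {Φ : ∀ i, SuperOp (X i) (Y i)} (h : ∀ i, IsCP (Φ i)) :
    IsCP (tensorMap Φ) := by
  choose r K hK using h
  obtain rfl : Φ = fun i => ∑ a, conjMap (K i a) := funext hK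
  have : tensorMap (fun i => ∑ a, conjMap (K i a)) =
      ∑ a : ∀ i, Fin (r i), conjMap (Matrix.of fun (y : ∀ i, Y i) (x : ∀ i, X i) =>
        ∏ i, K i (a i) (y i) (x i)) := by
    ext1 ρ
    ext y y'
    simp only [tensorMap, LinearMap.coe_mk, AddHom.coe_mk, Matrix.of_apply,
      sum_conjMap_single_apply, LinearMap.sum_apply, Matrix.sum_apply]
    simp only [conjMap, LinearMap.coe_mk, AddHom.coe_mk, Matrix.mul_apply, Matrix.of_apply,
      Matrix.conjTranspose_apply, star_prod, Finset.sum_mul]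
    simp only [Finset.prod_univ_sum, Fintype.piFinset_univ, Finset.prod_mul_distrib,
      Finset.sum_mul]
    rw [Finset.sum_comm]
    conv_rhs => rw [Finset.sum_comm]
    refine Finset.sum_congr rfl fun x' _ => ?_
    rw [Finset.sum_comm]
    exact Finset.sum_congr rfl fun a _ => Finset.sum_congr rfl fun x _ => by ring
  rw [this]
  exact isCP_sum_conjMap _

theorem isTP_tensorMap [∀ i, Fintype (Y i)] {Φ : ∀ i, SuperOp (X i) (Y i)}
    (h : ∀ i, IsTP (Φ i)) : IsTP (tensorMap Φ) := by
  intro ρ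
  simp only [Matrix.trace, Matrix.diag_apply, tensorMap, LinearMap.coe_mk, AddHom.coe_mk,
    Matrix.of_apply]
  rw [Finset.sum_comm]
  refine Finset.sum_congr rfl fun x _ => ?_
  rw [Finset.sum_comm]
  have h1 : ∀ x' : ∀ i, X i, ∑ y : ∀ i, Y i,
      (∏ i, Φ i (Matrix.single (x i) (x' i) 1) (y i) (y i)) * ρ x x' =
        if x = x' then ρ x x' else 0 := by
    intro x'
    have h2 := Finset.prod_univ_sum (fun i => (Finset.univ : Finset (Y i)))
      fun i y => Φ i (Matrix.single (x i) (x' i) 1) y y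
    rw [Fintype.piFinset_univ] at h2
    rw [← Finset.sum_mul, ← h2]
    have h3 : ∀ i, ∑ y, Φ i (Matrix.single (x i) (x' i) 1) y y = if x i = x' i then 1 else 0 := by
      intro i
      have := h i (Matrix.single (x i) (x' i) 1)
      simp only [Matrix.trace, Matrix.diag_apply] at this
      rw [this]
      simp [Matrix.single_apply, ite_and, eq_comm]
    simp_rw [h3, Finset.prod_ite_zero, Finset.prod_const_one, ite_mul, one_mul, zero_mul]
    simp [funext_iff]
  simp_rw [h1]
  simp

theorem isChannel_tensorMap [∀ i, Fintype (Y i)] {Φ : ∀ i, SuperOp (X i) (Y i)}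
    (h : ∀ i, IsChannel (Φ i)) : IsChannel (tensorMap Φ) :=
  ⟨isCP_tensorMap fun i => (h i).1, isTP_tensorMap fun i => (h i).2⟩

/-- Tensor products of complete families of Kraus operators are complete, in terms of matrix
elements. The output index is split into two parts `p` and `p'`, the memory and the channel port.
-/
theorem sum_prod_star_mul_prod {κ : Type} [Fintype κ] {P P' Q : ι → Type} [∀ i, Fintype (P i)]
    [∀ i, Fintype (P' i)] [∀ i, DecidableEq (Q i)] (A : ∀ i, κ → P i → P' i → Q i → ℂ)
    (hA : ∀ i q q', ∑ o, ∑ p, ∑ p', star (A i o p p' q) * A i o p p' q' =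
      if q = q' then 1 else 0) (q q' : ∀ i, Q i) :
    ∑ o : ι → κ, ∑ p : ∀ i, P i, ∑ p' : ∀ i, P' i, star (∏ i, A i (o i) (p i) (p' i) (q i)) *
      ∏ i, A i (o i) (p i) (p' i) (q' i) = if q = q' then 1 else 0 := by
  have h : ∀ i, ∑ o, ∑ p, ∑ p', star (A i o p p' (q i)) * A i o p p' (q' i) =
      if q i = q' i then 1 else 0 := fun i => hA i _ _
  have h' := Finset.prod_congr (rfl : (Finset.univ : Finset ι) = _) fun i _ => h i
  simp only [Finset.prod_univ_sum, Fintype.piFinset_univ, Finset.prod_ite_zero,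
    Finset.prod_const_one, Finset.prod_mul_distrib] at h'
  simp only [star_prod, h']
  simp [funext_iff]

end Tensor

section Protocol

variable {k m L : ℕ} {a : Fin k → ℕ} {b : Fin m → ℕ} {l : Layout k m L} {n : ℕ} {d : Fin L → ℕ}

theorem swap_bijective {α β : Type} {γ : α → Type} :
    Function.Bijective fun (x : ∀ i, β → γ i) (t : β) (i : α) => x i t :=
  ⟨fun x x' h => by
    funext i t
    exact congrFun (congrFun h t) i, fun y => ⟨fun i t => y t i, rfl⟩⟩

theorem swap_bijective' {α β : Type} {γ : α → Type} :
    Function.Bijective fun (x : β → ∀ i, γ i) (i : α) (t : β) => x t i :=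
  ⟨fun x x' h => by
    funext i t
    exact congrFun (congrFun h t) i, fun y => ⟨fun i t => y t i, rfl⟩⟩

theorem isChannel_blockMap {Λ : NetMap a b} (hΛ : IsChannel Λ) (n : ℕ) :
    IsChannel (blockMap Λ n) :=
  (isChannel_relabel swap_bijective).comp
    ((isChannel_tensorMap fun _ => hΛ).comp (isChannel_relabel swap_bijective'))

theorem isChannel_route {T : SuperOp (∀ i, Src l n d i) (∀ j, Dst l n d j)} (hT : IsChannel T) :
    IsChannel (route l n d T) := by
  refine (isChannel_relabel ⟨fun x x' h => ?_, fun y => ?_⟩).comp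
    (hT.comp (isChannel_relabel ⟨fun x x' h => ?_, fun y => ?_⟩))
  · funext e
    exact congrFun (congrFun h (l.rcv e)) ⟨e, rfl⟩
  · refine ⟨fun e => y (l.rcv e) ⟨e, rfl⟩, ?_⟩
    funext j ⟨e, he⟩
    subst he
    rfl
  · funext i ⟨e, he⟩
    subst he
    exact congrFun h e
  · exact ⟨fun i e => y e.1, rfl⟩

theorem isChannel_portMap {Λ : NetMap a b} (hΛ : IsChannel Λ) (u : Bool) :
    IsChannel (portMap Λ u) := by
  cases u with
  | true => exact hΛ
  | false =>
    have : ∀ i, Unique (Fin (port false (a i))) := fun i => inferInstanceAs (Unique (Fin 1))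
    have : ∀ j, Unique (Fin (port false (b j))) := fun j => inferInstanceAs (Unique (Fin 1))
    refine ⟨?_, fun ρ => ?_⟩
    · have : portMap Λ false = conjMap (Matrix.of fun _ _ => 1) := by
        ext1 ρ
        ext y y'
        obtain rfl : y = y' := Subsingleton.elim _ _
        simp [portMap, conjMap, Matrix.mul_apply, Matrix.trace]
      rw [this]
      exact isCP_conjMap _
    · simp [portMap, Matrix.trace]

theorem IsPlainProtocol.isChannel {Λ : NetMap a b} (hΛ : IsChannel Λ)
    {T : SuperOp (∀ i, Src l n d i) (∀ j, Dst l n d j)} (h : IsPlainProtocol l Λ n d T) :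
    IsChannel T := by
  obtain ⟨E, D, hE, hD, rfl⟩ := h
  exact (isChannel_tensorMap hD).comp ((isChannel_blockMap hΛ n).comp (isChannel_tensorMap hE))

theorem IsForwardProtocol.isChannel {Λ : NetMap a b} (hΛ : IsChannel Λ)
    {T : SuperOp (∀ i, Src l n d i) (∀ j, Dst l n d j)} (h : IsForwardProtocol l Λ n d T) :
    IsChannel T := by
  obtain ⟨N, E, D, hE, hE', hD, rfl⟩ := h
  refine ⟨IsCP.sum fun o => (isCP_tensorMap fun j => (hD j o).1).comp
    ((isChannel_blockMap hΛ n).1.comp (isCP_tensorMap fun i => hE i (o i))), fun ρ => ?_⟩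
  rw [LinearMap.sum_apply, Matrix.trace_sum]
  have h1 : ∀ o : Fin k → Fin N, ((tensorMap (fun j => D j o) ∘ₗ blockMap Λ n ∘ₗ
      tensorMap fun i => E i (o i)) ρ).trace = (tensorMap (fun i => E i (o i)) ρ).trace := by
    intro o
    exact ((isTP_tensorMap fun j => (hD j o).2) _).trans ((isChannel_blockMap hΛ n).2 _)
  simp_rw [h1]
  rw [← Matrix.trace_sum, ← LinearMap.sum_apply, sum_tensorMap]
  exact isTP_tensorMap hE' ρ

namespace Strategy

variable {Sees : Party k m → Party k m → Prop} (S : Strategy Sees a b l n d)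

theorem isChannel_discard : IsChannel S.discard := by
  refine ⟨?_, fun ρ => ?_⟩
  · have : S.discard = ∑ s : Fin k → Fin S.M, conjMap (Matrix.of
        fun (r : Fin m → Fin S.M) (q : S.Joint) => if q.1 = s ∧ q.2 = r then (1 : ℂ) else 0) := by
      ext1 ρ
      ext r r'
      simp [discard, conjMap, Matrix.mul_apply, Matrix.sum_apply, LinearMap.sum_apply,
        Fintype.sum_prod_type, ite_and, apply_ite (starRingEnd ℂ)]
    rw [this]
    exact isCP_sum_conjMap _
  · simp only [discard, LinearMap.coe_mk, AddHom.coe_mk, Matrix.trace, Matrix.diag_apply,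
      Matrix.of_apply, Fintype.sum_prod_type]
    rw [Finset.sum_comm]

theorem init_isometry : S.initᴴ * S.init = 1 := by
  ext x x'
  have h1 : ∀ i, ∑ s, star (S.load i s (x i)) * S.load i s (x' i) =
      if x i = x' i then 1 else 0 := by
    intro i
    have := congrFun (congrFun (S.load_isometry i) (x i)) (x' i)
    simpa [Matrix.mul_apply, Matrix.one_apply] using this
  have h2 : ∀ j, ∑ s, star (S.start j s) * S.start j s = 1 := by
    intro j
    have h3 : ‖S.start j‖ ^ 2 = 1 := by rw [S.start_unit, one_pow]
    rw [EuclideanSpace.norm_sq_eq] at h3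
    have h4 : ∀ s, star (S.start j s) * S.start j s = ((‖S.start j s‖ ^ 2 : ℝ) : ℂ) := by
      intro s
      rw [← Complex.normSq_eq_norm_sq, Complex.normSq_eq_conj_mul_self]
      rfl
    simp_rw [h4]
    rw [← Complex.ofReal_sum, h3, Complex.ofReal_one]
  simp only [Matrix.mul_apply, Matrix.conjTranspose_apply, init, Matrix.of_apply,
    Fintype.sum_prod_type, star_mul', star_prod]
  have h5 : ∀ (s : Fin k → Fin S.M) (t : Fin m → Fin S.M),
      ((∏ i, star (S.load i (s i) (x i))) * ∏ j, star (S.start j (t j))) *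
        ((∏ i, S.load i (s i) (x' i)) * ∏ j, S.start j (t j)) =
      (∏ i, star (S.load i (s i) (x i)) * S.load i (s i) (x' i)) *
        ∏ j, star (S.start j (t j)) * S.start j (t j) := by
    intro s t
    rw [Finset.prod_mul_distrib, Finset.prod_mul_distrib]
    ring
  simp_rw [h5]
  rw [← Finset.sum_mul_sum]
  have h6 := Finset.prod_univ_sum (fun _ : Fin k => (Finset.univ : Finset (Fin S.M)))
    fun i s => star (S.load i s (x i)) * S.load i s (x' i)
  have h7 := Finset.prod_univ_sum (fun _ : Fin m => (Finset.univ : Finset (Fin S.M)))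
    fun j s => star (S.start j s) * S.start j s
  rw [Fintype.piFinset_univ] at h6 h7
  rw [← h6, ← h7]
  simp_rw [h1, h2, Finset.prod_ite_zero, Finset.prod_const_one, mul_one, Matrix.one_apply,
    funext_iff]
  simp

/-- The joint Kraus operator of the senders as a function of their own outcomes alone. -/
def senderKraus (u : Bool) (h : List (Party k m → Fin S.N)) (o : Fin k → Fin S.N) :
    Matrix (S.Joint × ∀ i, Fin (port u (a i))) S.Joint ℂ :=
  Matrix.of fun s s' =>
    (∏ i, S.send i u (view Sees (.inl i) h) (o i) (s.1.1 i, s.2 i) (s'.1 i)) *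
      if s.1.2 = s'.2 then 1 else 0

theorem sum_senderKraus (u : Bool) (h : List (Party k m → Fin S.N)) :
    ∑ o : Fin k → Fin S.N, (S.senderKraus u h o)ᴴ * S.senderKraus u h o = 1 := by
  ext t t'
  have h1 := sum_prod_star_mul_prod
    (fun i o (p : Fin S.M) (p' : Fin (port u (a i))) q =>
      S.send i u (view Sees (.inl i) h) o (p, p') q) (fun i q q' => by
        have := congrFun (congrFun (S.send_complete i u (view Sees (.inl i) h)) q) q'
        simpa [Matrix.mul_apply, Matrix.one_apply, Fintype.sum_prod_type, Matrix.sum_apply]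
          using this) t.1 t'.1
  simp only [Matrix.sum_apply, Matrix.mul_apply, Matrix.conjTranspose_apply, senderKraus,
    Matrix.of_apply, Fintype.sum_prod_type]
  have h2 : ∀ (o : Fin k → Fin S.N) (p : Fin k → Fin S.M),
      ∑ s₂ : Fin m → Fin S.M, ∑ p' : ∀ i, Fin (port u (a i)),
        star ((∏ i, S.send i u (view Sees (.inl i) h) (o i) (p i, p' i) (t.1 i)) *
          if s₂ = t.2 then 1 else 0) *
        ((∏ i, S.send i u (view Sees (.inl i) h) (o i) (p i, p' i) (t'.1 i)) *
          if s₂ = t'.2 then 1 else 0) =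
      (∑ p' : ∀ i, Fin (port u (a i)),
        star (∏ i, S.send i u (view Sees (.inl i) h) (o i) (p i, p' i) (t.1 i)) *
        ∏ i, S.send i u (view Sees (.inl i) h) (o i) (p i, p' i) (t'.1 i)) *
          if t.2 = t'.2 then 1 else 0 := by
    intro o p
    rw [Finset.sum_eq_single t.2]
    · rw [Finset.sum_mul]
      refine Finset.sum_congr rfl fun p' _ => ?_
      simp
    · intro s₂ _ hs
      simp [hs]
    · simp
  simp_rw [h2, ← Finset.sum_mul]
  rw [h1, Matrix.one_apply]
  by_cases ht1 : t.1 = t'.1 <;> by_cases ht2 : t.2 = t'.2 <;> simp [Prod.ext_iff, ht1, ht2]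

/-- The receivers' joint operators are complete for every fixed list of outcomes of the senders,
as the measurements in a round depend on the outcomes of earlier rounds only. -/
theorem sum_receiveKraus (u : Bool) (h : List (Party k m → Fin S.N)) (o : Fin k → Fin S.N) :
    ∑ o' : Fin m → Fin S.N,
      (S.receiveKraus u h (Sum.elim o o'))ᴴ * S.receiveKraus u h (Sum.elim o o') = 1 := by
  ext t t'
  have h1 := sum_prod_star_mul_prod
    (fun j o (p : Fin S.M) (_ : Unit) q =>
      S.receive j u (view Sees (.inr j) h) o p q) (fun j q q' => by
        have := congrFun (congrFun (S.receive_complete j u (view Sees (.inr j) h)) q) q'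
        simpa [Matrix.mul_apply, Matrix.one_apply, Matrix.sum_apply]
          using this) (fun j => (t.1.2 j, t.2 j)) (fun j => (t'.1.2 j, t'.2 j))
  simp only [Fintype.sum_unique] at h1
  simp only [Matrix.sum_apply, Matrix.mul_apply, Matrix.conjTranspose_apply, receiveKraus,
    Matrix.of_apply, Fintype.sum_prod_type, Sum.elim_inr]
  have h2 : ∀ (o' : Fin m → Fin S.N),
      ∑ s₁ : Fin k → Fin S.M, ∑ p : Fin m → Fin S.M,
        star ((∏ j, S.receive j u (view Sees (.inr j) h) (o' j) (p j) (t.1.2 j, t.2 j)) *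
          if s₁ = t.1.1 then 1 else 0) *
        ((∏ j, S.receive j u (view Sees (.inr j) h) (o' j) (p j) (t'.1.2 j, t'.2 j)) *
          if s₁ = t'.1.1 then 1 else 0) =
      (∑ p : Fin m → Fin S.M,
        star (∏ j, S.receive j u (view Sees (.inr j) h) (o' j) (p j) (t.1.2 j, t.2 j)) *
        ∏ j, S.receive j u (view Sees (.inr j) h) (o' j) (p j) (t'.1.2 j, t'.2 j)) *
          if t.1.1 = t'.1.1 then 1 else 0 := by
    intro o'
    rw [Finset.sum_eq_single t.1.1]
    · rw [Finset.sum_mul]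
      refine Finset.sum_congr rfl fun p' _ => ?_
      simp
    · intro s₁ _ hs
      simp [hs]
    · simp
  simp_rw [h2, ← Finset.sum_mul]
  rw [h1, Matrix.one_apply]
  have h3 : (fun j => (t.1.2 j, t.2 j)) = (fun j => (t'.1.2 j, t'.2 j)) ↔
      t.1.2 = t'.1.2 ∧ t.2 = t'.2 := by
    simp only [funext_iff, Prod.mk.injEq, forall_and]
  simp only [h3]
  by_cases ht1 : t.1.1 = t'.1.1 <;> by_cases ht2 : t.1.2 = t'.1.2 <;>
    by_cases ht3 : t.2 = t'.2 <;> simp [Prod.ext_iff, ht1, ht2, ht3]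

/-- A round preserves the trace on summing over outcomes: first those of the receivers, for fixed
outcomes of the senders, then the latter, the channel in between being trace preserving. -/
theorem sum_trace_round {Λ : NetMap a b} (hΛ : IsChannel Λ) (u : Bool)
    (h : List (Party k m → Fin S.N)) (ρ : Matrix S.Joint S.Joint ℂ) :
    ∑ o, (S.round Λ u h o ρ).trace = ρ.trace := by
  rw [← (Equiv.sumArrowEquivProdArrow (Fin k) (Fin m) (Fin S.N)).symm.sum_comp,
    Fintype.sum_prod_type]
  have h1 : ∀ o o', (S.round Λ u h ((Equiv.sumArrowEquivProdArrow (Fin k) (Fin m)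
      (Fin S.N)).symm (o, o')) ρ).trace =
      ((S.receiveKraus u h (Sum.elim o o'))ᴴ * S.receiveKraus u h (Sum.elim o o') *
        amplify S.Joint (portMap Λ u) (conjMap (S.senderKraus u h o) ρ)).trace := by
    intro o o'
    rw [← trace_conjMap]
    rfl
  simp_rw [h1, ← Matrix.trace_sum, ← Finset.sum_mul, S.sum_receiveKraus, Matrix.one_mul,
    Matrix.trace_sum]
  have h2 : ∀ o, (amplify S.Joint (portMap Λ u) (conjMap (S.senderKraus u h o) ρ)).trace =
      ((S.senderKraus u h o)ᴴ * S.senderKraus u h o * ρ).trace := by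
    intro o
    rw [← trace_conjMap]
    exact (isChannel_portMap hΛ u).2.amplify _
  simp_rw [h2]
  rw [← Matrix.trace_sum, ← Finset.sum_mul, S.sum_senderKraus, Matrix.one_mul]

theorem isChannel_run {Λ : NetMap a b} (hΛ : IsChannel Λ) (us : List Bool) :
    ∀ h : List (Party k m → Fin S.N), IsChannel (S.run Λ us h) := by
  induction us with
  | nil =>
    intro h
    exact (isChannel_tensorMap fun j => S.deliver_channel j _).comp S.isChannel_discard
  | cons u us ih =>
    intro h
    refine ⟨IsCP.sum fun o => (ih (o :: h)).1.comp ((isCP_conjMap _).comp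
      ((isChannel_portMap hΛ u).1.amplify.comp (isCP_conjMap _))), fun ρ => ?_⟩
    rw [← S.sum_trace_round hΛ u h ρ]
    simp only [run, LinearMap.sum_apply, Matrix.trace_sum, LinearMap.comp_apply]
    exact Finset.sum_congr rfl fun o _ => (ih (o :: h)).2 _

theorem isChannel_total {Λ : NetMap a b} (hΛ : IsChannel Λ) : IsChannel (S.total Λ) := by
  refine (S.isChannel_run hΛ _ _).comp ⟨isCP_conjMap _, fun ρ => ?_⟩
  rw [trace_conjMap, S.init_isometry, Matrix.one_mul]

end Strategy

theorem IsProtocol.isChannel {Λ : NetMap a b} (hΛ : IsChannel Λ)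
    {T : SuperOp (∀ i, Src l n d i) (∀ j, Dst l n d j)} {C : Comm} (h : IsProtocol l Λ n d T C) :
    IsChannel T := by
  cases C with
  | none => exact IsPlainProtocol.isChannel hΛ h
  | forward => exact IsForwardProtocol.isChannel hΛ h
  | backward =>
    obtain ⟨S, rfl⟩ := h
    exact S.isChannel_total hΛ
  | twoWay =>
    obtain ⟨S, rfl⟩ := h
    exact S.isChannel_total hΛ

end Protocol

/-! ### Product vectors and fidelities -/

section Tensor

variable {ι : Type} [Fintype ι] {X : ι → Type}

/-- The product vector `⨂ e, ψ e` as a multilinear function of its factors. -/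
def tensorVec : MultilinearMap ℂ (fun e => EuclideanSpace ℂ (X e))
    (EuclideanSpace ℂ (∀ e, X e)) :=
  { toFun := fun ψ => WithLp.toLp 2 fun x => ∏ e, ψ e (x e)
    map_update_add' := by
      intro dec ψ e v v'
      ext x
      simp only [PiLp.add_apply]
      rw [← Finset.mul_prod_erase _ _ (Finset.mem_univ e),
        ← Finset.mul_prod_erase _ _ (Finset.mem_univ e),
        ← Finset.mul_prod_erase _ _ (Finset.mem_univ e)]
      simp only [Function.update_self, PiLp.add_apply, add_mul]
      congr 2 <;>
      exact Finset.prod_congr rfl fun f hf => by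
        simp [Function.update_of_ne (Finset.ne_of_mem_erase hf)]
    map_update_smul' := by
      intro dec ψ e c v
      ext x
      simp only [PiLp.smul_apply]
      rw [← Finset.mul_prod_erase _ _ (Finset.mem_univ e),
        ← Finset.mul_prod_erase _ _ (Finset.mem_univ e)]
      simp only [Function.update_self, PiLp.smul_apply, smul_eq_mul, mul_assoc]
      congr 2
      exact Finset.prod_congr rfl fun f hf => by
        simp [Function.update_of_ne (Finset.ne_of_mem_erase hf)] }

theorem tensorVec_apply (ψ : ∀ e, EuclideanSpace ℂ (X e)) (x : ∀ e, X e) :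
    tensorVec ψ x = ∏ e, ψ e (x e) := rfl

theorem inner_tensorVec [DecidableEq ι] [∀ e, Fintype (X e)]
    (ψ φ : ∀ e, EuclideanSpace ℂ (X e)) :
    inner ℂ (tensorVec ψ) (tensorVec φ) = ∏ e, inner ℂ (ψ e) (φ e) := by
  simp only [PiLp.inner_apply, tensorVec_apply]
  rw [Finset.prod_univ_sum, Fintype.piFinset_univ]
  refine Finset.sum_congr rfl fun x _ => ?_
  simp [Finset.prod_mul_distrib]

theorem norm_tensorVec [DecidableEq ι] [∀ e, Fintype (X e)]
    (ψ : ∀ e, EuclideanSpace ℂ (X e)) : ‖tensorVec ψ‖ = ∏ e, ‖ψ e‖ := by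
  have h : ((‖tensorVec ψ‖ ^ 2 : ℝ) : ℂ) = (((∏ e, ‖ψ e‖) ^ 2 : ℝ) : ℂ) := by
    have := inner_tensorVec ψ ψ
    simp only [inner_self_eq_norm_sq_to_K] at this
    rw [Finset.prod_pow] at this
    push_cast
    exact this
  rw [Complex.ofReal_inj] at h
  exact (pow_left_inj₀ (norm_nonneg _) (Finset.prod_nonneg fun e _ => norm_nonneg _)
    two_ne_zero).1 h

end Tensor

section Kraus

variable {X : Type} [Fintype X] {r : ℕ}

/-- The vector of the amplitudes `⟨ψ|K a|ψ⟩`, whose squared norm is the fidelity of `ψ`. -/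
def amplitude [DecidableEq X] (K : Fin r → Matrix X X ℂ) (ψ : EuclideanSpace ℂ X) :
    EuclideanSpace ℂ (Fin r) :=
  WithLp.toLp 2 fun a => inner ℂ ψ (toEuclideanLin (K a) ψ)

/-- The overlap of `Φ` with the mixture `∑ a, |f a⟩⟨f a|`. -/
theorem overlap_sum {Y : Type} [Fintype Y] (Φ : Y → ℂ) (f : Fin r → Y → ℂ) (σ : Matrix Y Y ℂ)
    (hσ : ∀ u v, σ u v = ∑ a, f a u * star (f a v)) :
    overlap Φ σ = ∑ a, ‖∑ u, star (Φ u) * f a u‖ ^ 2 := by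
  have h : star Φ ⬝ᵥ σ *ᵥ Φ = ∑ a, (∑ u, star (Φ u) * f a u) * star (∑ u, star (Φ u) * f a u) := by
    have h1 : ∀ a, (∑ u, star (Φ u) * f a u) * star (∑ u, star (Φ u) * f a u) =
        ∑ u, ∑ v, star (Φ u) * (f a u * star (f a v) * Φ v) := by
      intro a
      rw [star_sum, Finset.sum_mul_sum]
      refine Finset.sum_congr rfl fun u _ => Finset.sum_congr rfl fun v _ => ?_
      rw [star_mul', star_star]
      ring
    simp_rw [h1]
    rw [Finset.sum_comm]
    simp only [dotProduct, Matrix.mulVec, hσ, Pi.star_apply, Finset.mul_sum, Finset.sum_mul]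
    exact Finset.sum_congr rfl fun u _ => Finset.sum_comm
  rw [overlap, h, Complex.re_sum]
  refine Finset.sum_congr rfl fun a _ => ?_
  rw [show star (∑ u, star (Φ u) * f a u) = (starRingEnd ℂ) (∑ u, star (Φ u) * f a u) from rfl,
    Complex.mul_conj, Complex.ofReal_re, Complex.normSq_eq_norm_sq]

theorem overlap_pureState [DecidableEq X] (K : Fin r → Matrix X X ℂ) (ψ : EuclideanSpace ℂ X) :
    overlap ψ ((∑ a, conjMap (K a)) (pureState ψ)) = ‖amplitude K ψ‖ ^ 2 := by
  rw [overlap_sum ψ (fun a => K a *ᵥ ψ), EuclideanSpace.norm_sq_eq]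
  · refine Finset.sum_congr rfl fun a _ => ?_
    congr 2
    simp [amplitude, PiLp.inner_apply, toLpLin_apply, mul_comm]
  · intro u v
    simp only [LinearMap.sum_apply, Matrix.sum_apply, conjMap, LinearMap.coe_mk, AddHom.coe_mk,
      pureState]
    refine Finset.sum_congr rfl fun a _ => ?_
    rw [Matrix.mul_vecMulVec, Matrix.vecMulVec_mul, ← Matrix.star_mulVec]
    rfl

/-- Each Kraus operator contributes `|tr K ρ|²`, where `ρ` is the reduced state of `Φ`. -/
theorem overlap_amplify {R : Type} [Fintype R] (K : Fin r → Matrix X X ℂ) (Φ : R × X → ℂ) :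
    overlap Φ (amplify R (∑ a, conjMap (K a)) (pureState Φ)) =
      ∑ a, ‖∑ x, ∑ x', K a x x' * ∑ s, Φ (s, x') * star (Φ (s, x))‖ ^ 2 := by
  rw [overlap_sum Φ fun a u => (K a *ᵥ fun x => Φ (u.1, x)) u.2]
  · refine Finset.sum_congr rfl fun a _ => ?_
    congr 2
    rw [Fintype.sum_prod_type, Finset.sum_comm]
    simp only [Matrix.mulVec, dotProduct, Finset.mul_sum]
    refine Finset.sum_congr rfl fun x _ => ?_
    rw [Finset.sum_comm]
    refine Finset.sum_congr rfl fun x' _ => Finset.sum_congr rfl fun s _ => by ring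
  · intro u v
    simp only [amplify, LinearMap.sum_apply, Matrix.sum_apply, conjMap, LinearMap.coe_mk,
      AddHom.coe_mk, pureState, Matrix.of_apply]
    refine Finset.sum_congr rfl fun a _ => ?_
    rw [show (Matrix.of fun x x' => vecMulVec Φ (star Φ) (u.1, x) (v.1, x')) =
      vecMulVec (fun x => Φ (u.1, x)) (star fun x => Φ (v.1, x)) from rfl,
      Matrix.mul_vecMulVec, Matrix.vecMulVec_mul, ← Matrix.star_mulVec]
    rfl

/-- The completeness relation `∑ a, (K a)† K a = 1`, evaluated in `ψ`. -/
theorem sum_norm_sq_kraus [DecidableEq X] {K : Fin r → Matrix X X ℂ}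
    (hK : IsTP (∑ a, conjMap (K a)))
    (ψ : EuclideanSpace ℂ X) : ∑ a, ‖toEuclideanLin (K a) ψ‖ ^ 2 = ‖ψ‖ ^ 2 := by
  have htr : ∀ φ : EuclideanSpace ℂ X, (pureState φ).trace = ((‖φ‖ ^ 2 : ℝ) : ℂ) := by
    intro φ
    rw [EuclideanSpace.norm_sq_eq, Complex.ofReal_sum]
    refine Finset.sum_congr rfl fun x _ => ?_
    rw [← Complex.normSq_eq_norm_sq, ← Complex.mul_conj]
    rfl
  have h1 : ∀ a, conjMap (K a) (pureState ψ) = pureState (toEuclideanLin (K a) ψ) := by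
    intro a
    simp only [conjMap, LinearMap.coe_mk, AddHom.coe_mk, pureState]
    rw [Matrix.mul_vecMulVec, Matrix.vecMulVec_mul, ← Matrix.star_mulVec]
    rfl
  have h2 := hK (pureState ψ)
  rw [LinearMap.sum_apply, Matrix.trace_sum] at h2
  simp_rw [h1, htr] at h2
  rw [← Complex.ofReal_sum] at h2
  exact Complex.ofReal_injective h2

theorem norm_amplitude_le [DecidableEq X] {K : Fin r → Matrix X X ℂ}
    (hK : IsTP (∑ a, conjMap (K a)))
    {ψ : EuclideanSpace ℂ X} (hψ : ‖ψ‖ = 1) : ‖amplitude K ψ‖ ≤ 1 := by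
  have h : ‖amplitude K ψ‖ ^ 2 ≤ 1 := by
    rw [EuclideanSpace.norm_sq_eq]
    calc ∑ a, ‖amplitude K ψ a‖ ^ 2 ≤ ∑ a, ‖toEuclideanLin (K a) ψ‖ ^ 2 := by
          refine Finset.sum_le_sum fun a _ => pow_le_pow_left₀ (norm_nonneg _) ?_ 2
          have := norm_inner_le_norm (𝕜 := ℂ) ψ (toEuclideanLin (K a) ψ)
          rwa [hψ, one_mul] at this
      _ = 1 := by rw [sum_norm_sq_kraus hK, hψ, one_pow]
  nlinarith [norm_nonneg (amplitude K ψ)]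

end Kraus

section Fidelity

variable {L n : ℕ} {d : Fin L → ℕ} {r : ℕ}

/-- `overlap_pureState` for a product vector; `prodVec` and `tensorVec` have the same entries. -/
theorem overlap_prodVec (K : Fin r → Matrix (Mat n d) (Mat n d) ℂ)
    (ψ : ∀ e, EuclideanSpace ℂ (Blk n (d e))) :
    overlap (prodVec ψ) ((∑ a, conjMap (K a)) (pureState (prodVec ψ))) =
      ‖amplitude K (tensorVec ψ)‖ ^ 2 := overlap_pureState K (tensorVec ψ)

/-- The entanglement fidelity of sources with reduced states `∑ i, w e i |b e i⟩⟨b e i|` is the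
squared norm of the average of the amplitude vectors of the products of the vectors `b e i`. -/
theorem entanglementFidelity_eq (K : Fin r → Matrix (Mat n d) (Mat n d) ℂ) {c : Fin L → ℕ}
    (Ψ : ∀ e, EuclideanSpace ℂ (Fin (c e) × Blk n (d e))) {I : Fin L → Type} [∀ e, Fintype (I e)]
    (w : ∀ e, I e → ℝ) (b : ∀ e, I e → EuclideanSpace ℂ (Blk n (d e)))
    (hb : ∀ e y y', reduced (Ψ e) y y' = ∑ i, (w e i : ℂ) * (b e i y * star (b e i y'))) :
    entanglementFidelity Ψ (∑ a, conjMap (K a)) =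
      ‖∑ i : ∀ e, I e, ((∏ e, w e (i e) : ℝ) : ℂ) •
        amplitude K (tensorVec fun e => b e (i e))‖ ^ 2 := by
  rw [entanglementFidelity, overlap_amplify, EuclideanSpace.norm_sq_eq]
  refine Finset.sum_congr rfl fun a _ => ?_
  congr 2
  have h1 : ∀ x x' : Mat n d, ∑ s, prodBip Ψ (s, x') * star (prodBip Ψ (s, x)) =
      ∑ i : ∀ e, I e, ((∏ e, w e (i e) : ℝ) : ℂ) *
        (tensorVec (fun e => b e (i e)) x' * star (tensorVec (fun e => b e (i e)) x)) := by
    intro x x'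
    have h2 : ∀ e, ∑ s, Ψ e (s, x' e) * star (Ψ e (s, x e)) =
        ∑ i, (w e i : ℂ) * (b e i (x' e) * star (b e i (x e))) := fun e => hb e (x' e) (x e)
    have h3 := Finset.prod_congr (rfl : (Finset.univ : Finset (Fin L)) = _) fun e _ => h2 e
    simp only [Finset.prod_univ_sum, Fintype.piFinset_univ, Finset.prod_mul_distrib] at h3
    simp only [prodBip, tensorVec_apply, star_prod, Complex.ofReal_prod]
    exact h3
  simp_rw [h1]
  have h4 : (∑ i : ∀ e, I e, ((∏ e, w e (i e) : ℝ) : ℂ) •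
      amplitude K (tensorVec fun e => b e (i e))) a =
      ∑ i : ∀ e, I e, ((∏ e, w e (i e) : ℝ) : ℂ) *
        amplitude K (tensorVec fun e => b e (i e)) a := by
    simp
  rw [h4]
  have h5 : ∀ ψ : EuclideanSpace ℂ (Mat n d), amplitude K ψ a =
      ∑ x, ∑ x', K a x x' * (ψ x' * star (ψ x)) := by
    intro ψ
    simp only [amplitude, PiLp.inner_apply, toLpLin_apply, Matrix.mulVec, dotProduct]
    refine Finset.sum_congr rfl fun x _ => ?_
    simp only [RCLike.inner_apply, Finset.sum_mul]
    exact Finset.sum_congr rfl fun x' _ => by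
      rw [mul_assoc]; rfl
  simp_rw [h5, Finset.mul_sum]
  rw [Finset.sum_comm' (t' := Finset.univ) (s' := fun _ => Finset.univ) (by simp)]
  conv_rhs =>
    rw [Finset.sum_comm]
    enter [2, x]
    rw [Finset.sum_comm]
  rw [Finset.sum_comm]
  exact Finset.sum_congr rfl fun x _ => Finset.sum_congr rfl fun x' _ =>
    Finset.sum_congr rfl fun i _ => by ring

end Fidelity

/-! ### From subspaces to entanglement -/

section Amplitude

variable {X : Type} [Fintype X] [DecidableEq X] {r : ℕ}

theorem norm_sq_inner_add_le {X : Type} [Fintype X] {x y : EuclideanSpace ℂ X}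
    (hx : ‖x‖ = 1) (hy : ‖y‖ = 1) (hxy : inner ℂ x y = 0) (v : EuclideanSpace ℂ X) :
    ‖inner ℂ x v‖ ^ 2 + ‖inner ℂ y v‖ ^ 2 ≤ ‖v‖ ^ 2 := by
  have hyx : inner ℂ y x = 0 := inner_eq_zero_symm.1 hxy
  have h : Orthonormal ℂ ![x, y] := by
    rw [orthonormal_iff_ite]
    intro i j
    fin_cases i <;> fin_cases j <;> simp [hx, hy, hxy, hyx]
  have := h.sum_inner_products_le (s := Finset.univ) (x := v)
  simpa [Fin.sum_univ_two] using this

/-- If two orthonormal vectors and their normalised sum are transmitted faithfully, then their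
amplitude vectors are close, that is, the environment does not learn which one was sent. -/
theorem norm_sq_amplitude_sub_le {K : Fin r → Matrix X X ℂ} (hK : IsTP (∑ a, conjMap (K a)))
    {x y : EuclideanSpace ℂ X} (hx : ‖x‖ = 1) (hy : ‖y‖ = 1) (hxy : inner ℂ x y = 0) {s : ℝ}
    (hs : 0 ≤ s) (hFx : 1 - s ^ 2 ≤ ‖amplitude K x‖ ^ 2) (hFy : 1 - s ^ 2 ≤ ‖amplitude K y‖ ^ 2)
    (hF : 1 - s ^ 2 ≤ ‖amplitude K (((Real.sqrt 2)⁻¹ : ℂ) • (x + y))‖ ^ 2) :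
    ‖amplitude K x - amplitude K y‖ ^ 2 ≤ 16 * s := by
  -- if `y` is preserved, then its image has little weight in the orthogonal vector `x`
  let cross : EuclideanSpace ℂ X → EuclideanSpace ℂ X → EuclideanSpace ℂ (Fin r) := fun x y =>
    WithLp.toLp 2 fun a => inner ℂ x (toEuclideanLin (K a) y)
  have hcross : ∀ x y : EuclideanSpace ℂ X, ‖x‖ = 1 → ‖y‖ = 1 → inner ℂ x y = 0 →
      1 - s ^ 2 ≤ ‖amplitude K y‖ ^ 2 → ‖cross x y‖ ≤ s := by
    intro x y hx hy hxy hF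
    have h1 : ‖cross x y‖ ^ 2 + ‖amplitude K y‖ ^ 2 ≤ 1 := by
      rw [EuclideanSpace.norm_sq_eq, EuclideanSpace.norm_sq_eq, ← Finset.sum_add_distrib]
      calc _ ≤ ∑ a, ‖toEuclideanLin (K a) y‖ ^ 2 :=
            Finset.sum_le_sum fun a _ => norm_sq_inner_add_le hx hy hxy _
        _ = 1 := by rw [sum_norm_sq_kraus hK, hy, one_pow]
    exact (pow_le_pow_iff_left₀ (norm_nonneg _) hs two_ne_zero).1 (by linarith)
  have hsum : amplitude K (((Real.sqrt 2)⁻¹ : ℂ) • (x + y)) =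
      (2 : ℂ)⁻¹ • (amplitude K x + amplitude K y + (cross x y + cross y x)) := by
    ext a
    simp only [amplitude, cross, PiLp.smul_apply, PiLp.add_apply, map_smul, map_add,
      inner_smul_left, inner_smul_right, inner_add_left, inner_add_right, smul_eq_mul, map_inv₀,
      Complex.conj_ofReal]
    have h2 : ((Real.sqrt 2 : ℂ))⁻¹ * ((Real.sqrt 2 : ℂ))⁻¹ = 2⁻¹ := by
      rw [← mul_inv, ← Complex.ofReal_mul, Real.mul_self_sqrt (by norm_num), Complex.ofReal_ofNat]
    linear_combination (inner ℂ x (toEuclideanLin (K a) x) + inner ℂ y (toEuclideanLin (K a) y) +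
      (inner ℂ x (toEuclideanLin (K a) y) + inner ℂ y (toEuclideanLin (K a) x))) * h2
  have hax := norm_amplitude_le hK hx
  have hay := norm_amplitude_le hK hy
  rcases le_or_gt s (1 / 4) with hs4 | hs4
  · have h1 : 1 - s ≤ ‖amplitude K (((Real.sqrt 2)⁻¹ : ℂ) • (x + y))‖ := by
      by_contra hlt
      push Not at hlt
      nlinarith [norm_nonneg (amplitude K (((Real.sqrt 2)⁻¹ : ℂ) • (x + y)))]
    rw [hsum, norm_smul, norm_inv, Complex.norm_two] at h1
    have h2 := norm_add_le (amplitude K x + amplitude K y) (cross x y + cross y x)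
    have h3 := norm_add_le (cross x y) (cross y x)
    have h4 := hcross x y hx hy hxy hFy
    have h5 := hcross y x hy hx (inner_eq_zero_symm.1 hxy) hFx
    have h6 : 2 * (1 - 2 * s) ≤ ‖amplitude K x + amplitude K y‖ := by linarith
    -- two vectors in the unit ball whose sum has norm near two are close
    have h7 := parallelogram_law_with_norm ℂ (amplitude K x) (amplitude K y)
    nlinarith [norm_nonneg (amplitude K x), norm_nonneg (amplitude K y)]
  · have h1 := norm_sub_le (amplitude K x) (amplitude K y)
    nlinarith [norm_nonneg (amplitude K x - amplitude K y)]

end Amplitude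

section Average

variable {L : ℕ} {X : Fin L → Type} [∀ e, Fintype (X e)] [∀ e, DecidableEq (X e)] {r : ℕ}

/-- Replacing the factors of a product basis vector one by one shows that all amplitude vectors are
close to each other, and hence to any average of them. -/
theorem norm_average_amplitude_ge {K : Fin r → Matrix (∀ e, X e) (∀ e, X e) ℂ}
    (hK : IsTP (∑ a, conjMap (K a))) (H : ∀ e, Submodule ℂ (EuclideanSpace ℂ (X e)))
    {I : Fin L → Type} [∀ e, Fintype (I e)] [∀ e, DecidableEq (I e)] [∀ e, Nonempty (I e)]
    (b : ∀ e, I e → EuclideanSpace ℂ (X e)) (hb : ∀ e, Orthonormal ℂ (b e))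
    (hbH : ∀ e i, b e i ∈ H e) {s : ℝ} (hs : 0 ≤ s) (hs1 : s ≤ 1)
    (hF : ∀ ψ : ∀ e, EuclideanSpace ℂ (X e), (∀ e, ψ e ∈ H e ∧ ‖ψ e‖ = 1) →
      1 - s ^ 2 ≤ ‖amplitude K (tensorVec ψ)‖ ^ 2)
    (w : (∀ e, I e) → ℝ) (hw : ∀ i, 0 ≤ w i) (hw1 : ∑ i, w i = 1) :
    1 - s - L * (4 * Real.sqrt s) ≤
      ‖∑ i : ∀ e, I e, (w i : ℂ) • amplitude K (tensorVec fun e => b e (i e))‖ := by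
  let v : (∀ e, I e) → EuclideanSpace ℂ (Fin r) := fun i =>
    amplitude K (tensorVec fun e => b e (i e))
  have hnorm : ∀ i : ∀ e, I e, ‖tensorVec fun e => b e (i e)‖ = 1 := by
    intro i
    rw [norm_tensorVec]
    exact Finset.prod_eq_one fun e _ => (hb e).1 (i e)
  have hstep : ∀ (i : ∀ e, I e) e k, ‖v (Function.update i e k) - v i‖ ≤ 4 * Real.sqrt s := by
    intro i e k
    by_cases hk : k = i e
    · subst hk
      simp only [Function.update_eq_self, sub_self, norm_zero]
      positivity
    · have hupd : ∀ k', (fun f => b f (Function.update i e k' f)) =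
          Function.update (fun f => b f (i f)) e (b e k') := by
        intro k'
        funext f
        by_cases h : f = e
        · subst h; simp
        · simp [h]
      have hself : (fun f => b f (i f)) = Function.update (fun f => b f (i f)) e (b e (i e)) := by
        simp
      have horth : inner ℂ (b e k) (b e (i e)) = 0 := (hb e).2 hk
      have h1 := norm_sq_amplitude_sub_le hK (x := tensorVec fun f => b f (Function.update i e k f))
        (y := tensorVec fun f => b f (i f)) (hnorm _) (hnorm _) (by
          rw [inner_tensorVec]
          exact Finset.prod_eq_zero (Finset.mem_univ e) (by simpa using horth)) hs
        (hF _ fun f => ⟨hbH _ _, (hb f).1 _⟩) (hF _ fun f => ⟨hbH _ _, (hb f).1 _⟩) (by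
          have hsum : ((Real.sqrt 2)⁻¹ : ℂ) • ((tensorVec fun f => b f (Function.update i e k f)) +
              tensorVec fun f => b f (i f)) = tensorVec (Function.update (fun f => b f (i f)) e
                (((Real.sqrt 2)⁻¹ : ℂ) • (b e k + b e (i e)))) := by
            rw [MultilinearMap.map_update_smul, MultilinearMap.map_update_add, hupd, ← hself]
          rw [hsum]
          refine hF _ fun f => ?_
          by_cases h : f = e
          · subst h
            rw [Function.update_self]
            refine ⟨(H f).smul_mem _ ((H f).add_mem (hbH _ _) (hbH _ _)), ?_⟩
            have h2 : ‖b f k + b f (i f)‖ ^ 2 = 2 := by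
              rw [norm_add_sq (𝕜 := ℂ), horth, (hb f).1, (hb f).1]
              norm_num
            rw [norm_smul, norm_inv, Complex.norm_real, Real.norm_eq_abs,
              abs_of_nonneg (Real.sqrt_nonneg _), ← Real.sqrt_sq (norm_nonneg (b f k + b f (i f))),
              h2]
            exact inv_mul_cancel₀ (by positivity)
          · rw [Function.update_of_ne h]
            exact ⟨hbH _ _, (hb f).1 _⟩)
      have h3 : (4 * Real.sqrt s) ^ 2 = 16 * s := by
        rw [mul_pow, Real.sq_sqrt hs]
        norm_num
      rw [← h3] at h1
      exact (pow_le_pow_iff_left₀ (norm_nonneg _) (by positivity) two_ne_zero).1 h1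
  have hall : ∀ i j : ∀ e, I e, ‖v i - v j‖ ≤ L * (4 * Real.sqrt s) := by
    intro i j
    have h1 : ∀ S : Finset (Fin L), ‖v (S.piecewise i j) - v j‖ ≤ S.card * (4 * Real.sqrt s) := by
      intro S
      induction S using Finset.induction_on with
      | empty => simp
      | insert e S he ih =>
        rw [Finset.piecewise_insert, Finset.card_insert_of_notMem he]
        have h2 := norm_sub_le_norm_sub_add_norm_sub
          (v (Function.update (S.piecewise i j) e (i e))) (v (S.piecewise i j)) (v j)
        have h3 := hstep (S.piecewise i j) e (i e)
        push_cast
        linarith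
    have h2 := h1 Finset.univ
    rwa [Finset.piecewise_univ, Finset.card_univ, Fintype.card_fin] at h2
  let i₀ : ∀ e, I e := fun e => Classical.arbitrary _
  have h0 : 1 - s ≤ ‖v i₀‖ := by
    have h1 := hF (fun e => b e (i₀ e)) fun e => ⟨hbH _ _, (hb e).1 _⟩
    by_contra hlt
    push Not at hlt
    have : ‖v i₀‖ ^ 2 ≤ (1 - s) ^ 2 := pow_le_pow_left₀ (norm_nonneg _) hlt.le 2
    nlinarith [norm_nonneg (v i₀)]
  have h1 : v i₀ = ∑ i, (w i : ℂ) • v i + ∑ i, (w i : ℂ) • (v i₀ - v i) := by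
    rw [← Finset.sum_add_distrib]
    simp_rw [← smul_add, add_sub_cancel]
    rw [← Finset.sum_smul, ← Complex.ofReal_sum, hw1]
    simp
  have h2 : ‖∑ i, (w i : ℂ) • (v i₀ - v i)‖ ≤ L * (4 * Real.sqrt s) := by
    refine (norm_sum_le _ _).trans ?_
    calc ∑ i, ‖(w i : ℂ) • (v i₀ - v i)‖ ≤ ∑ i, w i * (L * (4 * Real.sqrt s)) := by
          refine Finset.sum_le_sum fun i _ => ?_
          rw [norm_smul, Complex.norm_real, Real.norm_eq_abs, abs_of_nonneg (hw i)]
          exact mul_le_mul_of_nonneg_left (hall _ _) (hw i)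
      _ = _ := by rw [← Finset.sum_mul, hw1, one_mul]
  have h3 := norm_add_le (∑ i, (w i : ℂ) • v i) (∑ i, (w i : ℂ) • (v i₀ - v i))
  rw [← h1] at h3
  change _ ≤ ‖∑ i, (w i : ℂ) • v i‖
  linarith

end Average

section MaxEntangled

variable {X : Type} [Fintype X]

/-- The maximally entangled state of a subspace `H` and a reference system of the same dimension. -/
def maxEntangled (H : Submodule ℂ (EuclideanSpace ℂ X)) :
    EuclideanSpace ℂ (Fin (Module.finrank ℂ H) × X) :=
  WithLp.toLp 2 fun q => ((Real.sqrt (Module.finrank ℂ H))⁻¹ : ℂ) *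
    (stdOrthonormalBasis ℂ H q.1 : EuclideanSpace ℂ X) q.2

variable (H : Submodule ℂ (EuclideanSpace ℂ X))

theorem reduced_maxEntangled (y y' : X) : reduced (maxEntangled H) y y' =
    ∑ i, (((Module.finrank ℂ H : ℝ)⁻¹ : ℝ) : ℂ) *
      ((stdOrthonormalBasis ℂ H i : EuclideanSpace ℂ X) y *
        star ((stdOrthonormalBasis ℂ H i : EuclideanSpace ℂ X) y')) := by
  simp only [reduced, maxEntangled, Matrix.of_apply]
  refine Finset.sum_congr rfl fun i _ => ?_
  have h : ((Real.sqrt (Module.finrank ℂ H))⁻¹ : ℂ) * star ((Real.sqrt (Module.finrank ℂ H))⁻¹ : ℂ)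
      = (((Module.finrank ℂ H : ℝ)⁻¹ : ℝ) : ℂ) := by
    rw [star_inv₀, show star ((Real.sqrt (Module.finrank ℂ H) : ℂ)) =
      (Real.sqrt (Module.finrank ℂ H) : ℂ) from Complex.conj_ofReal _, ← mul_inv,
      ← Complex.ofReal_mul, Real.mul_self_sqrt (Nat.cast_nonneg _), Complex.ofReal_inv]
  rw [← h, star_mul']
  ring

theorem orthonormal_coe_stdOrthonormalBasis :
    Orthonormal ℂ fun i => (stdOrthonormalBasis ℂ H i : EuclideanSpace ℂ X) :=
  (stdOrthonormalBasis ℂ H).orthonormal.comp_linearIsometry H.subtypeₗᵢ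

variable {H}

theorem finrank_pos_of_ne_bot (hH : H ≠ ⊥) : 0 < Module.finrank ℂ H := by
  rw [Module.finrank_pos_iff]
  exact Submodule.nontrivial_iff_ne_bot.2 hH

theorem norm_maxEntangled (hH : H ≠ ⊥) : ‖maxEntangled H‖ = 1 := by
  have hpos : (0 : ℝ) < Module.finrank ℂ H := by exact_mod_cast finrank_pos_of_ne_bot hH
  have h : ‖maxEntangled H‖ ^ 2 = 1 := by
    rw [EuclideanSpace.norm_sq_eq, Fintype.sum_prod_type]
    have h1 : ∀ i, ∑ x, ‖maxEntangled H (i, x)‖ ^ 2 = (Module.finrank ℂ H : ℝ)⁻¹ := by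
      intro i
      have h2 := (orthonormal_coe_stdOrthonormalBasis H).1 i
      have h3 : ‖(stdOrthonormalBasis ℂ H i : EuclideanSpace ℂ X)‖ ^ 2 = 1 := by rw [h2, one_pow]
      rw [EuclideanSpace.norm_sq_eq] at h3
      simp only [maxEntangled, norm_mul, mul_pow]
      rw [← Finset.mul_sum, h3, norm_inv, Complex.norm_real, Real.norm_eq_abs,
        abs_of_nonneg (Real.sqrt_nonneg _), inv_pow, Real.sq_sqrt hpos.le, mul_one]
    simp_rw [h1]
    rw [Finset.sum_const, Finset.card_univ, Fintype.card_fin, nsmul_eq_mul,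
      mul_inv_cancel₀ hpos.ne']
  exact (pow_eq_one_iff_of_nonneg (norm_nonneg _) two_ne_zero).1 h

variable [DecidableEq X]

theorem toEuclideanLin_reduced_maxEntangled (v : EuclideanSpace ℂ X) :
    toEuclideanLin (reduced (maxEntangled H)) v =
      (((Module.finrank ℂ H : ℝ)⁻¹ : ℝ) : ℂ) • ∑ i,
        inner ℂ (stdOrthonormalBasis ℂ H i : EuclideanSpace ℂ X) v •
          (stdOrthonormalBasis ℂ H i : EuclideanSpace ℂ X) := by
  ext y
  simp only [toLpLin_apply, Matrix.mulVec, dotProduct, reduced_maxEntangled, PiLp.smul_apply,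
    WithLp.ofLp_sum, Finset.sum_apply, PiLp.inner_apply, smul_eq_mul, Finset.sum_mul,
    Finset.mul_sum]
  rw [Finset.sum_comm]
  refine Finset.sum_congr rfl fun i _ => Finset.sum_congr rfl fun x _ => ?_
  simp only [RCLike.inner_apply, starRingEnd_apply]
  ring

theorem toEuclideanLin_reduced_maxEntangled_of_mem {v : EuclideanSpace ℂ X} (hv : v ∈ H) :
    toEuclideanLin (reduced (maxEntangled H)) v =
      (((Module.finrank ℂ H : ℝ)⁻¹ : ℝ) : ℂ) • v := by
  rw [toEuclideanLin_reduced_maxEntangled]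
  congr 1
  have := congrArg (Subtype.val) ((stdOrthonormalBasis ℂ H).sum_repr' ⟨v, hv⟩)
  simpa using this

theorem toEuclideanLin_reduced_maxEntangled_mem (v : EuclideanSpace ℂ X) :
    toEuclideanLin (reduced (maxEntangled H)) v ∈ H := by
  rw [toEuclideanLin_reduced_maxEntangled]
  exact H.smul_mem _ (H.sum_mem fun i _ => H.smul_mem _ (Subtype.mem _))

theorem trace_reduced {X : Type} [Fintype X] {R : Type} [Fintype R] (Ψ : EuclideanSpace ℂ (R × X)) :
    (reduced Ψ).trace = ((‖Ψ‖ ^ 2 : ℝ) : ℂ) := by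
  rw [EuclideanSpace.norm_sq_eq, Fintype.sum_prod_type, Finset.sum_comm, Complex.ofReal_sum]
  refine Finset.sum_congr rfl fun x _ => ?_
  rw [Complex.ofReal_sum]
  refine Finset.sum_congr rfl fun s _ => ?_
  rw [← Complex.normSq_eq_norm_sq, ← Complex.mul_conj]
  rfl

theorem trace_toEuclideanLin (ρ : Matrix X X ℂ) :
    LinearMap.trace ℂ (EuclideanSpace ℂ X) (toEuclideanLin ρ) = ρ.trace := by
  rw [LinearMap.trace_eq_sum_inner _ (EuclideanSpace.basisFun X ℂ)]
  refine Finset.sum_congr rfl fun x _ => ?_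
  simp [toLpLin_apply, EuclideanSpace.inner_single_left]

theorem sum_eigenvalues_reduced {R : Type} [Fintype R] {Ψ : EuclideanSpace ℂ (R × X)}
    (hΨ : ‖Ψ‖ = 1) : ∑ x, (reduced_isHermitian Ψ).eigenvalues x = 1 := by
  have h := (reduced_isHermitian Ψ).trace_eq_sum_eigenvalues
  rw [trace_reduced, hΨ] at h
  have h' : ((∑ x, (reduced_isHermitian Ψ).eigenvalues x : ℝ) : ℂ) = ((1 : ℝ) : ℂ) := by
    push_cast
    simpa using h.symm
  exact Complex.ofReal_injective h'

theorem toEuclideanLin_eigenvectorBasis {ρ : Matrix X X ℂ} (h : ρ.IsHermitian) (x : X) :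
    toEuclideanLin ρ (h.eigenvectorBasis x) = (h.eigenvalues x : ℂ) • h.eigenvectorBasis x := by
  ext y
  have := congrFun (h.mulVec_eigenvectorBasis x) y
  simpa [toLpLin_apply] using this

/-- The eigenvalues are `0` and `1 / dim H`. -/
theorem entropy_maxEntangled (hH : H ≠ ⊥) :
    entropy (reduced_isHermitian (maxEntangled H)) = Real.logb 2 (Module.finrank ℂ H) := by
  have hpos : (0 : ℝ) < Module.finrank ℂ H := by exact_mod_cast finrank_pos_of_ne_bot hH
  set h := reduced_isHermitian (maxEntangled H)
  have heig : ∀ x, h.eigenvalues x = 0 ∨ h.eigenvalues x = (Module.finrank ℂ H : ℝ)⁻¹ := by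
    intro x
    have h1 := toEuclideanLin_eigenvectorBasis h x
    have h2 := toEuclideanLin_reduced_maxEntangled_of_mem
      (toEuclideanLin_reduced_maxEntangled_mem (H := H) (h.eigenvectorBasis x))
    rw [h1, map_smul, h1, smul_smul, smul_smul] at h2
    have h3 : h.eigenvectorBasis x ≠ 0 := h.eigenvectorBasis.orthonormal.ne_zero x
    have h4 := smul_left_injective ℂ h3 h2
    have h5 : h.eigenvalues x * h.eigenvalues x =
        (Module.finrank ℂ H : ℝ)⁻¹ * h.eigenvalues x := by exact_mod_cast h4
    rcases eq_or_ne (h.eigenvalues x) 0 with h6 | h6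
    · exact Or.inl h6
    · exact Or.inr (mul_right_cancel₀ h6 h5)
  have hterm : ∀ x, Real.negMulLog (h.eigenvalues x) / Real.log 2 =
      h.eigenvalues x * Real.logb 2 (Module.finrank ℂ H) := by
    intro x
    rcases heig x with h1 | h1
    · rw [h1]
      simp
    · rw [h1, Real.negMulLog, Real.log_inv, Real.logb]
      ring
  rw [entropy]
  simp_rw [hterm]
  rw [← Finset.sum_mul, sum_eigenvalues_reduced (norm_maxEntangled hH), one_mul]

/-- All of `H` is typical if its only nonzero eigenvalue is. -/
theorem typicalWeight_maxEntangled (hH : H ≠ ⊥) {n : ℕ} {S ε : ℝ}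
    (h1 : (2 : ℝ) ^ (-(n * (S + ε))) ≤ (Module.finrank ℂ H : ℝ)⁻¹)
    (h2 : (Module.finrank ℂ H : ℝ)⁻¹ ≤ (2 : ℝ) ^ (-(n * (S - ε)))) :
    typicalWeight (reduced (maxEntangled H)) n S ε = 1 := by
  set ρ := reduced (maxEntangled H)
  have hle : H ≤ typicalSubspace ρ n S ε := fun v hv =>
    Submodule.subset_span ⟨_, h1, h2, toEuclideanLin_reduced_maxEntangled_of_mem hv⟩
  have h3 : (typicalSubspace ρ n S ε).starProjection.toLinearMap ∘ₗ toEuclideanLin ρ =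
      toEuclideanLin ρ := by
    ext1 v
    exact Submodule.starProjection_eq_self_iff.2
      (hle (toEuclideanLin_reduced_maxEntangled_mem v))
  rw [typicalWeight, ← LinearMap.comp_assoc, LinearMap.trace_comp_comm', h3, h3,
    trace_toEuclideanLin, trace_reduced, norm_maxEntangled hH]
  simp

end MaxEntangled

section Rates

theorem exists_kraus {k m L : ℕ} {a : Fin k → ℕ} {b : Fin m → ℕ} {l : Layout k m L}
    {Λ : NetMap a b} (hΛ : IsChannel Λ) {C : Comm} {n : ℕ} {d : Fin L → ℕ}
    {T : SuperOp (∀ i, Src l n d i) (∀ j, Dst l n d j)} (hT : IsProtocol l Λ n d T C) :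
    ∃ (r : ℕ) (K : Fin r → Matrix (Mat n d) (Mat n d) ℂ),
      route l n d T = ∑ a, conjMap (K a) ∧ IsTP (∑ a, conjMap (K a)) := by
  obtain ⟨⟨r, K, hK⟩, hTP⟩ := isChannel_route (hT.isChannel hΛ)
  exact ⟨r, K, hK, hK ▸ hTP⟩

theorem subspaceFidelity_le {L n : ℕ} {d : Fin L → ℕ}
    (H : ∀ e, Submodule ℂ (EuclideanSpace ℂ (Blk n (d e)))) {r : ℕ}
    (K : Fin r → Matrix (Mat n d) (Mat n d) ℂ) {ψ : ∀ e, EuclideanSpace ℂ (Blk n (d e))}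
    (hψ : ∀ e, ψ e ∈ H e ∧ ‖ψ e‖ = 1) :
    subspaceFidelity H (∑ a, conjMap (K a)) ≤ ‖amplitude K (tensorVec ψ)‖ ^ 2 := by
  rw [← overlap_prodVec]
  refine ciInf_le (f := fun ψ : {ψ : ∀ e, EuclideanSpace ℂ (Blk n (d e)) //
    ∀ e, ψ e ∈ H e ∧ ‖ψ e‖ = 1} => overlap (prodVec ψ.1)
      ((∑ a, conjMap (K a)) (pureState (prodVec ψ.1)))) ⟨0, ?_⟩ ⟨ψ, hψ⟩
  rintro _ ⟨φ, rfl⟩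
  simp only [overlap_prodVec]
  positivity

/-- The protocol which transmits given subspaces also transmits their maximally entangled states. -/
theorem entanglementFidelity_maxEntangled_ge {L n : ℕ} {d : Fin L → ℕ}
    {H : ∀ e, Submodule ℂ (EuclideanSpace ℂ (Blk n (d e)))} (hH : ∀ e, H e ≠ ⊥) {r : ℕ}
    {K : Fin r → Matrix (Mat n d) (Mat n d) ℂ} (hK : IsTP (∑ a, conjMap (K a))) {s : ℝ}
    (hs : 0 ≤ s) (hs1 : s ≤ 1) (hF : 1 - s ^ 2 ≤ subspaceFidelity H (∑ a, conjMap (K a))) :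
    ∃ t, entanglementFidelity (fun e => maxEntangled (H e)) (∑ a, conjMap (K a)) = t ^ 2 ∧
      1 - s - L * (4 * Real.sqrt s) ≤ t ∧ t ≤ 1 := by
  have hpos : ∀ e, 0 < Module.finrank ℂ (H e) := fun e => finrank_pos_of_ne_bot (hH e)
  have : ∀ e, Nonempty (Fin (Module.finrank ℂ (H e))) := fun e => ⟨⟨0, hpos e⟩⟩
  have hw1 : ∑ _i : ∀ e, Fin (Module.finrank ℂ (H e)),
      (∏ e, ((Module.finrank ℂ (H e) : ℝ))⁻¹) = 1 := by
    rw [Finset.sum_const, Finset.card_univ, Fintype.card_pi, nsmul_eq_mul]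
    simp only [Fintype.card_fin, Nat.cast_prod]
    rw [← Finset.prod_mul_distrib]
    exact Finset.prod_eq_one fun e _ => mul_inv_cancel₀ (by exact_mod_cast (hpos e).ne')
  have hw0 : 0 ≤ ∏ e, ((Module.finrank ℂ (H e) : ℝ))⁻¹ :=
    Finset.prod_nonneg fun e _ => inv_nonneg.2 (Nat.cast_nonneg _)
  refine ⟨_, entanglementFidelity_eq K _ (fun e _ => ((Module.finrank ℂ (H e) : ℝ))⁻¹)
    (fun e i => (stdOrthonormalBasis ℂ (H e) i : EuclideanSpace ℂ (Blk n (d e))))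
    (fun e => reduced_maxEntangled (H e)), ?_, ?_⟩
  · exact norm_average_amplitude_ge hK H
      (fun e i => (stdOrthonormalBasis ℂ (H e) i : EuclideanSpace ℂ (Blk n (d e))))
      (fun e => orthonormal_coe_stdOrthonormalBasis (H e)) (fun e i => Subtype.mem _) hs hs1
      (fun ψ hψ => hF.trans (subspaceFidelity_le H K hψ))
      (fun _ => ∏ e, ((Module.finrank ℂ (H e) : ℝ))⁻¹) (fun _ => hw0) hw1
  · refine (norm_sum_le _ _).trans ?_
    rw [← hw1]
    refine Finset.sum_le_sum fun i _ => ?_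
    rw [norm_smul, Complex.norm_real, Real.norm_eq_abs, abs_of_nonneg hw0]
    refine mul_le_of_le_one_right hw0 (norm_amplitude_le hK ?_)
    rw [norm_tensorVec]
    exact Finset.prod_eq_one fun e _ => (orthonormal_coe_stdOrthonormalBasis (H e)).1 _

theorem subspaceRates_subset {k m L : ℕ} {a : Fin k → ℕ} {b : Fin m → ℕ} (l : Layout k m L)
    {Λ : NetMap a b} (hΛ : IsChannel Λ) (C : Comm) (d : Fin L → ℕ) :
    subspaceRates l C Λ d ⊆ entanglementRates l C Λ d := by
  rintro R ⟨T, H, hT, hH, hR, hF⟩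
  refine ⟨T, fun n e => Module.finrank ℂ (H n e), fun n e => maxEntangled (H n e), hT,
    fun n e => norm_maxEntangled (hH n e), fun e => ?_, fun e ε hε δ hδ => ?_, ?_⟩
  · simp_rw [entropy_maxEntangled (hH _ e)]
    exact hR e
  · have h1 := (hR e).eventually (Metric.ball_mem_nhds (R e) hε)
    filter_upwards [h1, eventually_ge_atTop 1] with n hn hn1
    have hn0 : (0 : ℝ) < n := by exact_mod_cast hn1
    have hpos : (0 : ℝ) < Module.finrank ℂ (H n e) := by
      exact_mod_cast finrank_pos_of_ne_bot (hH n e)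
    change |Real.logb 2 (Module.finrank ℂ (H n e)) / n - R e| < ε at hn
    rw [abs_lt] at hn
    have h2 : Real.logb 2 (Module.finrank ℂ (H n e)) < n * (R e + ε) := by
      have := (div_lt_iff₀ hn0).1 (sub_lt_iff_lt_add'.1 hn.2)
      linarith
    have h3 : n * (R e - ε) < Real.logb 2 (Module.finrank ℂ (H n e)) := by
      have h4 : R e - ε < Real.logb 2 (Module.finrank ℂ (H n e)) / n := by linarith [hn.1]
      have := (lt_div_iff₀ hn0).1 h4
      linarith
    have h4 : ((Module.finrank ℂ (H n e) : ℝ))⁻¹ =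
        (2 : ℝ) ^ (-Real.logb 2 (Module.finrank ℂ (H n e))) := by
      rw [Real.rpow_neg (by norm_num), Real.rpow_logb (by norm_num) (by norm_num) hpos]
    rw [typicalWeight_maxEntangled (hH n e)]
    · linarith
    · rw [h4]
      exact Real.rpow_le_rpow_of_exponent_le (by norm_num) (by linarith)
    · rw [h4]
      exact Real.rpow_le_rpow_of_exponent_le (by norm_num) (by linarith)
  · let s : ℕ → ℝ := fun n => Real.sqrt (max 0 (1 - subspaceFidelity (H n) (route l n d (T n))))
    have hs : Tendsto s atTop (𝓝 0) := by
      have h1 : Tendsto (fun n => max 0 (1 - subspaceFidelity (H n) (route l n d (T n)))) atTop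
          (𝓝 (max 0 (1 - 1))) := tendsto_const_nhds.max (tendsto_const_nhds.sub hF)
      rw [sub_self, max_self] at h1
      have h2 := (Real.continuous_sqrt.tendsto 0).comp h1
      rwa [Real.sqrt_zero] at h2
    have hlow : Tendsto (fun n => 1 - s n - L * (4 * Real.sqrt (s n))) atTop (𝓝 1) := by
      have h2 := (Real.continuous_sqrt.tendsto _).comp hs
      have h3 := (tendsto_const_nhds (x := (1 : ℝ)).sub hs).sub
        ((h2.const_mul 4).const_mul (L : ℝ))
      simpa using h3
    have hmain : ∀ᶠ n in atTop, ∃ t, entanglementFidelity (fun e => maxEntangled (H n e))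
        (route l n d (T n)) = t ^ 2 ∧ 1 - s n - L * (4 * Real.sqrt (s n)) ≤ t ∧ t ≤ 1 := by
      filter_upwards [hs.eventually (gt_mem_nhds zero_lt_one)] with n hn
      obtain ⟨r, K, hK, hTP⟩ := exists_kraus hΛ (hT n)
      rw [hK]
      refine entanglementFidelity_maxEntangled_ge (hH n) hTP (Real.sqrt_nonneg _) hn.le ?_
      rw [Real.sq_sqrt (le_max_left _ _), ← hK]
      linarith [le_max_right 0 (1 - subspaceFidelity (H n) (route l n d (T n)))]
    have hlow2 : Tendsto (fun n => (1 - s n - L * (4 * Real.sqrt (s n))) ^ 2) atTop (𝓝 1) := by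
      simpa using hlow.pow 2
    refine tendsto_of_tendsto_of_tendsto_of_le_of_le' hlow2 tendsto_const_nhds ?_ ?_
    · filter_upwards [hmain, hlow.eventually (lt_mem_nhds zero_lt_one)] with n ⟨t, ht, h1, h2⟩ h3
      rw [ht]
      exact pow_le_pow_left₀ h3.le h1 2
    · filter_upwards [hmain, hlow.eventually (lt_mem_nhds zero_lt_one)] with n ⟨t, ht, h1, h2⟩ h3
      rw [ht]
      exact pow_le_one₀ (h3.le.trans h1) h2

end Rates

/-! ### Concentration of quadratic forms in random signs -/

theorem integrable_exp_mul_sub_mul_sq {b : ℝ} (hb : 0 < b) (y : ℝ) :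
    MeasureTheory.Integrable fun t : ℝ => Real.exp (t * y - b * t ^ 2) := by
  have h := ((integrable_exp_neg_mul_sq hb).comp_sub_right (y / (2 * b))).const_mul
    (Real.exp (y ^ 2 / (4 * b)))
  refine h.congr (Filter.Eventually.of_forall fun t => ?_)
  simp only
  rw [← Real.exp_add]
  congr 1
  field_simp
  ring

/-- Linearisation of a square in an exponent by a Gaussian average. -/
theorem integral_exp_mul_sub_sq (y : ℝ) :
    ∫ t : ℝ, Real.exp (t * y - 1 / 2 * t ^ 2) =
      Real.sqrt (2 * Real.pi) * Real.exp (y ^ 2 / 2) := by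
  have h : ∀ t : ℝ, Real.exp (t * y - 1 / 2 * t ^ 2) =
      Real.exp (y ^ 2 / 2) * Real.exp (-(1 / 2) * (t - y) ^ 2) := by
    intro t
    rw [← Real.exp_add]
    congr 1
    ring
  simp_rw [h]
  rw [MeasureTheory.integral_const_mul,
    MeasureTheory.integral_sub_right_eq_self (fun t => Real.exp (-(1 / 2) * t ^ 2)) y,
    integral_gaussian, mul_comm]
  congr 2
  ring

theorem integral_exp_mul_sq_le {c : ℝ} (hc0 : 0 ≤ c) (hc : c ≤ 1 / 4) :
    ∫ t : ℝ, Real.exp (t * 0 - (1 / 2 - c) * t ^ 2) ≤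
      Real.sqrt (2 * Real.pi) * Real.exp (2 * c) := by
  have h : ∀ t : ℝ, Real.exp (t * 0 - (1 / 2 - c) * t ^ 2) = Real.exp (-(1 / 2 - c) * t ^ 2) := by
    intro t
    congr 1
    ring
  simp_rw [h]
  rw [integral_gaussian]
  have h1 : Real.exp (2 * c) = Real.sqrt (Real.exp (4 * c)) := by
    rw [Real.sqrt_eq_rpow, ← Real.exp_mul]
    congr 1
    ring
  rw [h1, ← Real.sqrt_mul (by positivity)]
  apply Real.sqrt_le_sqrt
  rw [div_le_iff₀ (by linarith)]
  have h2 : 1 + 4 * c ≤ Real.exp (4 * c) := by linarith [Real.add_one_le_exp (4 * c)]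
  have h3 : 1 ≤ (1 - 2 * c) * Real.exp (4 * c) := by
    nlinarith [mul_le_mul_of_nonneg_left h2 (show 0 ≤ 1 - 2 * c by linarith)]
  nlinarith [Real.pi_pos]

/-- If the random vector `ξ` is sub-Gaussian, then the exponential moments of the quadratic form
with eigenbasis `f` and eigenvalues `μ ≥ 0` are controlled by its trace, for exponents `s` up to a
quarter of the inverse of its norm. The square in the exponent is linearised by Gaussian
variables, and the two averages are interchanged. -/
theorem sum_exp_quadratic_le {X ι Ω : Type*} [Fintype X] [Fintype ι] [Fintype Ω]
    (ξ : Ω → X → ℝ)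
    (hξ : ∀ v : X → ℝ, ∑ ω, Real.exp (∑ x, v x * ξ ω x) ≤
      Fintype.card Ω * Real.exp ((∑ x, v x ^ 2) / 2))
    (f : ι → X → ℝ) (hf : ∀ t : ι → ℝ, ∑ x, (∑ i, t i * f i x) ^ 2 = ∑ i, t i ^ 2)
    (μ : ι → ℝ) (hμ0 : ∀ i, 0 ≤ μ i) (s : ℝ) (hs : 0 ≤ s) (hμ : ∀ i, s * μ i ≤ 1 / 4) :
    ∑ ω, Real.exp (s * ∑ i, μ i * (∑ x, f i x * ξ ω x) ^ 2) ≤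
      Fintype.card Ω * Real.exp (2 * s * ∑ i, μ i) := by
  set c : ℝ := Real.sqrt (2 * Real.pi) with hc
  have hcpos : 0 < c := Real.sqrt_pos.2 (by positivity)
  set z : Ω → ι → ℝ := fun ω i => Real.sqrt (2 * (s * μ i)) * ∑ x, f i x * ξ ω x with hz
  have hsm : ∀ i, 0 ≤ s * μ i := fun i => mul_nonneg hs (hμ0 i)
  have hprod : ∀ (b : ι → ℝ) (y : ι → ℝ) (t : ι → ℝ),
      ∏ i, Real.exp (t i * y i - b i * t i ^ 2) =
        Real.exp (∑ i, (t i * y i - b i * t i ^ 2)) := fun b y t => (Real.exp_sum _ _).symm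
  have hint : ∀ (b : ι → ℝ), (∀ i, 0 < b i) → ∀ y : ι → ℝ, MeasureTheory.Integrable
      fun t : ι → ℝ => Real.exp (∑ i, (t i * y i - b i * t i ^ 2)) := by
    intro b hb y
    have := MeasureTheory.Integrable.fintype_prod (μ := fun _ : ι => MeasureTheory.volume)
      (f := fun i (t : ℝ) => Real.exp (t * y i - b i * t ^ 2))
      (fun i => integrable_exp_mul_sub_mul_sq (hb i) (y i))
    simp only [hprod] at this
    exact this
  have h1 : ∀ ω, c ^ Fintype.card ι * Real.exp (s * ∑ i, μ i * (∑ x, f i x * ξ ω x) ^ 2) =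
      ∫ t : ι → ℝ, Real.exp (∑ i, (t i * z ω i - 1 / 2 * t i ^ 2)) := by
    intro ω
    have h2 := MeasureTheory.integral_fintype_prod_volume_eq_prod
      (f := fun i (t : ℝ) => Real.exp (t * z ω i - 1 / 2 * t ^ 2))
    simp_rw [Real.exp_sum]
    refine Eq.trans ?_ h2.symm
    rw [Finset.prod_congr rfl fun i _ => integral_exp_mul_sub_sq (z ω i)]
    rw [Finset.prod_mul_distrib, Finset.prod_const, ← Real.exp_sum, Finset.card_univ]
    congr 2
    rw [Finset.mul_sum]
    refine Finset.sum_congr rfl fun i _ => ?_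
    rw [hz]
    simp only [mul_pow]
    rw [Real.sq_sqrt (by linarith [hsm i])]
    ring
  have h3 : ∀ t : ι → ℝ, ∑ ω, Real.exp (∑ i, (t i * z ω i - 1 / 2 * t i ^ 2)) ≤
      Fintype.card Ω * Real.exp (∑ i, (t i * 0 - (1 / 2 - s * μ i) * t i ^ 2)) := by
    intro t
    have h4 := hξ fun x => ∑ i, (t i * Real.sqrt (2 * (s * μ i))) * f i x
    have h5 := hf fun i => t i * Real.sqrt (2 * (s * μ i))
    rw [h5] at h4
    have h6 : ∀ ω, Real.exp (∑ i, (t i * z ω i - 1 / 2 * t i ^ 2)) =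
        Real.exp (∑ x, (∑ i, (t i * Real.sqrt (2 * (s * μ i))) * f i x) * ξ ω x) *
          Real.exp (-(∑ i, 1 / 2 * t i ^ 2)) := by
      intro ω
      rw [← Real.exp_add, Finset.sum_sub_distrib, sub_eq_add_neg]
      congr 2
      simp_rw [hz, Finset.sum_mul, Finset.mul_sum]
      rw [Finset.sum_comm]
      refine Finset.sum_congr rfl fun i _ => Finset.sum_congr rfl fun x _ => by ring
    simp_rw [h6]
    rw [← Finset.sum_mul]
    refine (mul_le_mul_of_nonneg_right h4 (Real.exp_pos _).le).trans (le_of_eq ?_)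
    rw [mul_assoc, ← Real.exp_add]
    congr 2
    rw [Finset.sum_div, ← Finset.sum_neg_distrib, ← Finset.sum_add_distrib]
    refine Finset.sum_congr rfl fun i _ => ?_
    rw [mul_pow, Real.sq_sqrt (by linarith [hsm i])]
    ring
  have h7 : c ^ Fintype.card ι * ∑ ω, Real.exp (s * ∑ i, μ i * (∑ x, f i x * ξ ω x) ^ 2) ≤
      c ^ Fintype.card ι * (Fintype.card Ω * Real.exp (2 * s * ∑ i, μ i)) := by
    rw [Finset.mul_sum]
    simp_rw [h1]
    rw [← MeasureTheory.integral_finsetSum _ fun ω _ => hint _ (fun _ => by norm_num) _]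
    refine (MeasureTheory.integral_mono
      (MeasureTheory.integrable_finsetSum _ fun ω _ => hint _ (fun _ => by norm_num) _)
      ((hint _ (fun i => by linarith [hμ i]) _).const_mul _) h3).trans ?_
    rw [MeasureTheory.integral_const_mul]
    have h8 := MeasureTheory.integral_fintype_prod_volume_eq_prod
      (f := fun i (t : ℝ) => Real.exp (t * 0 - (1 / 2 - s * μ i) * t ^ 2))
    have h9 : ∏ i, ∫ t : ℝ, Real.exp (t * 0 - (1 / 2 - s * μ i) * t ^ 2) ≤
        c ^ Fintype.card ι * Real.exp (2 * s * ∑ i, μ i) := by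
      refine (Finset.prod_le_prod (fun i _ => MeasureTheory.integral_nonneg fun t =>
        (Real.exp_pos _).le) fun i _ => integral_exp_mul_sq_le (hsm i) (hμ i)).trans (le_of_eq ?_)
      rw [Finset.prod_mul_distrib, Finset.prod_const, ← Real.exp_sum, Finset.card_univ,
        Finset.mul_sum]
      congr 2
      exact Finset.sum_congr rfl fun i _ => by ring
    simp_rw [Real.exp_sum]
    rw [h8]
    calc _ ≤ (Fintype.card Ω : ℝ) * (c ^ Fintype.card ι * Real.exp (2 * s * ∑ i, μ i)) :=
          mul_le_mul_of_nonneg_left h9 (Nat.cast_nonneg _)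
      _ = _ := by ring
  exact le_of_mul_le_mul_left h7 (by positivity)

/-- The sign of a bit. -/
def bitSign (b : Bool) : ℝ := if b then 1 else -1

/-- The vector `x ↦ ∑ j, ± a j` with independent signs is sub-Gaussian, by `cosh t ≤ exp (t² /
2)`. -/
theorem sum_exp_signs_le {X J : Type*} [Fintype X] [Fintype J] [DecidableEq X] [DecidableEq J]
    (a : J → ℝ) (ha : ∑ j, a j ^ 2 ≤ 1) (v : X → ℝ) :
    ∑ ω : X × J → Bool, Real.exp (∑ x, v x * ∑ j, bitSign (ω (x, j)) * a j) ≤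
      Fintype.card (X × J → Bool) * Real.exp ((∑ x, v x ^ 2) / 2) := by
  have h1 : ∀ ω : X × J → Bool, Real.exp (∑ x, v x * ∑ j, bitSign (ω (x, j)) * a j) =
      ∏ q : X × J, Real.exp (bitSign (ω q) * (v q.1 * a q.2)) := by
    intro ω
    rw [← Real.exp_sum, Fintype.sum_prod_type]
    congr 1
    refine Finset.sum_congr rfl fun x _ => ?_
    rw [Finset.mul_sum]
    exact Finset.sum_congr rfl fun j _ => by ring
  simp_rw [h1]
  have h2 := Finset.prod_univ_sum (fun _ : X × J => (Finset.univ : Finset Bool))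
    (fun q b => Real.exp (bitSign b * (v q.1 * a q.2)))
  rw [Fintype.piFinset_univ] at h2
  rw [← h2]
  have h3 : ∀ q : X × J, ∑ b, Real.exp (bitSign b * (v q.1 * a q.2)) ≤
      2 * Real.exp ((v q.1 * a q.2) ^ 2 / 2) := by
    intro q
    have := Real.cosh_le_exp_half_sq (v q.1 * a q.2)
    rw [Real.cosh_eq] at this
    simp only [Fintype.sum_bool, bitSign]
    norm_num
    linarith
  refine (Finset.prod_le_prod (fun q _ => Finset.sum_nonneg fun b _ => (Real.exp_pos _).le)
    fun q _ => h3 q).trans ?_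
  rw [Finset.prod_mul_distrib, Finset.prod_const, ← Real.exp_sum]
  simp only [Fintype.card_fun, Fintype.card_bool, Finset.card_univ, Nat.cast_pow, Nat.cast_ofNat]
  refine mul_le_mul_of_nonneg_left (Real.exp_le_exp.2 ?_) (by positivity)
  rw [← Finset.sum_div, Fintype.sum_prod_type]
  refine div_le_div_of_nonneg_right (Finset.sum_le_sum fun x _ => ?_) (by norm_num)
  simp_rw [mul_pow]
  rw [← Finset.mul_sum]
  exact mul_le_of_le_one_right (sq_nonneg _) ha

/-- Exponential moments of a positive quadratic form of sums of random signs. -/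
theorem sum_exp_dotProduct_signs_le {X J : Type*} [Fintype X] [Fintype J] [DecidableEq X]
    [DecidableEq J] (a : J → ℝ) (ha : ∑ j, a j ^ 2 ≤ 1) (C : Matrix X X ℝ) (hC : C.PosSemidef)
    (s β : ℝ) (hs : 0 ≤ s) (hβ : ∀ v : X → ℝ, v ⬝ᵥ C *ᵥ v ≤ β * ∑ x, v x ^ 2)
    (hsβ : s * β ≤ 1 / 4) :
    ∑ ω : X × J → Bool, Real.exp (s * ((fun x => ∑ j, bitSign (ω (x, j)) * a j) ⬝ᵥ
        C *ᵥ fun x => ∑ j, bitSign (ω (x, j)) * a j)) ≤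
      Fintype.card (X × J → Bool) * Real.exp (2 * s * C.trace) := by
  set f : X → X → ℝ := fun i x => hC.isHermitian.eigenvectorBasis i x with hf
  set μ := hC.isHermitian.eigenvalues with hμ
  have hnorm : ∀ t : X → ℝ, ∑ x, (∑ i, t i * f i x) ^ 2 = ∑ i, t i ^ 2 := by
    intro t
    have h1 := hC.isHermitian.eigenvectorBasis.repr.symm.norm_map (WithLp.toLp 2 t)
    have h2 : ∀ x, (hC.isHermitian.eigenvectorBasis.repr.symm (WithLp.toLp 2 t)) x =
        ∑ i, t i * f i x := by
      intro x
      rw [← OrthonormalBasis.sum_repr_symm]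
      simp [hf]
    have h3 := congrArg (· ^ 2) h1
    simp only [EuclideanSpace.norm_sq_eq, h2, Real.norm_eq_abs, sq_abs] at h3
    exact h3
  have hquad : ∀ v : X → ℝ, v ⬝ᵥ C *ᵥ v = ∑ i, μ i * (∑ x, f i x * v x) ^ 2 := by
    intro v
    have h1 : ∀ y z, C y z = ∑ i, μ i * (f i y * f i z) := by
      intro y z
      have h2 := congrFun (congrFun hC.isHermitian.spectral_theorem y) z
      simp only [Unitary.conjStarAlgAut_apply, Matrix.mul_apply, Matrix.diagonal_apply,
        Matrix.star_apply, Matrix.IsHermitian.eigenvectorUnitary_apply] at h2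
      rw [h2]
      simp [hf, hμ]
      exact Finset.sum_congr rfl fun i _ => by ring
    simp only [dotProduct, Matrix.mulVec, h1, sq, Finset.sum_mul_sum]
    simp only [Finset.mul_sum, Finset.sum_mul]
    rw [Finset.sum_comm' (t' := Finset.univ) (s' := fun _ => Finset.univ) (by simp)]
    conv_rhs =>
      rw [Finset.sum_comm]
      enter [2, y]
      rw [Finset.sum_comm]
    rw [Finset.sum_comm]
    refine Finset.sum_congr rfl fun y _ => Finset.sum_congr rfl fun z _ =>
      Finset.sum_congr rfl fun i _ => by ring
  have htr : C.trace = ∑ i, μ i := by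
    simpa using hC.isHermitian.trace_eq_sum_eigenvalues
  have hle : ∀ i, μ i ≤ β := by
    intro i
    have h1 := hβ (f i)
    have h2 : ∑ x, f i x ^ 2 = 1 := by
      have := hnorm (Pi.single i 1)
      simpa [Pi.single_apply] using this
    have h3 : f i ⬝ᵥ C *ᵥ f i = μ i := by
      have := hC.isHermitian.mulVec_eigenvectorBasis i
      rw [show C *ᵥ f i = μ i • f i from this, dotProduct_smul, smul_eq_mul]
      simp only [dotProduct, ← sq, h2, mul_one]
    rwa [h2, h3, mul_one] at h1
  simp_rw [hquad, htr]
  exact sum_exp_quadratic_le _ (sum_exp_signs_le a ha) f hnorm μ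
    (fun i => hC.eigenvalues_nonneg i) s hs fun i =>
      (mul_le_mul_of_nonneg_left (hle i) hs).trans hsβ

/-- Some choice of signs makes all quadratic forms of a family, of less than exponential
cardinality, at most four times as large as their bounds `τ k` on the mean. -/
theorem exists_signs {X J K : Type*} [Fintype X] [Fintype J] [Fintype K] [DecidableEq X]
    [DecidableEq J] (a : K → J → ℝ) (ha : ∀ k, ∑ j, a k j ^ 2 ≤ 1) (C : K → Matrix X X ℝ)
    (hC : ∀ k, (C k).PosSemidef) (β : ℝ) (hβ0 : 0 < β)
    (hβ : ∀ k (v : X → ℝ), v ⬝ᵥ C k *ᵥ v ≤ β * ∑ x, v x ^ 2) (τ : K → ℝ)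
    (hτ : ∀ k, (C k).trace ≤ τ k) (ε : ℝ) (hε : ∀ k, ε ≤ τ k)
    (hK : (Fintype.card K : ℝ) < Real.exp (ε / (2 * β))) :
    ∃ ω : X × J → Bool, ∀ k, (fun x => ∑ j, bitSign (ω (x, j)) * a k j) ⬝ᵥ
      C k *ᵥ (fun x => ∑ j, bitSign (ω (x, j)) * a k j) ≤ 4 * τ k := by
  by_contra! hcon
  -- the largest exponent for which exponential moments are available
  set s : ℝ := 1 / (4 * β) with hs
  have hs0 : 0 < s := by positivity
  have hsβ : s * β = 1 / 4 := by rw [hs]; field_simp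
  set Q : (X × J → Bool) → K → ℝ := fun ω k => (fun x => ∑ j, bitSign (ω (x, j)) * a k j) ⬝ᵥ
      C k *ᵥ (fun x => ∑ j, bitSign (ω (x, j)) * a k j) with hQ
  have h1 : ∀ ω, 1 ≤ ∑ k, Real.exp (s * Q ω k) * Real.exp (-(s * (4 * τ k))) := by
    intro ω
    obtain ⟨k, hk⟩ := hcon ω
    have h2 : 1 ≤ Real.exp (s * Q ω k) * Real.exp (-(s * (4 * τ k))) := by
      rw [← Real.exp_add]
      apply Real.one_le_exp
      have := mul_le_mul_of_nonneg_left hk.le hs0.le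
      simp only [hQ]
      linarith
    exact h2.trans (Finset.single_le_sum (f := fun k => Real.exp (s * Q ω k) *
      Real.exp (-(s * (4 * τ k)))) (fun k _ => by positivity) (Finset.mem_univ k))
  have h3 : (Fintype.card (X × J → Bool) : ℝ) ≤
      ∑ k : K, Fintype.card (X × J → Bool) * Real.exp (-(ε / (2 * β))) := by
    calc (Fintype.card (X × J → Bool) : ℝ) = ∑ ω : X × J → Bool, (1 : ℝ) := by
          simp
      _ ≤ ∑ ω, ∑ k, Real.exp (s * Q ω k) * Real.exp (-(s * (4 * τ k))) :=
          Finset.sum_le_sum fun ω _ => h1 ω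
      _ = ∑ k, (∑ ω, Real.exp (s * Q ω k)) * Real.exp (-(s * (4 * τ k))) := by
          rw [Finset.sum_comm]
          simp_rw [Finset.sum_mul]
      _ ≤ _ := by
          refine Finset.sum_le_sum fun k _ => ?_
          have h4 := sum_exp_dotProduct_signs_le (a k) (ha k) (C k) (hC k) s β hs0.le (hβ k) hsβ.le
          refine (mul_le_mul_of_nonneg_right h4 (Real.exp_pos _).le).trans ?_
          rw [mul_assoc, ← Real.exp_add]
          refine mul_le_mul_of_nonneg_left (Real.exp_le_exp.2 ?_) (Nat.cast_nonneg _)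
          have h5 : ε / (2 * β) = 2 * s * ε := by rw [hs]; field_simp; ring
          rw [h5]
          have := hτ k
          have := hε k
          nlinarith
  rw [Finset.sum_const, Finset.card_univ, nsmul_eq_mul] at h3
  have hpos : (0 : ℝ) < Fintype.card (X × J → Bool) := by
    exact_mod_cast Fintype.card_pos
  have h6 : (Fintype.card K : ℝ) * Real.exp (-(ε / (2 * β))) < 1 := by
    rw [Real.exp_neg, ← div_eq_mul_inv, div_lt_one (Real.exp_pos _)]
    exact hK
  nlinarith

/-! ### Random embeddings -/

section Embedding

/-- Nets of the unit ball from a grid of spacing `1 / (r (D + 1))` in the real and imaginary parts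
of the coordinates. -/
theorem exists_net (r : ℕ) (hr : 1 ≤ r) (D : ℕ) : ∃ N : Finset (EuclideanSpace ℂ (Fin D)),
    N.card ≤ (3 * r * (D + 1)) ^ (2 * D) ∧ (∀ v ∈ N, ‖v‖ ≤ 2) ∧
    ∀ v : EuclideanSpace ℂ (Fin D), ‖v‖ ≤ 1 → ∃ v' ∈ N, ‖v - v'‖ ≤ 1 / r := by
  classical
  set q : ℕ := r * (D + 1) with hq
  have hq1 : 1 ≤ q := Nat.one_le_iff_ne_zero.2 (by positivity)
  have hq0 : (0 : ℝ) < q := by exact_mod_cast hq1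
  let I : Finset ℤ := Finset.Icc (-(q : ℤ)) q
  let P : Fin D → ℤ × ℤ → ℂ := fun _ k => ((k.1 / q : ℝ) : ℂ) + ((k.2 / q : ℝ) : ℂ) * Complex.I
  let N₀ : Finset (EuclideanSpace ℂ (Fin D)) :=
    (Fintype.piFinset fun _ : Fin D => I ×ˢ I).image fun k => WithLp.toLp 2 fun j => P j (k j)
  refine ⟨N₀.filter fun v => ‖v‖ ≤ 2, ?_, fun v hv => (Finset.mem_filter.1 hv).2, ?_⟩
  · refine (Finset.card_filter_le _ _).trans (Finset.card_image_le.trans ?_)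
    rw [Fintype.card_piFinset]
    simp only [Finset.card_product, Finset.prod_const, Finset.card_univ, Fintype.card_fin]
    have hI : I.card ≤ 3 * r * (D + 1) := by
      simp only [I, Int.card_Icc]
      rw [mul_assoc, ← hq]
      omega
    calc (I.card * I.card) ^ D ≤ (3 * r * (D + 1) * (3 * r * (D + 1))) ^ D := by gcongr
      _ = _ := by rw [← sq, ← pow_mul]
  · intro v hv
    let k : Fin D → ℤ × ℤ := fun j => (round (q * (v j).re), round (q * (v j).im))
    let v' : EuclideanSpace ℂ (Fin D) := WithLp.toLp 2 fun j => P j (k j)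
    have hcoord : ∀ j, ‖v j‖ ≤ 1 := fun j => (PiLp.norm_apply_le v j).trans hv
    have hround : ∀ t : ℝ, |t| ≤ 1 → round (q * t) ∈ I := by
      intro t ht
      have h1 := abs_sub_round ((q : ℝ) * t)
      rw [abs_le] at h1 ht
      have h2 : ((round ((q : ℝ) * t) : ℤ) : ℝ) < q + 1 := by nlinarith
      have h3 : (-(q : ℝ) - 1) < ((round ((q : ℝ) * t) : ℤ) : ℝ) := by nlinarith
      have h2' : round ((q : ℝ) * t) < (q : ℤ) + 1 := by exact_mod_cast h2
      have h3' : -(q : ℤ) - 1 < round ((q : ℝ) * t) := by exact_mod_cast h3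
      simp only [I, Finset.mem_Icc]
      omega
    have herr : ∀ t : ℝ, (t - (round (q * t) : ℤ) / q) ^ 2 ≤ 1 / (4 * q ^ 2) := by
      intro t
      have h1 := abs_sub_round ((q : ℝ) * t)
      have h2 : t - (round (q * t) : ℤ) / q = (q * t - (round (q * t) : ℤ)) / q := by
        field_simp
      rw [h2, div_pow, div_le_div_iff₀ (by positivity) (by positivity), ← sq_abs]
      have h3 : |(q : ℝ) * t - (round (q * t) : ℤ)| ^ 2 ≤ (1 / 2) ^ 2 :=
        pow_le_pow_left₀ (abs_nonneg _) h1 2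
      nlinarith [sq_nonneg (q : ℝ)]
    have hdist : ‖v - v'‖ ≤ 1 / r := by
      have h1 : ‖v - v'‖ ^ 2 ≤ ∑ _j : Fin D, 1 / (2 * (q : ℝ) ^ 2) := by
        rw [EuclideanSpace.norm_sq_eq]
        refine Finset.sum_le_sum fun j _ => ?_
        rw [← Complex.normSq_eq_norm_sq, Complex.normSq_apply]
        have h2 := herr (v j).re
        have h3 := herr (v j).im
        have h4 : 1 / (2 * (q : ℝ) ^ 2) = 1 / (4 * q ^ 2) + 1 / (4 * q ^ 2) := by
          field_simp; norm_num
        rw [h4, ← sq, ← sq]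
        refine add_le_add (le_trans (le_of_eq ?_) h2) (le_trans (le_of_eq ?_) h3) <;>
          simp [v', P, k]
      rw [Finset.sum_const, Finset.card_univ, Fintype.card_fin, nsmul_eq_mul] at h1
      have hr0 : (0 : ℝ) < r := by exact_mod_cast hr
      have h5 : (D : ℝ) * (1 / (2 * (q : ℝ) ^ 2)) ≤ (1 / r) ^ 2 := by
        rw [hq]
        push_cast
        rw [mul_one_div, div_pow, div_le_div_iff₀ (by positivity) (by positivity)]
        have : (D : ℝ) ≤ 2 * (D + 1) ^ 2 := by nlinarith [(Nat.cast_nonneg D : (0 : ℝ) ≤ D)]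
        nlinarith [sq_nonneg (r : ℝ)]
      exact (pow_le_pow_iff_left₀ (norm_nonneg _) (by positivity) two_ne_zero).1 (h1.trans h5)
    refine ⟨v', Finset.mem_filter.2 ⟨Finset.mem_image.2 ⟨k, ?_, rfl⟩, ?_⟩, hdist⟩
    · rw [Fintype.mem_piFinset]
      intro j
      exact Finset.mem_product.2 ⟨hround _ ((Complex.abs_re_le_norm _).trans (hcoord j)),
        hround _ ((Complex.abs_im_le_norm _).trans (hcoord j))⟩
    · have h1 : ‖v'‖ ≤ ‖v‖ + ‖v - v'‖ := by
        have := norm_sub_le v (v - v')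
        simpa using this
      have h2 : (1 : ℝ) / r ≤ 1 := by
        rw [div_le_one (by exact_mod_cast hr)]
        exact_mod_cast hr
      linarith

variable {X J I : Type*} [Fintype X] [Fintype J] [Fintype I] {E F : Type*}
  [NormedAddCommGroup E] [InnerProductSpace ℂ E] [NormedAddCommGroup F] [InnerProductSpace ℂ F]

/-- The map `a ↦ ∑ x, √(p x) (∑ j, ± a j) u x` with the signs given by `ω`. For independent
uniform signs the image of a unit vector has the covariance `∑ x, p x |u x⟩⟨u x|`. -/
def signEmbedding (u : X → E) (p : X → ℝ) (ω : X × J → Bool) : EuclideanSpace ℂ J →ₗ[ℂ] E where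
  toFun a := ∑ x, ((Real.sqrt (p x) : ℂ) * ∑ j, (bitSign (ω (x, j)) : ℂ) * a j) • u x
  map_add' a a' := by
    simp only [PiLp.add_apply, mul_add, Finset.sum_add_distrib, add_smul]
  map_smul' c a := by
    simp only [PiLp.smul_apply, smul_eq_mul, RingHom.id_apply, Finset.smul_sum, smul_smul]
    refine Finset.sum_congr rfl fun x _ => ?_
    congr 1
    rw [Finset.mul_sum, Finset.mul_sum, Finset.mul_sum]
    exact Finset.sum_congr rfl fun j _ => by ring

/-- The quadratic form `ψ ↦ ∑ i, w i ‖ℓ i ψ‖²`. -/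
def sqForm (w : I → ℝ) (ℓ : I → E →ₗ[ℂ] F) (ψ : E) : ℝ := ∑ i, w i * ‖ℓ i ψ‖ ^ 2

theorem sqForm_add_le {w : I → ℝ} (hw : ∀ i, 0 ≤ w i) (ℓ : I → E →ₗ[ℂ] F) (ψ φ : E) :
    sqForm w ℓ (ψ + φ) ≤ 2 * sqForm w ℓ ψ + 2 * sqForm w ℓ φ := by
  simp only [sqForm, Finset.mul_sum, ← Finset.sum_add_distrib]
  refine Finset.sum_le_sum fun i _ => ?_
  have h : ‖ℓ i (ψ + φ)‖ ^ 2 ≤ 2 * ‖ℓ i ψ‖ ^ 2 + 2 * ‖ℓ i φ‖ ^ 2 := by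
    rw [map_add]
    have := norm_add_le (ℓ i ψ) (ℓ i φ)
    nlinarith [norm_nonneg (ℓ i ψ + ℓ i φ), sq_nonneg (‖ℓ i ψ‖ - ‖ℓ i φ‖)]
  nlinarith [mul_le_mul_of_nonneg_left h (hw i)]

theorem sqForm_smul (w : I → ℝ) (ℓ : I → E →ₗ[ℂ] F) (c : ℂ) (ψ : E) :
    sqForm w ℓ (c • ψ) = ‖c‖ ^ 2 * sqForm w ℓ ψ := by
  simp only [sqForm, Finset.mul_sum, map_smul, norm_smul]
  exact Finset.sum_congr rfl fun i _ => by ring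

/-- The real matrix of a quadratic form in the vectors `√(p x) u x`. -/
def sqFormMatrix (u : X → E) (p : X → ℝ) (w : I → ℝ) (ℓ : I → E →ₗ[ℂ] F) : Matrix X X ℝ :=
  Matrix.of fun y z => Real.sqrt (p y) * Real.sqrt (p z) *
    ∑ i, w i * (inner ℂ (ℓ i (u y)) (ℓ i (u z))).re

theorem dotProduct_sqFormMatrix (u : X → E) (p : X → ℝ) (w : I → ℝ) (ℓ : I → E →ₗ[ℂ] F)
    (v : X → ℝ) : v ⬝ᵥ sqFormMatrix u p w ℓ *ᵥ v =
      sqForm w ℓ (∑ x, ((Real.sqrt (p x) : ℂ) * v x) • u x) := by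
  have h : ∀ i, ‖ℓ i (∑ x, ((Real.sqrt (p x) : ℂ) * v x) • u x)‖ ^ 2 =
      ∑ y, ∑ z, v y * v z * (Real.sqrt (p y) * Real.sqrt (p z)) *
        (inner ℂ (ℓ i (u y)) (ℓ i (u z))).re := by
    intro i
    rw [← inner_self_eq_norm_sq (𝕜 := ℂ)]
    simp only [map_sum, map_smul]
    rw [sum_inner, map_sum]
    refine Finset.sum_congr rfl fun y _ => ?_
    rw [inner_sum, map_sum]
    refine Finset.sum_congr rfl fun z _ => ?_
    simp only [inner_smul_left, inner_smul_right, Complex.conj_ofReal, ← Complex.ofReal_mul,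
      ← mul_assoc]
    rw [RCLike.re_eq_complex_re, Complex.re_ofReal_mul]
    ring
  simp only [sqForm, h, sqFormMatrix, dotProduct, Matrix.mulVec, Matrix.of_apply, Finset.mul_sum,
    Finset.sum_mul]
  rw [Finset.sum_comm (s := (Finset.univ : Finset I))]
  refine Finset.sum_congr rfl fun y _ => ?_
  rw [Finset.sum_comm]
  exact Finset.sum_congr rfl fun i _ => Finset.sum_congr rfl fun z _ => by ring

theorem sqFormMatrix_posSemidef (u : X → E) (p : X → ℝ) {w : I → ℝ} (hw : ∀ i, 0 ≤ w i)
    (ℓ : I → E →ₗ[ℂ] F) : (sqFormMatrix u p w ℓ).PosSemidef := by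
  refine Matrix.PosSemidef.of_dotProduct_mulVec_nonneg ?_ fun v => ?_
  · ext y z
    simp only [Matrix.conjTranspose_apply, sqFormMatrix, Matrix.of_apply, star_trivial]
    rw [mul_comm (Real.sqrt (p z))]
    congr 1
    refine Finset.sum_congr rfl fun i _ => ?_
    rw [← inner_conj_symm, Complex.conj_re]
  · rw [star_trivial, dotProduct_sqFormMatrix]
    exact Finset.sum_nonneg fun i _ => mul_nonneg (hw i) (sq_nonneg _)

theorem trace_sqFormMatrix (u : X → E) {p : X → ℝ} (hp : ∀ x, 0 ≤ p x) (w : I → ℝ)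
    (ℓ : I → E →ₗ[ℂ] F) : (sqFormMatrix u p w ℓ).trace = ∑ x, p x * sqForm w ℓ (u x) := by
  simp only [Matrix.trace, Matrix.diag_apply, sqFormMatrix, Matrix.of_apply, sqForm,
    Real.mul_self_sqrt (hp _)]
  refine Finset.sum_congr rfl fun x _ => ?_
  congr 1
  refine Finset.sum_congr rfl fun i _ => ?_
  rw [← inner_self_eq_norm_sq (𝕜 := ℂ), RCLike.re_eq_complex_re]

/-- The matrix of a form with bound `κ` has norm at most `κ δ` if `p ≤ δ`. -/
theorem sqFormMatrix_le (u : OrthonormalBasis X ℂ E) {p : X → ℝ} (hp : ∀ x, 0 ≤ p x) {δ κ : ℝ}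
    (hδ : ∀ x, p x ≤ δ) {w : I → ℝ} {ℓ : I → E →ₗ[ℂ] F} (hκ0 : 0 ≤ κ)
    (hκ : ∀ ψ, sqForm w ℓ ψ ≤ κ * ‖ψ‖ ^ 2) (v : X → ℝ) :
    v ⬝ᵥ sqFormMatrix u p w ℓ *ᵥ v ≤ κ * δ * ∑ x, v x ^ 2 := by
  rw [dotProduct_sqFormMatrix]
  refine (hκ _).trans ?_
  rw [mul_assoc]
  refine mul_le_mul_of_nonneg_left ?_ hκ0
  have h1 := u.repr.norm_map (∑ x, ((Real.sqrt (p x) : ℂ) * v x) • u x)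
  rw [← h1, EuclideanSpace.norm_sq_eq, Finset.mul_sum]
  refine Finset.sum_le_sum fun x _ => ?_
  have h2 : u.repr (∑ x, ((Real.sqrt (p x) : ℂ) * v x) • u x) x = (Real.sqrt (p x) : ℂ) * v x := by
    classical
    simp [map_sum, Pi.single_apply]
  rw [h2, norm_mul, mul_pow, Complex.norm_real, Complex.norm_real, Real.norm_eq_abs,
    Real.norm_eq_abs, sq_abs, sq_abs, Real.sq_sqrt (hp x)]
  exact mul_le_mul_of_nonneg_right (hδ x) (sq_nonneg _)

/-- Random signs are applied to real vectors only: the real and imaginary parts of `v` are treated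
separately, and halved, so that they lie in the unit ball for `v` from a net. -/
theorem sqForm_signEmbedding_le {D : ℕ} (u : X → E) (p : X → ℝ) (ω : X × Fin D → Bool)
    {w : I → ℝ} (hw : ∀ i, 0 ≤ w i) (ℓ : I → E →ₗ[ℂ] F) (t : ℝ) (v : EuclideanSpace ℂ (Fin D))
    (hre : (fun x => ∑ j, bitSign (ω (x, j)) * ((v j).re / 2)) ⬝ᵥ sqFormMatrix u p w ℓ *ᵥ
      (fun x => ∑ j, bitSign (ω (x, j)) * ((v j).re / 2)) ≤ 4 * t)
    (him : (fun x => ∑ j, bitSign (ω (x, j)) * ((v j).im / 2)) ⬝ᵥ sqFormMatrix u p w ℓ *ᵥ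
      (fun x => ∑ j, bitSign (ω (x, j)) * ((v j).im / 2)) ≤ 4 * t) :
    sqForm w ℓ (signEmbedding u p ω v) ≤ 64 * t := by
  rw [dotProduct_sqFormMatrix] at hre him
  have h1 : signEmbedding u p ω v =
      (2 : ℂ) • ∑ x, ((Real.sqrt (p x) : ℂ) *
        (∑ j, bitSign (ω (x, j)) * ((v j).re / 2) : ℝ)) • u x +
      (2 * Complex.I) • ∑ x, ((Real.sqrt (p x) : ℂ) *
        (∑ j, bitSign (ω (x, j)) * ((v j).im / 2) : ℝ)) • u x := by
    simp only [signEmbedding, LinearMap.coe_mk, AddHom.coe_mk, Finset.smul_sum, smul_smul]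
    rw [← Finset.sum_add_distrib]
    refine Finset.sum_congr rfl fun x _ => ?_
    rw [← add_smul]
    congr 1
    push_cast
    simp only [Finset.mul_sum]
    rw [← Finset.sum_add_distrib]
    refine Finset.sum_congr rfl fun j _ => ?_
    linear_combination (-(Real.sqrt (p x) * bitSign (ω (x, j))) : ℂ) * Complex.re_add_im (v j)
  rw [h1]
  refine (sqForm_add_le hw ℓ _ _).trans ?_
  rw [sqForm_smul, sqForm_smul, norm_mul, Complex.norm_I, Complex.norm_two]
  linarith

/-- If every form of a family has a small mean with respect to the distribution `p` on the basis
`u`, then some sign embedding keeps all of them small on a given finite set of vectors. -/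
theorem exists_embedding [DecidableEq X] {D : ℕ} (u : OrthonormalBasis X ℂ E) {p : X → ℝ}
    (hp : ∀ x, 0 ≤ p x) (hp1 : ∑ x, p x = 1) {δ κ ε : ℝ} (hδ0 : 0 < δ) (hδ : ∀ x, p x ≤ δ)
    (hκ1 : 1 ≤ κ) (hε : ε ≤ 1) {Γ : Type*} [Fintype Γ] {w : I → ℝ} (hw : ∀ i, 0 ≤ w i)
    (ℓ : Γ → I → E →ₗ[ℂ] F) (hκ : ∀ γ ψ, sqForm w (ℓ γ) ψ ≤ κ * ‖ψ‖ ^ 2)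
    (hmean : ∀ γ, ∑ x, p x * sqForm w (ℓ γ) (u x) ≤ ε)
    (N : Finset (EuclideanSpace ℂ (Fin D))) (hN : ∀ v ∈ N, ‖v‖ ≤ 2)
    (hcard : 2 * (Fintype.card Γ + 1) * (N.card : ℝ) < Real.exp (ε / (2 * (κ * δ)))) :
    ∃ V : EuclideanSpace ℂ (Fin D) →ₗ[ℂ] E, (∀ γ, ∀ v ∈ N, sqForm w (ℓ γ) (V v) ≤ 64 * ε) ∧
      (∀ v ∈ N, ‖V v‖ ^ 2 ≤ 64) ∧ ∀ j, ‖V (EuclideanSpace.single j 1)‖ ^ 2 = 1 := by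
  -- the index `none` stands for the form `‖ψ‖ ^ 2`, which controls the norm of the embedding
  let part : Bool → ℂ → ℝ := fun s z => bif s then z.re else z.im
  let a : Option Γ × N × Bool → Fin D → ℝ := fun k j => part k.2.2 (k.2.1.1 j) / 2
  let w₁ : Unit → ℝ := fun _ => 1
  let ℓ₁ : Unit → E →ₗ[ℂ] E := fun _ => LinearMap.id
  have hform₁ : ∀ ψ, sqForm w₁ ℓ₁ ψ = ‖ψ‖ ^ 2 := fun ψ => by simp [sqForm, w₁, ℓ₁]
  have hκ₁ : ∀ ψ, sqForm w₁ ℓ₁ ψ ≤ κ * ‖ψ‖ ^ 2 := by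
    intro ψ
    rw [hform₁]
    exact le_mul_of_one_le_left (sq_nonneg _) hκ1
  let C : Option Γ × N × Bool → Matrix X X ℝ := fun k => match k.1 with
    | none => sqFormMatrix u p w₁ ℓ₁
    | some γ => sqFormMatrix u p w (ℓ γ)
  let τ : Option Γ × N × Bool → ℝ := fun k => match k.1 with
    | none => 1
    | some _ => ε
  have hpart : ∀ s z, part s z ^ 2 ≤ ‖z‖ ^ 2 := by
    intro s z
    rw [← Complex.normSq_eq_norm_sq, Complex.normSq_apply]
    cases s <;> simp only [part] <;> simp <;> nlinarith [mul_self_nonneg z.re, mul_self_nonneg z.im]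
  obtain ⟨ω, hω⟩ := exists_signs a (by
      rintro ⟨o, v, s⟩
      have h1 : ∑ j, (part s (v.1 j)) ^ 2 ≤ 4 := by
        have h2 := hN v.1 v.2
        have h3 : ‖v.1‖ ^ 2 ≤ 4 := by nlinarith [norm_nonneg v.1]
        rw [EuclideanSpace.norm_sq_eq] at h3
        exact (Finset.sum_le_sum fun j _ => hpart s _).trans h3
      simp only [a, div_pow]
      rw [← Finset.sum_div]
      linarith) C (by
      rintro ⟨o, v, s⟩
      cases o with
      | none => exact sqFormMatrix_posSemidef u p (fun _ => zero_le_one) ℓ₁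
      | some γ => exact sqFormMatrix_posSemidef u p hw (ℓ γ)) (κ * δ) (by positivity) (by
      rintro ⟨o, v, s⟩
      cases o with
      | none => exact sqFormMatrix_le u hp hδ (by linarith) hκ₁
      | some γ => exact sqFormMatrix_le u hp hδ (by linarith) (hκ γ)) τ (by
      rintro ⟨o, v, s⟩
      cases o with
      | none =>
        simp only [C, τ]
        rw [trace_sqFormMatrix _ hp]
        simp [hform₁, hp1]
      | some γ =>
        simp only [C, τ]
        rw [trace_sqFormMatrix _ hp]
        exact hmean γ) ε (by
      rintro ⟨o, v, s⟩
      cases o with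
      | none => exact hε
      | some γ => exact le_rfl) (by
      refine lt_of_eq_of_lt ?_ hcard
      simp only [Fintype.card_prod, Fintype.card_option, Fintype.card_coe, Fintype.card_bool]
      push_cast
      ring)
  refine ⟨signEmbedding u p ω, fun γ v hv => ?_, fun v hv => ?_, fun j => ?_⟩
  · exact sqForm_signEmbedding_le u p ω hw (ℓ γ) ε v (hω (some γ, ⟨v, hv⟩, true))
      (hω (some γ, ⟨v, hv⟩, false))
  · have := sqForm_signEmbedding_le u p ω (fun _ => zero_le_one) ℓ₁ 1 v (hω (none, ⟨v, hv⟩, true))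
      (hω (none, ⟨v, hv⟩, false))
    rw [hform₁] at this
    linarith
  · have h1 : signEmbedding u p ω (EuclideanSpace.single j 1) =
        ∑ x, ((Real.sqrt (p x) : ℂ) * bitSign (ω (x, j))) • u x := by
      simp only [signEmbedding, LinearMap.coe_mk, AddHom.coe_mk, PiLp.single_apply]
      simp
    rw [h1, ← u.repr.norm_map, EuclideanSpace.norm_sq_eq, ← hp1]
    refine Finset.sum_congr rfl fun x _ => ?_
    have h2 : u.repr (∑ x, ((Real.sqrt (p x) : ℂ) * bitSign (ω (x, j))) • u x) x =
        (Real.sqrt (p x) : ℂ) * bitSign (ω (x, j)) := by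
      simp [map_sum, Pi.single_apply]
    rw [h2, norm_mul, mul_pow, Complex.norm_real, Complex.norm_real, Real.norm_eq_abs,
      Real.norm_eq_abs, sq_abs, sq_abs, Real.sq_sqrt (hp x)]
    unfold bitSign
    split <;> simp

/-- A bound on a `1/2`-net of the unit ball extends to the whole space at the cost of a factor. -/
theorem norm_le_of_net {D : ℕ} (V : EuclideanSpace ℂ (Fin D) →ₗ[ℂ] E)
    (N : Finset (EuclideanSpace ℂ (Fin D)))
    (hN : ∀ v : EuclideanSpace ℂ (Fin D), ‖v‖ ≤ 1 → ∃ v' ∈ N, ‖v - v'‖ ≤ 1 / 2)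
    (hV : ∀ v ∈ N, ‖V v‖ ^ 2 ≤ 64) (v : EuclideanSpace ℂ (Fin D)) : ‖V v‖ ≤ 16 * ‖v‖ := by
  let W := LinearMap.toContinuousLinearMap V
  have h1 : ‖W‖ ≤ 8 + ‖W‖ / 2 := by
    refine ContinuousLinearMap.opNorm_le_of_unit_norm (by positivity) fun v hv => ?_
    obtain ⟨v', hv', hd⟩ := hN v hv.le
    have h2 : ‖V v'‖ ≤ 8 := by nlinarith [hV v' hv', norm_nonneg (V v')]
    have h3 : ‖W (v - v')‖ ≤ ‖W‖ * (1 / 2) :=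
      (W.le_opNorm _).trans (mul_le_mul_of_nonneg_left hd (norm_nonneg _))
    have h4 : W v = V v' + W (v - v') := by simp [W]
    rw [h4]
    refine (norm_add_le _ _).trans ?_
    linarith
  exact (W.le_opNorm v).trans (mul_le_mul_of_nonneg_right (by linarith) (norm_nonneg _))

/-- A map with unit columns and bounded norm is bounded below on a subspace of proportional
dimension, spanned by singular vectors. -/
theorem exists_subspace_bounded_below [FiniteDimensional ℂ E] {D : ℕ}
    (V : EuclideanSpace ℂ (Fin D) →ₗ[ℂ] E) (hV : ∀ v, ‖V v‖ ≤ 16 * ‖v‖)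
    (hcol : ∀ j, ‖V (EuclideanSpace.single j 1)‖ ^ 2 = 1) :
    ∃ W : Submodule ℂ (EuclideanSpace ℂ (Fin D)), D ≤ 512 * Module.finrank ℂ W ∧
      ∀ v ∈ W, ‖v‖ ^ 2 ≤ 2 * ‖V v‖ ^ 2 := by
  classical
  let T : EuclideanSpace ℂ (Fin D) →ₗ[ℂ] EuclideanSpace ℂ (Fin D) := LinearMap.adjoint V ∘ₗ V
  have hinner : ∀ v v', inner ℂ v (T v') = inner ℂ (V v) (V v') := by
    intro v v'
    simp only [T, LinearMap.comp_apply, LinearMap.adjoint_inner_right]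
  have hT : T.IsSymmetric := by
    intro v v'
    rw [hinner, ← inner_conj_symm, hinner, inner_conj_symm]
  have hn : Module.finrank ℂ (EuclideanSpace ℂ (Fin D)) = D := by simp
  let b := hT.eigenvectorBasis hn
  let μ := hT.eigenvalues hn
  have hb : ∀ i, T (b i) = (μ i : ℂ) • b i := hT.apply_eigenvectorBasis hn
  have hVb : ∀ i k, inner ℂ (V (b i)) (V (b k)) = if i = k then (μ k : ℂ) else 0 := by
    intro i k
    rw [← hinner, hb, inner_smul_right, orthonormal_iff_ite.1 b.orthonormal]
    simp
  have hμ : ∀ i, μ i = ‖V (b i)‖ ^ 2 := by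
    intro i
    have := congrArg Complex.re (hVb i i)
    rw [if_pos rfl, Complex.ofReal_re] at this
    rw [← this, ← inner_self_eq_norm_sq (𝕜 := ℂ)]
    rfl
  have hsum : ∑ i, μ i = D := by
    have h1 := LinearMap.trace_eq_sum_inner T b
    have h2 := LinearMap.trace_eq_sum_inner T (EuclideanSpace.basisFun (Fin D) ℂ)
    rw [h1] at h2
    simp only [hinner, hVb, if_true, EuclideanSpace.basisFun_apply, inner_self_eq_norm_sq_to_K]
      at h2
    have h3 : ((∑ i, μ i : ℝ) : ℂ) =
        ((∑ j : Fin D, ‖V (EuclideanSpace.single j 1)‖ ^ 2 : ℝ) : ℂ) := by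
      push_cast
      exact h2
    rw [Complex.ofReal_inj] at h3
    rw [h3]
    simp [hcol]
  have hμle : ∀ i, μ i ≤ 256 := by
    intro i
    have h1 := hV (b i)
    rw [b.norm_eq_one] at h1
    rw [hμ]
    nlinarith [norm_nonneg (V (b i))]
  let I : Finset (Fin D) := Finset.univ.filter fun i => 1 / 2 ≤ μ i
  refine ⟨Submodule.span ℂ (Set.range fun i : I => b i), ?_, ?_⟩
  · rw [finrank_span_eq_card (b := fun i : I => b i)
      (b.orthonormal.linearIndependent.comp _ Subtype.val_injective)]
    have h1 : ∀ i, μ i ≤ 1 / 2 + if i ∈ I then 256 else 0 := by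
      intro i
      by_cases hi : i ∈ I
      · rw [if_pos hi]; linarith [hμle i]
      · rw [if_neg hi]
        simp only [I, Finset.mem_filter, Finset.mem_univ, true_and, not_le] at hi
        linarith
    have h2 : (D : ℝ) ≤ ∑ i : Fin D, (1 / 2 + if i ∈ I then (256 : ℝ) else 0) := by
      rw [← hsum]
      exact Finset.sum_le_sum fun i _ => h1 i
    rw [Finset.sum_add_distrib, Finset.sum_ite_mem] at h2
    simp only [Finset.sum_const, Finset.card_univ, Fintype.card_fin, nsmul_eq_mul,
      Finset.univ_inter] at h2
    have h3 : (D : ℝ) ≤ 512 * (I.card : ℝ) := by linarith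
    rw [Fintype.card_coe]
    exact_mod_cast h3
  · intro v hv
    obtain ⟨c, rfl⟩ := (Submodule.mem_span_range_iff_exists_fun ℂ).1 hv
    have h1 : ‖∑ i : I, c i • b i‖ ^ 2 = ∑ i : I, ‖c i‖ ^ 2 := by
      have horth : Orthonormal ℂ fun i : I => b i := b.orthonormal.comp _ Subtype.val_injective
      rw [← inner_self_eq_norm_sq (𝕜 := ℂ), horth.inner_sum]
      simp only [map_sum]
      refine Finset.sum_congr rfl fun i _ => ?_
      rw [← Complex.normSq_eq_conj_mul_self, Complex.normSq_eq_norm_sq,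
        RCLike.re_eq_complex_re, Complex.ofReal_re]
    have h2 : ‖V (∑ i : I, c i • b i)‖ ^ 2 = ∑ i : I, μ i * ‖c i‖ ^ 2 := by
      rw [← inner_self_eq_norm_sq (𝕜 := ℂ)]
      simp only [map_sum, map_smul, sum_inner, inner_sum, inner_smul_left, inner_smul_right, hVb]
      refine Finset.sum_congr rfl fun i _ => ?_
      rw [Finset.sum_eq_single i]
      · have h3 : c i * ((starRingEnd ℂ) (c i) * μ i) = ((μ i * ‖c i‖ ^ 2 : ℝ) : ℂ) := by
          rw [← mul_assoc, Complex.mul_conj, Complex.normSq_eq_norm_sq]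
          push_cast
          ring
        rw [if_pos rfl, h3, RCLike.re_eq_complex_re, Complex.ofReal_re]
      · intro k _ hk
        rw [if_neg fun h => hk (Subtype.ext h)]
        simp
      · simp
    rw [h1, h2, Finset.mul_sum]
    refine Finset.sum_le_sum fun i _ => ?_
    have h3 : 1 / 2 ≤ μ i := (Finset.mem_filter.1 i.2).2
    nlinarith [sq_nonneg ‖c i‖]

end Embedding

/-! ### Subspaces whose product vectors are all good -/

section Product

variable {ι : Type*} [Fintype ι] {X : ι → Type*} [∀ e, Fintype (X e)]

/-- The average over a product distribution, with one coordinate singled out. -/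
theorem sum_prod_mul_eq [DecidableEq ι] (p : ∀ e, X e → ℝ) (e : ι) (G : (∀ f, X f) → ℝ) :
    ∑ x : ∀ f, X f, (∏ f, p f (x f)) * G x =
      ∑ y, p e y * ∑ z : ∀ f : {f // f ≠ e}, X f,
        (∏ f : {f // f ≠ e}, p f (z f)) * G ((Equiv.piSplitAt e X).symm (y, z)) := by
  rw [← (Equiv.piSplitAt e X).symm.sum_comp, Fintype.sum_prod_type]
  refine Finset.sum_congr rfl fun y _ => ?_
  rw [Finset.mul_sum]
  refine Finset.sum_congr rfl fun z _ => ?_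
  rw [Fintype.prod_eq_mul_prod_subtype_ne _ e, ← mul_assoc]
  congr 2
  · simp [Equiv.piSplitAt]
  · refine Finset.prod_congr rfl fun f _ => ?_
    simp [Equiv.piSplitAt, f.2]

/-- Resampling one coordinate does not change the average. -/
theorem sum_prod_update [DecidableEq ι] {p : ∀ e, X e → ℝ} (e : ι) (hp1 : ∑ y, p e y = 1)
    (G : (∀ f, X f) → ℝ) :
    ∑ y, p e y * ∑ x : ∀ f, X f, (∏ f, p f (x f)) * G (Function.update x e y) =
      ∑ x : ∀ f, X f, (∏ f, p f (x f)) * G x := by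
  have hupd : ∀ y y' z, Function.update ((Equiv.piSplitAt e X).symm (y', z)) e y =
      (Equiv.piSplitAt e X).symm (y, z) := by
    intro y y' z
    funext f
    by_cases h : f = e
    · subst h
      simp [Equiv.piSplitAt]
    · simp [Equiv.piSplitAt, h]
  rw [sum_prod_mul_eq p e G]
  refine Finset.sum_congr rfl fun y _ => ?_
  rw [sum_prod_mul_eq p e]
  simp_rw [hupd]
  rw [← Finset.sum_mul, hp1, one_mul]

/-- Averaging: some coordinates of a product distribution can be frozen without increasing the
mean of a given function. -/
theorem exists_single_of_sum_prod [DecidableEq ι] [∀ e, DecidableEq (X e)] {p : ∀ e, X e → ℝ}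
    (hp : ∀ e x, 0 ≤ p e x) (hp1 : ∀ e, ∑ x, p e x = 1) (G : (∀ e, X e) → ℝ) (S : Finset ι) :
    ∃ q : ∀ e, X e → ℝ, (∀ e ∈ S, ∃ y, q e = Pi.single y 1) ∧ (∀ e ∉ S, q e = p e) ∧
      ∑ x : ∀ e, X e, (∏ e, q e (x e)) * G x ≤ ∑ x : ∀ e, X e, (∏ e, p e (x e)) * G x := by
  induction S using Finset.induction_on with
  | empty => exact ⟨p, by simp, fun _ _ => rfl, le_rfl⟩
  | insert e S he ih =>
    obtain ⟨q, hq1, hq2, hq⟩ := ih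
    let g : X e → ℝ := fun y => ∑ z : ∀ f : {f // f ≠ e}, X f,
        (∏ f : {f // f ≠ e}, q f (z f)) * G ((Equiv.piSplitAt e X).symm (y, z))
    have hsum : ∑ x : ∀ e, X e, (∏ e, q e (x e)) * G x = ∑ y, p e y * g y := by
      rw [sum_prod_mul_eq q e G, hq2 e he]
    obtain ⟨y, hy⟩ : ∃ y, g y ≤ ∑ y, p e y * g y := by
      by_contra! hcon
      have h1 : ∑ y, p e y * (∑ y, p e y * g y) < ∑ y, p e y * g y := by
        obtain ⟨y, -, hy⟩ := Finset.exists_ne_zero_of_sum_ne_zero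
          (show ∑ y, p e y ≠ 0 by rw [hp1]; exact one_ne_zero)
        refine Finset.sum_lt_sum (fun y _ => mul_le_mul_of_nonneg_left (hcon y).le (hp e y))
          ⟨y, Finset.mem_univ _, mul_lt_mul_of_pos_left (hcon y) (lt_of_le_of_ne (hp e y) hy.symm)⟩
      rw [← Finset.sum_mul, hp1, one_mul] at h1
      exact lt_irrefl _ h1
    refine ⟨Function.update q e (Pi.single y 1), fun f hf => ?_, fun f hf => ?_, ?_⟩
    · rcases eq_or_ne f e with rfl | hfe
      · exact ⟨y, Function.update_self ..⟩
      · rw [Function.update_of_ne hfe]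
        exact hq1 f (Finset.mem_of_mem_insert_of_ne hf hfe)
    · rw [Finset.mem_insert, not_or] at hf
      rw [Function.update_of_ne hf.1]
      exact hq2 f hf.2
    · refine le_trans (le_of_eq ?_) (hy.trans (hsum ▸ hq))
      rw [sum_prod_mul_eq _ e G, Finset.sum_eq_single y]
      · rw [Function.update_self, Pi.single_eq_same, one_mul]
        refine Finset.sum_congr rfl fun z _ => ?_
        congr 1
        exact Finset.prod_congr rfl fun f _ => by rw [Function.update_of_ne f.2]
      · intro y' _ hy'
        rw [Function.update_self, Pi.single_eq_of_ne hy', zero_mul]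
      · exact fun h => absurd (Finset.mem_univ y) h

variable {E : ι → Type*} {F : Type*} [∀ e, NormedAddCommGroup (E e)]
  [∀ e, InnerProductSpace ℂ (E e)] [NormedAddCommGroup F] [InnerProductSpace ℂ F]

/-- The one-dimensional counterpart of `exists_embedding`, for a deterministic source. -/
theorem exists_embedding_of_single {Y E' : Type*} [Fintype Y] [DecidableEq Y]
    [NormedAddCommGroup E'] [InnerProductSpace ℂ E'] {D : ℕ} (hD : D = 1)
    (u : OrthonormalBasis Y ℂ E') (y : Y) {ε : ℝ} {Γ I : Type*} [Fintype I] {w : I → ℝ}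
    (hw : ∀ i, 0 ≤ w i) (ℓ : Γ → I → E' →ₗ[ℂ] F)
    (hmean : ∀ γ, ∑ x, (Pi.single y 1 : Y → ℝ) x * sqForm w (ℓ γ) (u x) ≤ ε)
    (N : Finset (EuclideanSpace ℂ (Fin D))) (hN : ∀ v ∈ N, ‖v‖ ≤ 2) :
    ∃ V : EuclideanSpace ℂ (Fin D) →ₗ[ℂ] E', (∀ γ, ∀ v ∈ N, sqForm w (ℓ γ) (V v) ≤ 64 * ε) ∧
      (∀ v ∈ N, ‖V v‖ ^ 2 ≤ 64) ∧ ∀ j, ‖V (EuclideanSpace.single j 1)‖ ^ 2 = 1 := by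
  subst hD
  let V : EuclideanSpace ℂ (Fin 1) →ₗ[ℂ] E' :=
    { toFun := fun v => v 0 • u y
      map_add' := fun v v' => by simp [add_smul]
      map_smul' := fun c v => by simp [mul_smul] }
  have hVn : ∀ v, ‖V v‖ = ‖v 0‖ := fun v => by
    change ‖v 0 • u y‖ = _
    rw [norm_smul, u.norm_eq_one, mul_one]
  have hv0 : ∀ v ∈ N, ‖v 0‖ ^ 2 ≤ 4 := fun v hv => by
    have := (PiLp.norm_apply_le v 0).trans (hN v hv)
    nlinarith [norm_nonneg (v 0)]
  refine ⟨V, fun γ v hv => ?_, fun v hv => ?_, fun j => ?_⟩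
  · have h1 := hmean γ
    simp only [Pi.single_apply, ite_mul, one_mul, zero_mul, Finset.sum_ite_eq', Finset.mem_univ,
      if_true] at h1
    change sqForm w (ℓ γ) (v 0 • u y) ≤ _
    rw [sqForm_smul]
    have h2 : 0 ≤ sqForm w (ℓ γ) (u y) :=
      Finset.sum_nonneg fun i _ => mul_nonneg (hw i) (sq_nonneg _)
    nlinarith [hv0 v hv]
  · rw [hVn]
    linarith [hv0 v hv]
  · rw [hVn, Subsingleton.elim j 0]
    simp

variable {D : ι → ℕ}

/-- The vectors `V e (a e)` for `e ∈ S`, and the basis vectors `u e (x e)` for the other `e`. -/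
def mixVec [DecidableEq ι] (S : Finset ι) (V : ∀ e, EuclideanSpace ℂ (Fin (D e)) →ₗ[ℂ] E e)
    (u : ∀ e, X e → E e) (a : ∀ e, EuclideanSpace ℂ (Fin (D e))) (x : ∀ e, X e) (e : ι) : E e :=
  if e ∈ S then V e (a e) else u e (x e)

/-- The embeddings are chosen one after the other, in the order of increasing dimensions, such that
the remaining average stays small for all choices of net vectors in the spaces treated so far: these
choices are few compared to the concentration in a space of larger dimension. -/
theorem exists_embeddings [DecidableEq ι] [∀ e, DecidableEq (X e)]
    (u : ∀ e, OrthonormalBasis (X e) ℂ (E e))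
    (M : MultilinearMap ℂ E F) (hM : ∀ ψ, ‖M ψ‖ ^ 2 ≤ 2 * ∏ e, ‖ψ e‖ ^ 2) {p : ∀ e, X e → ℝ}
    (hp : ∀ e x, 0 ≤ p e x) (hp1 : ∀ e, ∑ x, p e x = 1) {ε : ℝ} (hε0 : 0 ≤ ε)
    (hε : 64 ^ Fintype.card ι * ε ≤ 1)
    (hmean : ∑ x : ∀ e, X e, (∏ e, p e (x e)) * ‖M fun e => u e (x e)‖ ^ 2 ≤ ε)
    (c : ℕ) (hc : 1 ≤ c) (N : ∀ e, Finset (EuclideanSpace ℂ (Fin (D e))))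
    (hNcard : ∀ e, (N e).card ≤ (c * (D e + 1)) ^ (2 * D e)) (hN : ∀ e, ∀ v ∈ N e, ‖v‖ ≤ 2)
    (hstep : ∀ e, (D e = 1 ∧ ∃ y, p e = Pi.single y 1) ∨ ∃ δ, 0 < δ ∧ (∀ x, p e x ≤ δ) ∧
      4 * ((c * (D e + 1) : ℝ) ^ (2 * D e)) ^ (Fintype.card ι + 1) <
        Real.exp (ε / (4 * 64 ^ Fintype.card ι * δ)))
    (S : Finset ι) : ∃ V : ∀ e, EuclideanSpace ℂ (Fin (D e)) →ₗ[ℂ] E e,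
      (∀ e ∈ S, (∀ v ∈ N e, ‖V e v‖ ^ 2 ≤ 64) ∧
        ∀ j, ‖V e (EuclideanSpace.single j 1)‖ ^ 2 = 1) ∧
      ∀ a : ∀ e, EuclideanSpace ℂ (Fin (D e)), (∀ e ∈ S, a e ∈ N e) →
        ∑ x : ∀ e, X e, (∏ e, p e (x e)) * ‖M (mixVec S V (fun e => u e) a x)‖ ^ 2 ≤
          64 ^ S.card * ε := by
  induction S using Finset.induction_on_max_value D with
  | empty =>
    refine ⟨fun _ => 0, by simp, fun a _ => ?_⟩
    have h : ∀ x, mixVec ∅ (fun _ => 0) (fun e => u e) a x = fun e => u e (x e) :=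
      fun x => funext fun e => if_neg (Finset.notMem_empty e)
    simpa [h] using hmean
  | insert e S heS hmax ih =>
    obtain ⟨V, hV, hVa⟩ := ih
    let Γ := ∀ f : S, N f
    let ext : Γ → ∀ f, EuclideanSpace ℂ (Fin (D f)) := fun γ f =>
      if h : f ∈ S then (γ ⟨f, h⟩ : EuclideanSpace ℂ (Fin (D f))) else 0
    have hext : ∀ γ, ∀ f ∈ S, ext γ f ∈ N f := by
      intro γ f hf
      simp only [ext, dif_pos hf]
      exact (γ ⟨f, hf⟩).2
    let w : (∀ f, X f) → ℝ := fun x => ∏ f, p f (x f)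
    have hw : ∀ x, 0 ≤ w x := fun x => Finset.prod_nonneg fun f _ => hp f _
    have hw1 : ∑ x, w x = 1 := by
      have := Finset.prod_univ_sum (fun f => (Finset.univ : Finset (X f))) p
      rw [Fintype.piFinset_univ] at this
      rw [← this]
      simp [hp1]
    -- `M` as a function of the factor `e` alone, for net vectors `γ` in the factors in `S`
    let ℓ : Γ → (∀ f, X f) → E e →ₗ[ℂ] F := fun γ x =>
      M.toLinearMap (mixVec S V (fun f => u f) (ext γ) x) e
    have hℓ : ∀ γ x ψ, ℓ γ x ψ =
        M (Function.update (mixVec S V (fun f => u f) (ext γ) x) e ψ) := fun _ _ _ => rfl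
    have hmean' : ∀ γ, ∑ y, p e y * sqForm w (ℓ γ) (u e y) ≤ 64 ^ S.card * ε := by
      intro γ
      refine le_trans (le_of_eq ?_) (hVa (ext γ) (hext γ))
      rw [← sum_prod_update e (hp1 e)]
      refine Finset.sum_congr rfl fun y _ => ?_
      congr 1
      refine Finset.sum_congr rfl fun x _ => ?_
      rw [hℓ]
      congr 4
      funext f
      by_cases h : f = e
      · subst h
        simp [mixVec, heS]
      · simp [mixVec, h]
    have hκ : ∀ γ ψ, sqForm w (ℓ γ) ψ ≤ 2 * 64 ^ Fintype.card ι * ‖ψ‖ ^ 2 := by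
      intro γ ψ
      have h1 : ∀ x, ‖ℓ γ x ψ‖ ^ 2 ≤ 2 * 64 ^ Fintype.card ι * ‖ψ‖ ^ 2 := by
        intro x
        rw [hℓ]
        refine (hM _).trans ?_
        rw [mul_assoc]
        refine mul_le_mul_of_nonneg_left ?_ (by norm_num)
        rw [← Finset.mul_prod_erase _ _ (Finset.mem_univ e), Function.update_self, mul_comm]
        refine mul_le_mul_of_nonneg_right ?_ (sq_nonneg _)
        calc ∏ f ∈ Finset.univ.erase e,
              ‖Function.update (mixVec S V (fun f => u f) (ext γ) x) e ψ f‖ ^ 2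
            ≤ ∏ f ∈ Finset.univ.erase e, (64 : ℝ) := by
              refine Finset.prod_le_prod (fun f _ => sq_nonneg _) fun f hf => ?_
              rw [Function.update_of_ne (Finset.ne_of_mem_erase hf)]
              simp only [mixVec]
              split
              · next h => exact (hV f h).1 _ (hext γ f h)
              · rw [(u f).norm_eq_one]; norm_num
          _ = 64 ^ (Fintype.card ι - 1) := by
              rw [Finset.prod_const, Finset.card_erase_of_mem (Finset.mem_univ e), Finset.card_univ]
          _ ≤ 64 ^ Fintype.card ι := pow_le_pow_right₀ (by norm_num) (Nat.sub_le _ _)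
      calc sqForm w (ℓ γ) ψ ≤ ∑ x, w x * (2 * 64 ^ Fintype.card ι * ‖ψ‖ ^ 2) :=
            Finset.sum_le_sum fun x _ => mul_le_mul_of_nonneg_left (h1 x) (hw x)
        _ = _ := by rw [← Finset.sum_mul, hw1, one_mul]
    have hSε : 64 ^ S.card * ε ≤ 1 := by
      refine le_trans (mul_le_mul_of_nonneg_right ?_ hε0) hε
      exact pow_le_pow_right₀ (by norm_num) (Finset.card_le_univ S)
    obtain ⟨Ve, hVe1, hVe2, hVe3⟩ : ∃ Ve : EuclideanSpace ℂ (Fin (D e)) →ₗ[ℂ] E e,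
        (∀ γ, ∀ v ∈ N e, sqForm w (ℓ γ) (Ve v) ≤ 64 * (64 ^ S.card * ε)) ∧
        (∀ v ∈ N e, ‖Ve v‖ ^ 2 ≤ 64) ∧ ∀ j, ‖Ve (EuclideanSpace.single j 1)‖ ^ 2 = 1 := by
      rcases hstep e with ⟨hD, y, hy⟩ | ⟨δ, hδ0, hδ, hcard⟩
      · exact exists_embedding_of_single hD (u e) y hw ℓ (fun γ => by
          simpa only [hy] using hmean' γ) (N e) (hN e)
      · refine exists_embedding (u e) (hp e) (hp1 e) hδ0 hδ (κ := 2 * 64 ^ Fintype.card ι) ?_ hSε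
          hw ℓ hκ hmean' (N e) (hN e) ?_
        · have : (1 : ℝ) ≤ 64 ^ Fintype.card ι := one_le_pow₀ (by norm_num)
          linarith
        · set B : ℝ := (c * (D e + 1) : ℝ) ^ (2 * D e) with hB
          have hB1 : 1 ≤ B := by
            refine one_le_pow₀ ?_
            have h1 : (1 : ℝ) ≤ c := by exact_mod_cast hc
            nlinarith [(Nat.cast_nonneg (D e) : (0 : ℝ) ≤ D e)]
          have hNB : ((N e).card : ℝ) ≤ B := by
            rw [hB]
            exact_mod_cast hNcard e
          have hΓ : (Fintype.card Γ : ℝ) ≤ B ^ Fintype.card ι := by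
            have h1 : Fintype.card Γ = ∏ f : S, (N f).card := by
              simp [Γ, Fintype.card_pi]
            have h2 : ∀ f : S, ((N f).card : ℝ) ≤ B := by
              intro f
              have h3 : D f ≤ D e := hmax f f.2
              have h4 : (N f).card ≤ (c * (D e + 1)) ^ (2 * D e) := by
                refine (hNcard f).trans ?_
                calc (c * (D f + 1)) ^ (2 * D f) ≤ (c * (D e + 1)) ^ (2 * D f) := by gcongr
                  _ ≤ _ := Nat.pow_le_pow_right (by positivity) (by omega)
              rw [hB]
              exact_mod_cast h4
            rw [h1]
            push_cast
            calc ∏ f : S, ((N f).card : ℝ) ≤ ∏ _f : S, B :=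
                  Finset.prod_le_prod (fun _ _ => Nat.cast_nonneg _) fun f _ => h2 f
              _ = B ^ S.card := by simp
              _ ≤ _ := pow_le_pow_right₀ hB1 (Finset.card_le_univ S)
          have h5 : 2 * ((Fintype.card Γ : ℝ) + 1) * (N e).card ≤ 4 * B ^ (Fintype.card ι + 1) := by
            have h6 : (1 : ℝ) ≤ B ^ Fintype.card ι := one_le_pow₀ hB1
            calc 2 * ((Fintype.card Γ : ℝ) + 1) * (N e).card
                ≤ 2 * (B ^ Fintype.card ι + B ^ Fintype.card ι) * B := by gcongr
              _ = _ := by ring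
          refine (h5.trans_lt hcard).trans_le (Real.exp_le_exp.2 ?_)
          have h7 : 2 * (2 * 64 ^ Fintype.card ι * δ) = 4 * 64 ^ Fintype.card ι * δ := by ring
          rw [h7]
          refine div_le_div_of_nonneg_right ?_ (by positivity)
          exact le_mul_of_one_le_left hε0 (one_le_pow₀ (by norm_num))
    refine ⟨Function.update V e Ve, fun f hf => ?_, fun a ha => ?_⟩
    · by_cases h : f = e
      · subst h
        rw [Function.update_self]
        exact ⟨hVe2, hVe3⟩
      · rw [Function.update_of_ne h]
        exact hV f (Finset.mem_of_mem_insert_of_ne hf h)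
    · let γ : Γ := fun f => ⟨a f, ha f (Finset.mem_insert_of_mem f.2)⟩
      have h1 := hVe1 γ (a e) (ha e (Finset.mem_insert_self _ _))
      rw [Finset.card_insert_of_notMem heS, pow_succ']
      rw [← mul_assoc] at h1
      refine le_trans (le_of_eq ?_) h1
      refine Finset.sum_congr rfl fun x _ => ?_
      rw [hℓ]
      congr 4
      funext f
      by_cases h : f = e
      · subst h
        simp [mixVec]
      · by_cases hfS : f ∈ S
        · simp [mixVec, h, hfS, ext, γ]
        · simp [mixVec, h, hfS]

/-- A bound for a multilinear map on tuples of net vectors extends to all tuples. -/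
theorem norm_multilinear_le_of_net {r : ℕ} (hr : Fintype.card ι * 2 ^ Fintype.card ι + 2 ≤ r)
    (N : ∀ e, Finset (EuclideanSpace ℂ (Fin (D e)))) (hN2 : ∀ e, ∀ v ∈ N e, ‖v‖ ≤ 2)
    (hN : ∀ e, ∀ v : EuclideanSpace ℂ (Fin (D e)), ‖v‖ ≤ 1 → ∃ v' ∈ N e, ‖v - v'‖ ≤ 1 / r)
    (G : ContinuousMultilinearMap ℂ (fun e => EuclideanSpace ℂ (Fin (D e))) F) {t : ℝ}
    (ht : 0 ≤ t) (hG : ∀ a : ∀ e, EuclideanSpace ℂ (Fin (D e)), (∀ e, a e ∈ N e) → ‖G a‖ ≤ t)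
    (v : ∀ e, EuclideanSpace ℂ (Fin (D e))) : ‖G v‖ ≤ 2 * t * ∏ e, ‖v e‖ := by
  have hr0 : (0 : ℝ) < r := by
    have : 0 < r := by omega
    exact_mod_cast this
  have hunit : ∀ v : ∀ e, EuclideanSpace ℂ (Fin (D e)), (∀ e, ‖v e‖ = 1) →
      ‖G v‖ ≤ t + ‖G‖ / 2 := by
    intro v hv
    choose v' hv'N hv' using fun e => hN e (v e) (hv e).le
    have h1 := G.norm_image_sub_le v v'
    have h2 : ‖v - v'‖ ≤ 1 / r := (pi_norm_le_iff_of_nonneg (by positivity)).2 hv'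
    have h3 : max ‖v‖ ‖v'‖ ≤ 2 := by
      refine max_le ((pi_norm_le_iff_of_nonneg (by norm_num)).2 fun e => ?_)
        ((pi_norm_le_iff_of_nonneg (by norm_num)).2 fun e => hN2 e _ (hv'N e))
      rw [hv e]
      norm_num
    have h4 : (max ‖v‖ ‖v'‖) ^ (Fintype.card ι - 1) ≤ (2 : ℝ) ^ (Fintype.card ι - 1) := by
      gcongr
    have h5 : (Fintype.card ι : ℝ) * 2 ^ (Fintype.card ι - 1) * (1 / r) ≤ 1 / 2 := by
      rw [mul_one_div, div_le_iff₀ hr0]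
      rcases Nat.eq_zero_or_pos (Fintype.card ι) with h0 | h0
      · rw [h0]
        simp
      · have h6 : (2 : ℝ) ^ Fintype.card ι = 2 * 2 ^ (Fintype.card ι - 1) := by
          rw [← pow_succ']
          congr 1
          omega
        have h7 : ((Fintype.card ι * 2 ^ Fintype.card ι + 2 : ℕ) : ℝ) ≤ r := by exact_mod_cast hr
        push_cast at h7
        rw [h6] at h7
        linarith
    have h8 : ‖G v - G v'‖ ≤ ‖G‖ / 2 := by
      refine h1.trans ?_
      calc ‖G‖ * Fintype.card ι * max ‖v‖ ‖v'‖ ^ (Fintype.card ι - 1) * ‖v - v'‖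
          ≤ ‖G‖ * Fintype.card ι * 2 ^ (Fintype.card ι - 1) * (1 / r) := by gcongr
        _ = ‖G‖ * (Fintype.card ι * 2 ^ (Fintype.card ι - 1) * (1 / r)) := by ring
        _ ≤ ‖G‖ * (1 / 2) := by gcongr
        _ = _ := by ring
    have h9 : ‖G v‖ ≤ ‖G v'‖ + ‖G v - G v'‖ := by
      have := norm_add_le (G v') (G v - G v')
      simpa using this
    linarith [hG v' hv'N]
  have hop : ‖G‖ ≤ t + ‖G‖ / 2 := by
    refine G.opNorm_le_bound (by positivity) fun v => ?_
    by_cases h0 : ∃ e, v e = 0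
    · obtain ⟨e, he⟩ := h0
      rw [G.map_coord_zero e he, norm_zero]
      positivity
    · push Not at h0
      have h1 : v = fun e => ((‖v e‖ : ℝ) : ℂ) • (((‖v e‖⁻¹ : ℝ) : ℂ) • v e) := by
        funext e
        rw [smul_smul, ← Complex.ofReal_mul, mul_inv_cancel₀ (norm_ne_zero_iff.2 (h0 e))]
        simp
      have h2 := hunit (fun e => ((‖v e‖⁻¹ : ℝ) : ℂ) • v e) fun e => by
        rw [norm_smul, Complex.norm_real, norm_inv, norm_norm,
          inv_mul_cancel₀ (norm_ne_zero_iff.2 (h0 e))]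
      rw [h1, G.map_smul_univ, norm_smul, norm_prod, mul_comm]
      refine mul_le_mul h2 (le_of_eq ?_) (by positivity) (by positivity)
      refine Finset.prod_congr rfl fun e _ => ?_
      rw [← h1]
      simp
  refine (G.le_opNorm v).trans (mul_le_mul_of_nonneg_right (by linarith) ?_)
  exact Finset.prod_nonneg fun e _ => norm_nonneg _

/-- A bounded multilinear map which is small on average over product basis vectors, drawn from
distributions without large point masses, is small on all product vectors from suitable subspaces of
almost the maximal dimensions allowed by these distributions. -/
theorem exists_product_subspaces [DecidableEq ι] [∀ e, DecidableEq (X e)]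
    (u : ∀ e, OrthonormalBasis (X e) ℂ (E e)) (D : ι → ℕ)
    (M : MultilinearMap ℂ E F) (hM : ∀ ψ, ‖M ψ‖ ^ 2 ≤ 2 * ∏ e, ‖ψ e‖ ^ 2) {p : ∀ e, X e → ℝ}
    (hp : ∀ e x, 0 ≤ p e x) (hp1 : ∀ e, ∑ x, p e x = 1) {ε : ℝ} (hε0 : 0 ≤ ε)
    (hε : 64 ^ Fintype.card ι * ε ≤ 1)
    (hmean : ∑ x : ∀ e, X e, (∏ e, p e (x e)) * ‖M fun e => u e (x e)‖ ^ 2 ≤ ε)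
    {r : ℕ} (hr : Fintype.card ι * 2 ^ Fintype.card ι + 2 ≤ r)
    (hstep : ∀ e, (D e = 1 ∧ ∃ y, p e = Pi.single y 1) ∨ ∃ δ, 0 < δ ∧ (∀ x, p e x ≤ δ) ∧
      4 * ((3 * r * (D e + 1) : ℝ) ^ (2 * D e)) ^ (Fintype.card ι + 1) <
        Real.exp (ε / (4 * 64 ^ Fintype.card ι * δ))) :
    ∃ H : ∀ e, Submodule ℂ (E e), (∀ e, Module.finrank ℂ (H e) ≤ D e) ∧
      (∀ e, D e ≤ 512 * Module.finrank ℂ (H e)) ∧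
      ∀ ψ : ∀ e, E e, (∀ e, ψ e ∈ H e) →
        ‖M ψ‖ ^ 2 ≤ 4 * 128 ^ Fintype.card ι * ε * ∏ e, ‖ψ e‖ ^ 2 := by
  have hr1 : 1 ≤ r := by omega
  choose N hNcard hN2 hN using fun e => exists_net r hr1 (D e)
  obtain ⟨V, hV, hVM⟩ := exists_embeddings u M hM hp hp1 hε0 hε hmean (3 * r) (by omega) N hNcard
    hN2 (by simpa using hstep) Finset.univ
  have : ∀ e, FiniteDimensional ℂ (E e) := fun e => (u e).toBasis.finiteDimensional_of_finite
  have hVle : ∀ e v, ‖V e v‖ ≤ 16 * ‖v‖ := by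
    intro e
    refine norm_le_of_net (V e) (N e) (fun v hv => ?_) (hV e (Finset.mem_univ e)).1
    obtain ⟨v', hv', hd⟩ := hN e v hv
    refine ⟨v', hv', hd.trans ?_⟩
    have h2 : (2 : ℝ) ≤ r := by
      have : 2 ≤ r := by omega
      exact_mod_cast this
    exact one_div_le_one_div_of_le (by norm_num) h2
  have hsq : ∀ ψ, ‖M ψ‖ ≤ 2 * ∏ e, ‖ψ e‖ := by
    intro ψ
    have h1 := hM ψ
    rw [Finset.prod_pow] at h1
    have h2 : 0 ≤ ∏ e, ‖ψ e‖ := Finset.prod_nonneg fun e _ => norm_nonneg _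
    nlinarith [norm_nonneg (M ψ)]
  let G : ContinuousMultilinearMap ℂ (fun e => EuclideanSpace ℂ (Fin (D e))) F :=
    (M.compLinearMap V).mkContinuous (2 * 16 ^ Fintype.card ι) fun v => by
      rw [MultilinearMap.compLinearMap_apply]
      refine (hsq _).trans ?_
      rw [mul_assoc]
      refine mul_le_mul_of_nonneg_left ?_ (by norm_num)
      calc ∏ e, ‖V e (v e)‖ ≤ ∏ e, (16 * ‖v e‖) :=
            Finset.prod_le_prod (fun e _ => norm_nonneg _) fun e _ => hVle e (v e)
        _ = _ := by rw [Finset.prod_mul_distrib, Finset.prod_const, Finset.card_univ]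
  have hGapp : ∀ v, G v = M fun e => V e (v e) := fun v => rfl
  have hp1' : ∑ x : ∀ e, X e, ∏ e, p e (x e) = 1 := by
    have := Finset.prod_univ_sum (fun f => (Finset.univ : Finset (X f))) p
    rw [Fintype.piFinset_univ] at this
    rw [← this]
    simp [hp1]
  have hGN : ∀ a : ∀ e, EuclideanSpace ℂ (Fin (D e)), (∀ e, a e ∈ N e) →
      ‖G a‖ ≤ Real.sqrt (64 ^ Fintype.card ι * ε) := by
    intro a ha
    have h1 := hVM a fun e _ => ha e
    apply Real.le_sqrt_of_sq_le
    have h2 : ∀ x, mixVec Finset.univ V (fun e => u e) a x = fun e => V e (a e) :=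
      fun x => funext fun e => if_pos (Finset.mem_univ e)
    simp_rw [h2] at h1
    rwa [← Finset.sum_mul, hp1', one_mul] at h1
  have hGle := norm_multilinear_le_of_net hr N hN2 hN G (Real.sqrt_nonneg _) hGN
  choose W hWdim hW using fun e =>
    exists_subspace_bounded_below (V e) (hVle e) (hV e (Finset.mem_univ e)).2
  have hrank : ∀ e, Module.finrank ℂ ((W e).map (V e)) = Module.finrank ℂ (W e) := by
    intro e
    rw [← LinearMap.range_domRestrict]
    refine LinearMap.finrank_range_of_inj ?_
    rw [← LinearMap.ker_eq_bot, LinearMap.ker_eq_bot']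
    intro v hv
    have h1 := hW e v v.2
    rw [show V e v = 0 from hv] at h1
    have h2 : ‖(v : EuclideanSpace ℂ (Fin (D e)))‖ = 0 := by
      simp only [norm_zero] at h1
      nlinarith [norm_nonneg (v : EuclideanSpace ℂ (Fin (D e)))]
    exact Subtype.ext (norm_eq_zero.1 h2)
  refine ⟨fun e => (W e).map (V e), fun e => ?_, fun e => ?_, fun ψ hψ => ?_⟩
  · rw [hrank]
    refine (Submodule.finrank_le _).trans (le_of_eq ?_)
    simp
  · rw [hrank]
    exact hWdim e
  · choose v hvW hv using hψ
    have h1 : M ψ = G v := by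
      rw [hGapp]
      congr 1
      funext e
      exact (hv e).symm
    have h2 : ‖G v‖ ^ 2 ≤ 4 * (64 ^ Fintype.card ι * ε) * ∏ e, ‖v e‖ ^ 2 := by
      have h3 := pow_le_pow_left₀ (norm_nonneg _) (hGle v) 2
      rw [mul_pow, mul_pow, Real.sq_sqrt (by positivity), ← Finset.prod_pow] at h3
      linarith
    rw [h1]
    refine h2.trans ?_
    have h4 : ∏ e, ‖v e‖ ^ 2 ≤ 2 ^ Fintype.card ι * ∏ e, ‖ψ e‖ ^ 2 := by
      calc ∏ e, ‖v e‖ ^ 2 ≤ ∏ e, (2 * ‖ψ e‖ ^ 2) :=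
            Finset.prod_le_prod (fun e _ => sq_nonneg _) fun e _ => by
              rw [← hv e]
              exact hW e (v e) (hvW e)
        _ = _ := by rw [Finset.prod_mul_distrib, Finset.prod_const, Finset.card_univ]
    calc 4 * (64 ^ Fintype.card ι * ε) * ∏ e, ‖v e‖ ^ 2
        ≤ 4 * (64 ^ Fintype.card ι * ε) * (2 ^ Fintype.card ι * ∏ e, ‖ψ e‖ ^ 2) := by gcongr
      _ = _ := by
        rw [show (128 : ℝ) = 64 * 2 by norm_num, mul_pow]
        ring

end Product

/-! ### The spectrum of a source -/

section Spectrum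

variable {X : Type} [Fintype X] [DecidableEq X]

open ComplexOrder in
theorem eigenvalues_reduced_nonneg {R : Type} [Fintype R] (Ψ : EuclideanSpace ℂ (R × X)) (x : X) :
    0 ≤ (reduced_isHermitian Ψ).eigenvalues x := by
  have h : reduced Ψ = (Matrix.of fun r x => star (Ψ (r, x)))ᴴ *
      Matrix.of fun r x => star (Ψ (r, x)) := by
    ext x x'
    simp [reduced, Matrix.mul_apply]
  have h1 : (reduced Ψ).PosSemidef := h ▸ Matrix.posSemidef_conjTranspose_mul_self _
  exact h1.eigenvalues_nonneg x

theorem entropy_reduced_nonneg {R : Type} [Fintype R] {Ψ : EuclideanSpace ℂ (R × X)}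
    (hΨ : ‖Ψ‖ = 1) : 0 ≤ entropy (reduced_isHermitian Ψ) := by
  refine Finset.sum_nonneg fun x _ => div_nonneg (Real.negMulLog_nonneg
    (eigenvalues_reduced_nonneg Ψ x) ?_) (Real.log_nonneg (by norm_num))
  rw [← sum_eigenvalues_reduced hΨ]
  exact Finset.single_le_sum (fun y _ => eigenvalues_reduced_nonneg Ψ y) (Finset.mem_univ x)

/-- The spectral decomposition `ρ = ∑ x, λ x |u x⟩⟨u x|`, in terms of matrix elements. -/
theorem apply_eq_sum_eigenvalues {ρ : Matrix X X ℂ} (h : ρ.IsHermitian) (y y' : X) :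
    ρ y y' = ∑ x, (h.eigenvalues x : ℂ) *
      (h.eigenvectorBasis x y * star (h.eigenvectorBasis x y')) := by
  have h2 := congrFun (congrFun h.spectral_theorem y) y'
  simp only [Unitary.conjStarAlgAut_apply, Matrix.mul_apply, Matrix.diagonal_apply,
    Matrix.star_apply, Matrix.IsHermitian.eigenvectorUnitary_apply] at h2
  rw [h2]
  simp only [mul_ite, mul_zero, Finset.sum_ite_eq', Finset.mem_univ, if_true, Function.comp_apply]
  exact Finset.sum_congr rfl fun i _ => by
    rw [mul_comm (h.eigenvectorBasis i y), mul_assoc]; rfl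

/-- Eigenvectors with an eigenvalue above the typical range are orthogonal to the typical
subspace, so the typical weight bounds the sum of the eigenvalues which are not too large. -/
theorem typicalWeight_le {ρ : Matrix X X ℂ} (h : ρ.IsHermitian) (h0 : ∀ x, 0 ≤ h.eigenvalues x)
    (n : ℕ) (S ε : ℝ) : typicalWeight ρ n S ε ≤
      ∑ x, if h.eigenvalues x ≤ (2 : ℝ) ^ (-(n * (S - ε))) then h.eigenvalues x else 0 := by
  set P := typicalSubspace ρ n S ε with hP
  have hsym : (toEuclideanLin ρ).IsSymmetric := Matrix.isSymmetric_toEuclideanLin_iff.2 h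
  have htr : typicalWeight ρ n S ε = ∑ x, h.eigenvalues x * ‖P.starProjection
      (h.eigenvectorBasis x)‖ ^ 2 := by
    have h1 : P.starProjection.toLinearMap ∘ₗ P.starProjection.toLinearMap =
        P.starProjection.toLinearMap := by
      ext1 v
      exact Submodule.starProjection_eq_self_iff.2 (Submodule.starProjection_apply_mem _ _)
    change (LinearMap.trace ℂ (EuclideanSpace ℂ X) (P.starProjection.toLinearMap ∘ₗ
      toEuclideanLin ρ ∘ₗ P.starProjection.toLinearMap)).re = _
    rw [LinearMap.trace_comp_comm', LinearMap.comp_assoc, h1,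
      LinearMap.trace_comp_comm', LinearMap.trace_eq_sum_inner _ h.eigenvectorBasis,
      Complex.re_sum]
    refine Finset.sum_congr rfl fun x _ => ?_
    rw [LinearMap.comp_apply, toEuclideanLin_eigenvectorBasis, map_smul, inner_smul_right,
      Complex.re_ofReal_mul]
    congr 1
    change (inner ℂ (h.eigenvectorBasis x) (P.starProjection (h.eigenvectorBasis x))).re = _
    exact (inner_re_symm (𝕜 := ℂ) _ _).trans (P.re_inner_starProjection_eq_normSq _)
  rw [htr]
  refine Finset.sum_le_sum fun x _ => ?_
  split_ifs with hx
  · refine mul_le_of_le_one_right (h0 x) (pow_le_one₀ (norm_nonneg _) ?_)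
    refine (P.norm_starProjection_apply_le _).trans ?_
    rw [h.eigenvectorBasis.orthonormal.1 x]
  · have h2 : h.eigenvectorBasis x ∈ Pᗮ := by
      have h3 : P ≤ (ℂ ∙ h.eigenvectorBasis x)ᗮ := by
        rw [hP, typicalSubspace, Submodule.span_le]
        rintro v ⟨t, -, ht, hv⟩
        rw [SetLike.mem_coe, Submodule.mem_orthogonal_singleton_iff_inner_left]
        have h4 := hsym v (h.eigenvectorBasis x)
        rw [hv, toEuclideanLin_eigenvectorBasis, inner_smul_left, inner_smul_right,
          Complex.conj_ofReal, ← sub_eq_zero, ← sub_mul, mul_eq_zero, ← Complex.ofReal_sub,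
          Complex.ofReal_eq_zero] at h4
        refine h4.resolve_left fun h5 => hx ?_
        linarith
      exact (Submodule.mem_orthogonal _ _).2 fun w hw =>
        Submodule.mem_orthogonal_singleton_iff_inner_left.1 (h3 hw)
    rw [P.starProjection_apply_eq_zero_iff.2 h2]
    simp

end Spectrum

/-! ### From entangled states to subspaces: a single block -/

section Contraction

variable {X : Type} [Fintype X] [DecidableEq X] {r : ℕ}

/-- Superpositions of Kraus operators of a channel with a unit vector of coefficients are
contractions. -/
theorem exists_contraction {K : Fin r → Matrix X X ℂ} (hK : IsTP (∑ a, conjMap (K a)))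
    (v : EuclideanSpace ℂ (Fin r)) :
    ∃ A : EuclideanSpace ℂ X →ₗ[ℂ] EuclideanSpace ℂ X, (∀ φ, ‖A φ‖ ≤ ‖φ‖) ∧
      ∀ φ, inner ℂ φ (A φ) = (‖v‖ : ℂ)⁻¹ * inner ℂ v (amplitude K φ) := by
  refine ⟨∑ a, ((‖v‖ : ℂ)⁻¹ * star (v a)) • toEuclideanLin (K a), fun φ => ?_, fun φ => ?_⟩
  · have h1 : ‖(∑ a, ((‖v‖ : ℂ)⁻¹ * star (v a)) • toEuclideanLin (K a)) φ‖ ≤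
        ∑ a, (‖v‖⁻¹ * ‖v a‖) * ‖toEuclideanLin (K a) φ‖ := by
      rw [LinearMap.sum_apply]
      refine (norm_sum_le _ _).trans (Finset.sum_le_sum fun a _ => le_of_eq ?_)
      rw [LinearMap.smul_apply, norm_smul, norm_mul, norm_inv, Complex.norm_real, norm_norm,
        norm_star]
    have h2 := Finset.sum_mul_sq_le_sq_mul_sq Finset.univ (fun a => ‖v‖⁻¹ * ‖v a‖)
      fun a => ‖toEuclideanLin (K a) φ‖
    rw [sum_norm_sq_kraus hK] at h2
    have h3 : ∑ a, (‖v‖⁻¹ * ‖v a‖) ^ 2 ≤ 1 := by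
      simp_rw [mul_pow]
      rw [← Finset.mul_sum, ← EuclideanSpace.norm_sq_eq, ← mul_pow]
      exact pow_le_one₀ (by positivity) (inv_mul_le_one)
    refine h1.trans (abs_le_of_sq_le_sq' ?_ (norm_nonneg _)).2
    exact h2.trans (mul_le_of_le_one_left (sq_nonneg _) h3)
  · simp only [LinearMap.sum_apply, LinearMap.smul_apply, inner_sum, inner_smul_right,
      PiLp.inner_apply v, amplitude, Finset.mul_sum]
    refine Finset.sum_congr rfl fun a _ => ?_
    simp only [RCLike.inner_apply, starRingEnd_apply]
    ring

/-- A contraction nearly fixes every vector whose expectation value is close to the maximal one. -/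
theorem norm_sub_contraction_sq_le {E : Type*} [NormedAddCommGroup E] [InnerProductSpace ℂ E]
    {A : E →ₗ[ℂ] E} (hA : ∀ φ, ‖A φ‖ ≤ ‖φ‖) (φ : E) :
    ‖φ - A φ‖ ^ 2 ≤ 2 * (‖φ‖ ^ 2 - (inner ℂ φ (A φ)).re) := by
  have h1 := norm_sub_sq (𝕜 := ℂ) φ (A φ)
  have h2 := pow_le_pow_left₀ (norm_nonneg _) (hA φ) 2
  rw [h1]
  have : RCLike.re (inner ℂ φ (A φ)) = (inner ℂ φ (A φ)).re := rfl
  linarith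

end Contraction

section Finite

variable {L n : ℕ} {d : Fin L → ℕ} {r : ℕ} {K : Fin r → Matrix (Mat n d) (Mat n d) ℂ}
  {c : Fin L → ℕ} {Ψ : ∀ e, EuclideanSpace ℂ (Fin (c e) × Blk n (d e))}

/-- High entanglement fidelity: some contraction `A`, obtained by superposing the Kraus operators,
nearly fixes the products of the eigenvectors of the sources on average, and its expectation values
bound the amplitudes of transmission from below. -/
theorem exists_contraction_of_entanglementFidelity (hK : IsTP (∑ a, conjMap (K a)))
    (hΨ : ∀ e, ‖Ψ e‖ = 1) {ε : ℝ} (hε : 0 ≤ ε)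
    (hF : 1 - ε ≤ entanglementFidelity Ψ (∑ a, conjMap (K a))) :
    ∃ A : EuclideanSpace ℂ (Mat n d) →ₗ[ℂ] EuclideanSpace ℂ (Mat n d), (∀ φ, ‖A φ‖ ≤ ‖φ‖) ∧
      (∀ φ, ‖inner ℂ φ (A φ)‖ ≤ ‖amplitude K φ‖) ∧
      ∑ x : Mat n d, (∏ e, (reduced_isHermitian (Ψ e)).eigenvalues (x e)) *
        ‖tensorVec (fun e => (reduced_isHermitian (Ψ e)).eigenvectorBasis (x e)) -
          A (tensorVec fun e => (reduced_isHermitian (Ψ e)).eigenvectorBasis (x e))‖ ^ 2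
        ≤ 2 * ε := by
  set w : ∀ e, Blk n (d e) → ℝ := fun e => (reduced_isHermitian (Ψ e)).eigenvalues
  set u : ∀ e, OrthonormalBasis (Blk n (d e)) ℂ (EuclideanSpace ℂ (Blk n (d e))) := fun e =>
    (reduced_isHermitian (Ψ e)).eigenvectorBasis
  set φ : Mat n d → EuclideanSpace ℂ (Mat n d) := fun x => tensorVec fun e => u e (x e)
  set v : EuclideanSpace ℂ (Fin r) := ∑ x : Mat n d, ((∏ e, w e (x e) : ℝ) : ℂ) •
    amplitude K (φ x) with hv
  have hw : ∀ e x, 0 ≤ w e x := fun e x => eigenvalues_reduced_nonneg (Ψ e) x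
  have hFv : entanglementFidelity Ψ (∑ a, conjMap (K a)) = ‖v‖ ^ 2 :=
    entanglementFidelity_eq K Ψ w (fun e x => u e x)
      fun e => apply_eq_sum_eigenvalues (reduced_isHermitian (Ψ e))
  have hw1 : ∑ x : Mat n d, ∏ e, w e (x e) = 1 := by
    rw [← Fintype.piFinset_univ, ← Finset.prod_univ_sum]
    exact Finset.prod_eq_one fun e _ => sum_eigenvalues_reduced (hΨ e)
  have hφ : ∀ x, ‖φ x‖ = 1 := fun x => by
    rw [norm_tensorVec]
    exact Finset.prod_eq_one fun e _ => (u e).orthonormal.1 _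
  obtain ⟨A, hA, hAv⟩ := exists_contraction hK v
  have hle : 1 - ε ≤ ‖v‖ := by
    rw [hFv] at hF
    rcases le_total 1 ‖v‖ with h | h
    · linarith
    · nlinarith [norm_nonneg v]
  have hsum : ∑ x : Mat n d, (∏ e, w e (x e)) * (inner ℂ (φ x) (A (φ x))).re = ‖v‖ := by
    have h1 : ∑ x : Mat n d, ((∏ e, w e (x e) : ℝ) : ℂ) * inner ℂ (φ x) (A (φ x)) = (‖v‖ : ℂ) := by
      calc _ = (‖v‖ : ℂ)⁻¹ * inner ℂ v v := by
            conv_rhs => rw [hv]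
            rw [← hv, inner_sum, Finset.mul_sum]
            refine Finset.sum_congr rfl fun x _ => ?_
            rw [hAv, inner_smul_right]
            ring
        _ = _ := by
            rw [inner_self_eq_norm_sq_to_K]
            rcases eq_or_ne (‖v‖ : ℂ) 0 with h | h
            · simp [h]
            · change (‖v‖ : ℂ)⁻¹ * (‖v‖ : ℂ) ^ 2 = ‖v‖
              field_simp
    have h2 := congrArg Complex.re h1
    simp only [Complex.re_sum, Complex.re_ofReal_mul, Complex.ofReal_re] at h2
    exact h2
  refine ⟨A, hA, fun ψ => ?_, ?_⟩
  · rw [hAv, norm_mul, norm_inv, Complex.norm_real, norm_norm]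
    rcases eq_or_ne ‖v‖ 0 with h | h
    · rw [h]
      simp
    · rw [inv_mul_le_iff₀ (lt_of_le_of_ne (norm_nonneg v) h.symm)]
      exact norm_inner_le_norm v _
  · calc ∑ x : Mat n d, (∏ e, w e (x e)) * ‖φ x - A (φ x)‖ ^ 2
        ≤ ∑ x : Mat n d, (∏ e, w e (x e)) * (2 * (1 - (inner ℂ (φ x) (A (φ x))).re)) := by
          refine Finset.sum_le_sum fun x _ => mul_le_mul_of_nonneg_left ?_
            (Finset.prod_nonneg fun e _ => hw e _)
          have := norm_sub_contraction_sq_le hA (φ x)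
          rwa [hφ, one_pow] at this
      _ = 2 * (∑ x : Mat n d, ∏ e, w e (x e) -
          ∑ x : Mat n d, (∏ e, w e (x e)) * (inner ℂ (φ x) (A (φ x))).re) := by
          simp only [Finset.mul_sum, ← Finset.sum_sub_distrib]
          exact Finset.sum_congr rfl fun x _ => by ring
      _ = 2 * (1 - ‖v‖) := by rw [hw1, hsum]
      _ ≤ 2 * ε := by linarith

/-- Subspaces of prescribed dimensions that a protocol transmits because it transmits entangled
states. The eigenvalues of the sources are cut off at `t e`; a transmission with `D e = 1` is served
by a single eigenvector. -/
theorem exists_subspaces_of_entanglementFidelity (hK : IsTP (∑ a, conjMap (K a)))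
    (hΨ : ∀ e, ‖Ψ e‖ = 1) {ε κ : ℝ} (hε0 : 0 ≤ ε) (hε : 64 ^ L * ε ≤ 1)
    (hF : 1 - ε / 2 ^ L ≤ entanglementFidelity Ψ (∑ a, conjMap (K a))) (hκ0 : 0 ≤ κ)
    (hκ1 : κ ≤ 1) (hκ : 16 * 128 ^ L * ε ≤ κ ^ 2) {t : Fin L → ℝ}
    (htyp : ∀ e, 1 / 2 ≤ ∑ x, if (reduced_isHermitian (Ψ e)).eigenvalues x ≤ t e then
      (reduced_isHermitian (Ψ e)).eigenvalues x else 0)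
    {D : Fin L → ℕ} (hD1 : ∀ e, 1 ≤ D e) {s : ℕ} (hs : L * 2 ^ L + 2 ≤ s)
    (hstep : ∀ e, D e = 1 ∨ 0 < t e ∧ 4 * ((3 * s * (D e + 1) : ℝ) ^ (2 * D e)) ^ (L + 1) <
      Real.exp (ε / (4 * 64 ^ L * (2 * t e)))) :
    ∃ H : ∀ e, Submodule ℂ (EuclideanSpace ℂ (Blk n (d e))), (∀ e, H e ≠ ⊥) ∧
      (∀ e, Module.finrank ℂ (H e) ≤ D e) ∧ (∀ e, D e ≤ 512 * Module.finrank ℂ (H e)) ∧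
      1 - 2 * κ ≤ subspaceFidelity H (∑ a, conjMap (K a)) := by
  obtain ⟨A, hA, hAK, hmean⟩ := exists_contraction_of_entanglementFidelity hK hΨ
    (by positivity) hF
  set w : ∀ e, Blk n (d e) → ℝ := fun e => (reduced_isHermitian (Ψ e)).eigenvalues with hwdef
  set u : ∀ e, OrthonormalBasis (Blk n (d e)) ℂ (EuclideanSpace ℂ (Blk n (d e))) := fun e =>
    (reduced_isHermitian (Ψ e)).eigenvectorBasis
  have hw : ∀ e x, 0 ≤ w e x := fun e x => eigenvalues_reduced_nonneg (Ψ e) x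
  -- the eigenvalues cut off at `t e` and normalised, which at most doubles them
  let τ : Fin L → ℝ := fun e => ∑ x, if w e x ≤ t e then w e x else 0
  have hτ : ∀ e, 1 / 2 ≤ τ e := htyp
  have hτ0 : ∀ e, 0 < τ e := fun e => lt_of_lt_of_le (by norm_num) (hτ e)
  let p : ∀ e, Blk n (d e) → ℝ := fun e x => (if w e x ≤ t e then w e x else 0) / τ e
  have hp : ∀ e x, 0 ≤ p e x := fun e x => div_nonneg (by split_ifs; exacts [hw e x, le_rfl])
    (hτ0 e).le
  have hp1 : ∀ e, ∑ x, p e x = 1 := fun e => by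
    rw [← Finset.sum_div]
    exact div_self (hτ0 e).ne'
  have hpw : ∀ e x, p e x ≤ 2 * w e x := by
    intro e x
    rw [div_le_iff₀ (hτ0 e)]
    have h1 : (if w e x ≤ t e then w e x else 0) ≤ w e x := by
      split_ifs
      exacts [le_rfl, hw e x]
    nlinarith [hw e x, hτ e]
  have hpt : ∀ e, 0 < t e → ∀ x, p e x ≤ 2 * t e := by
    intro e ht x
    rw [div_le_iff₀ (hτ0 e)]
    have h1 : (if w e x ≤ t e then w e x else 0) ≤ t e := by
      split_ifs with h
      exacts [h, ht.le]
    nlinarith [hτ e]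
  -- half of the deviation from the identity has norm at most one
  let M : MultilinearMap ℂ (fun e => EuclideanSpace ℂ (Blk n (d e))) (EuclideanSpace ℂ (Mat n d)) :=
    ((1 / 2 : ℂ) • (LinearMap.id - A)).compMultilinearMap tensorVec
  have hMn : ∀ ψ, ‖M ψ‖ = 1 / 2 * ‖tensorVec ψ - A (tensorVec ψ)‖ := by
    intro ψ
    change ‖(1 / 2 : ℂ) • (tensorVec ψ - A (tensorVec ψ))‖ = _
    rw [norm_smul]
    norm_num
  have hM : ∀ ψ, ‖M ψ‖ ^ 2 ≤ 2 * ∏ e, ‖ψ e‖ ^ 2 := by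
    intro ψ
    have h1 : ‖M ψ‖ ≤ ‖tensorVec ψ‖ := by
      rw [hMn]
      linarith [norm_sub_le (tensorVec ψ) (A (tensorVec ψ)), hA (tensorVec ψ)]
    rw [Finset.prod_pow, ← norm_tensorVec]
    nlinarith [norm_nonneg (M ψ), norm_nonneg (tensorVec ψ)]
  have hmean2 : ∑ x : Mat n d, (∏ e, p e (x e)) * ‖M fun e => u e (x e)‖ ^ 2 ≤ ε := by
    calc _ ≤ ∑ x : Mat n d, (2 ^ L * ∏ e, w e (x e)) * (1 / 4 *
          ‖tensorVec (fun e => u e (x e)) - A (tensorVec fun e => u e (x e))‖ ^ 2) := by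
          refine Finset.sum_le_sum fun x _ => ?_
          rw [hMn, mul_pow]
          norm_num only
          refine mul_le_mul_of_nonneg_right ?_ (by positivity)
          refine (Finset.prod_le_prod (fun e _ => hp e _) fun e _ => hpw e _).trans (le_of_eq ?_)
          rw [Finset.prod_mul_distrib, Finset.prod_const, Finset.card_univ, Fintype.card_fin]
      _ = 2 ^ L / 4 * ∑ x : Mat n d, (∏ e, w e (x e)) *
          ‖tensorVec (fun e => u e (x e)) - A (tensorVec fun e => u e (x e))‖ ^ 2 := by
          rw [Finset.mul_sum]
          exact Finset.sum_congr rfl fun x _ => by ring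
      _ ≤ 2 ^ L / 4 * (2 * (ε / 2 ^ L)) := mul_le_mul_of_nonneg_left hmean (by positivity)
      _ = ε / 2 := by
          field_simp
          norm_num
      _ ≤ ε := by linarith
  obtain ⟨q, hq1, hq2, hq⟩ := exists_single_of_sum_prod hp hp1
    (fun x => ‖M fun e => u e (x e)‖ ^ 2) (Finset.univ.filter fun e => D e = 1)
  simp only [Finset.mem_filter, Finset.mem_univ, true_and] at hq1 hq2
  have hq0 : ∀ e x, 0 ≤ q e x := by
    intro e x
    by_cases h : D e = 1
    · obtain ⟨y, hy⟩ := hq1 e h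
      rw [hy]
      rw [Pi.single_apply]
      split_ifs <;> norm_num
    · rw [hq2 e h]
      exact hp e x
  have hqs : ∀ e, ∑ x, q e x = 1 := by
    intro e
    by_cases h : D e = 1
    · obtain ⟨y, hy⟩ := hq1 e h
      rw [hy, Finset.sum_pi_single']
      simp
    · rw [hq2 e h]
      exact hp1 e
  obtain ⟨H, hH1, hH2, hH⟩ := exists_product_subspaces u D M hM hq0 hqs hε0
    (by rwa [Fintype.card_fin]) (hq.trans hmean2) (r := s) (by rwa [Fintype.card_fin]) (by
      intro e
      rcases eq_or_ne (D e) 1 with h | h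
      · exact Or.inl ⟨h, hq1 e h⟩
      · obtain ⟨h1, h2⟩ := (hstep e).resolve_left h
        refine Or.inr ⟨2 * t e, by linarith, ?_, by rwa [Fintype.card_fin]⟩
        rw [hq2 e h]
        exact hpt e h1)
  have hpos : ∀ e, 0 < Module.finrank ℂ (H e) := by
    intro e
    have := hD1 e
    have := hH2 e
    omega
  have hbot : ∀ e, H e ≠ ⊥ := fun e h => by
    have := hpos e
    rw [h, finrank_bot] at this
    exact lt_irrefl _ this
  refine ⟨H, hbot, hH1, hH2, ?_⟩
  have hne : ∀ e, ∃ v ∈ H e, ‖v‖ = 1 := fun e => by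
    obtain ⟨v, hv, hv0⟩ := (H e).exists_mem_ne_zero_of_ne_bot (hbot e)
    exact ⟨((‖v‖ : ℂ)⁻¹) • v, (H e).smul_mem _ hv, norm_smul_inv_norm hv0⟩
  choose v0 hv0 using hne
  have : Nonempty {ψ : ∀ e, EuclideanSpace ℂ (Blk n (d e)) // ∀ e, ψ e ∈ H e ∧ ‖ψ e‖ = 1} :=
    ⟨⟨v0, hv0⟩⟩
  refine le_ciInf fun ψ => ?_
  obtain ⟨ψ, hψ⟩ := ψ
  rw [overlap_prodVec]
  have hψ1 : ‖tensorVec ψ‖ = 1 := by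
    rw [norm_tensorVec]
    exact Finset.prod_eq_one fun e _ => (hψ e).2
  have h1 := hH ψ fun e => (hψ e).1
  rw [Finset.prod_eq_one (fun e _ => by rw [(hψ e).2, one_pow]), mul_one, Fintype.card_fin,
    hMn] at h1
  have h2 : ‖tensorVec ψ - A (tensorVec ψ)‖ ≤ κ := by
    refine (abs_le_of_sq_le_sq' ?_ hκ0).2
    linarith
  have h3 : 1 - κ ≤ ‖amplitude K (tensorVec ψ)‖ := by
    refine le_trans ?_ (hAK (tensorVec ψ))
    have h4 : inner ℂ (tensorVec ψ) (A (tensorVec ψ)) =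
        1 - inner ℂ (tensorVec ψ) (tensorVec ψ - A (tensorVec ψ)) := by
      rw [inner_sub_right, inner_self_eq_norm_sq_to_K, hψ1]
      simp
    have h5 := norm_inner_le_norm (𝕜 := ℂ) (tensorVec ψ) (tensorVec ψ - A (tensorVec ψ))
    rw [hψ1, one_mul] at h5
    rw [h4]
    have h6 := norm_sub_norm_le (1 : ℂ) (inner ℂ (tensorVec ψ) (tensorVec ψ - A (tensorVec ψ)))
    rw [norm_one] at h6
    linarith
  nlinarith [sq_nonneg κ]

end Finite

/-! ### Asymptotics -/

section Asymptotics

/-- The number of net points, which is exponential in the dimension of the subspaces up to a factor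
linear in `n` in the exponent, is beaten by concentration, because that dimension is by a factor
`2 ^ (n * η)` below the inverse of the largest eigenvalue. -/
theorem eventually_net_lt_exp {R η : ℝ} (hη : 0 < η) (hR : 2 * η ≤ R) (s : ℕ) (hs : 1 ≤ s) (L : ℕ)
    {a : ℝ} (ha : 0 < a) : ∀ᶠ n : ℕ in atTop,
      4 * ((3 * s * ((⌊(2 : ℝ) ^ (n * (R - 2 * η))⌋₊ : ℕ) + 1) : ℝ) ^
        (2 * ⌊(2 : ℝ) ^ (n * (R - 2 * η))⌋₊)) ^ (L + 1) <
      Real.exp (a / (2 * (2 : ℝ) ^ (-(n * (R - η))))) := by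
  have hb : (1 : ℝ) < 2 ^ η := Real.one_lt_rpow (by norm_num) hη
  set b : ℝ := 2 ^ η with hbdef
  have h0 := (tendsto_pow_const_div_const_pow_of_one_lt 0 hb).const_mul
    (2 + 2 * (L + 1) * Real.log (6 * s))
  have h1 := (tendsto_pow_const_div_const_pow_of_one_lt 1 hb).const_mul
    (2 * (L + 1) * ((R - 2 * η) * Real.log 2))
  have h2 := h0.add h1
  rw [mul_zero, mul_zero, add_zero] at h2
  filter_upwards [h2.eventually (gt_mem_nhds (show (0 : ℝ) < a / 2 by positivity))] with n hn
  have hbn : (0 : ℝ) < b ^ n := by positivity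
  set z : ℝ := (2 : ℝ) ^ (n * (R - 2 * η)) with hz
  have hz1 : 1 ≤ z := Real.one_le_rpow (by norm_num)
    (mul_nonneg (Nat.cast_nonneg _) (by linarith))
  have hs1 : (1 : ℝ) ≤ s := by exact_mod_cast hs
  have hD : (⌊z⌋₊ : ℝ) ≤ z := Nat.floor_le (by linarith)
  have hzb : a / (2 * (2 : ℝ) ^ (-(n * (R - η)))) = a / 2 * (z * b ^ n) := by
    have h3 : z * b ^ n = (2 : ℝ) ^ (n * (R - η)) := by
      rw [hz, hbdef, ← Real.rpow_natCast, ← Real.rpow_mul (by norm_num),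
        ← Real.rpow_add (by norm_num)]
      congr 1
      ring
    rw [h3, Real.rpow_neg (by norm_num)]
    field_simp
  have hlogz : Real.log z = n * ((R - 2 * η) * Real.log 2) := by
    rw [hz, Real.log_rpow (by norm_num)]
    ring
  have hlog : Real.log (3 * s * (⌊z⌋₊ + 1)) ≤ Real.log (6 * s) + Real.log z := by
    rw [← Real.log_mul (by positivity) (by positivity)]
    refine Real.log_le_log (by positivity) ?_
    nlinarith
  have hlog0 : 0 ≤ Real.log (3 * s * (⌊z⌋₊ + 1)) := by
    refine Real.log_nonneg ?_
    nlinarith [Nat.cast_nonneg (α := ℝ) ⌊z⌋₊]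
  have hlog4 : Real.log 4 ≤ 2 := by
    have := Real.log_two_lt_d9
    rw [show (4 : ℝ) = 2 ^ 2 by norm_num, Real.log_pow]
    push_cast
    linarith
  rw [← Real.log_lt_iff_lt_exp (by positivity), hzb, Real.log_mul (by norm_num) (by positivity),
    Real.log_pow, Real.log_pow]
  have hn' : 2 + 2 * (L + 1) * (Real.log (6 * s) + Real.log z) < a / 2 * b ^ n := by
    rw [← div_lt_iff₀ hbn]
    refine lt_of_eq_of_lt ?_ hn
    rw [hlogz]
    ring
  push_cast
  calc Real.log 4 + (L + 1) * (2 * ⌊z⌋₊ * Real.log (3 * s * (⌊z⌋₊ + 1)))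
      ≤ 2 * z + (L + 1) * (2 * z * (Real.log (6 * s) + Real.log z)) := by
        gcongr
        linarith
    _ = z * (2 + 2 * (L + 1) * (Real.log (6 * s) + Real.log z)) := by ring
    _ < z * (a / 2 * b ^ n) := mul_lt_mul_of_pos_left hn' (by linarith)
    _ = _ := by ring

/-- Properties which hold eventually for each tolerance hold eventually for a tolerance which tends
to zero slowly enough. -/
theorem exists_tendsto_atTop_of_forall_eventually {P : ℕ → ℕ → Prop}
    (h : ∀ m, ∀ᶠ n in atTop, P m n) :
    ∃ g : ℕ → ℕ, Tendsto g atTop atTop ∧ ∀ᶠ n in atTop, P (g n) n := by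
  classical
  refine ⟨fun n => Nat.findGreatest (fun m => P m n) n, tendsto_atTop.2 fun m => ?_, ?_⟩
  · filter_upwards [h m, eventually_ge_atTop m] with n hn hm
    exact Nat.le_findGreatest hm hn
  · filter_upwards [h 0] with n hn
    exact Nat.findGreatest_spec (P := fun m => P m n) (Nat.zero_le n) hn

/-- The rate of subspaces of dimension `f`, a fixed proportion of `D`. -/
theorem abs_logb_div_sub_le {R η : ℝ} (hη : 0 < η) (hR : 2 * η ≤ R) {n D f : ℕ} (hn : 10 / η ≤ n)
    (hD : D = ⌊(2 : ℝ) ^ (n * (R - 2 * η))⌋₊) (h1 : f ≤ D) (h2 : D ≤ 512 * f) :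
    |Real.logb 2 f / n - R| ≤ 3 * η := by
  have hn0 : (0 : ℝ) < n := lt_of_lt_of_le (by positivity) hn
  have hnη : 10 ≤ n * η := by rwa [div_le_iff₀ hη] at hn
  set z : ℝ := (2 : ℝ) ^ (n * (R - 2 * η)) with hz
  have hz1 : 1 ≤ z := Real.one_le_rpow (by norm_num) (mul_nonneg hn0.le (by linarith))
  have hDz : (D : ℝ) ≤ z := hD ▸ Nat.floor_le (by linarith)
  have hDz' : z < D + 1 := hD ▸ Nat.lt_floor_add_one z
  have hD1 : 1 ≤ D := hD ▸ Nat.le_floor (by exact_mod_cast hz1)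
  have hf : 0 < f := by omega
  have hf0 : (0 : ℝ) < f := by exact_mod_cast hf
  have hD1' : (1 : ℝ) ≤ D := by exact_mod_cast hD1
  have h1' : (f : ℝ) ≤ D := by exact_mod_cast h1
  have h2' : (D : ℝ) ≤ 512 * f := by exact_mod_cast h2
  have hup : Real.logb 2 f ≤ n * (R - 2 * η) := by
    rw [Real.logb_le_iff_le_rpow (by norm_num) hf0]
    linarith
  have hlow : n * (R - 2 * η) - 10 ≤ Real.logb 2 f := by
    -- `2 ^ 10 = 2 * 512`, with a factor two for rounding down to `D`
    rw [Real.le_logb_iff_rpow_le (by norm_num) hf0, Real.rpow_sub (by norm_num), ← hz]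
    norm_num
    linarith
  rw [abs_le]
  constructor
  · rw [neg_le_sub_iff_le_add, ← sub_le_iff_le_add, le_div_iff₀ hn0]
    linarith
  · rw [sub_le_iff_le_add, div_le_iff₀ hn0]
    nlinarith

end Asymptotics

/-! ### From entangled states to subspaces: rates -/

section Rates

variable {k m L : ℕ} {a : Fin k → ℕ} {b : Fin m → ℕ} {l : Layout k m L} {Λ : NetMap a b}

/-- For each tolerance `η`, a protocol for entanglement transmission with QAEP sources transmits,
for large `n`, subspaces whose rates and fidelity are right up to a multiple of `η`. Rates below
`2 * η` are served by one-dimensional subspaces. -/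
theorem eventually_exists_subspaces (hΛ : IsChannel Λ) {C : Comm} {d : Fin L → ℕ}
    {R : Fin L → ℝ} {T : ∀ n, SuperOp (∀ i, Src l n d i) (∀ j, Dst l n d j)} {c : ℕ → Fin L → ℕ}
    {Ψ : ∀ n e, EuclideanSpace ℂ (Fin (c n e) × Blk n (d e))}
    (hT : ∀ n, IsProtocol l Λ n d (T n) C) (hΨ : ∀ n e, ‖Ψ n e‖ = 1)
    (hR : ∀ e, Tendsto (fun n : ℕ => entropy (reduced_isHermitian (Ψ n e)) / n) atTop (𝓝 (R e)))
    (hQ : ∀ e, IsQAEP (fun n => reduced (Ψ n e)) (R e))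
    (hF : Tendsto (fun n => entanglementFidelity (Ψ n) (route l n d (T n))) atTop (𝓝 1))
    {η : ℝ} (hη : 0 < η) (hη1 : η ≤ 1) :
    ∀ᶠ n : ℕ in atTop, ∃ H : ∀ e, Submodule ℂ (EuclideanSpace ℂ (Blk n (d e))),
      (∀ e, H e ≠ ⊥) ∧ (∀ e, |Real.logb 2 (Module.finrank ℂ (H e)) / n - R e| ≤ 3 * η) ∧
      1 - 2 * η ≤ subspaceFidelity H (route l n d (T n)) := by
  have hR0 : ∀ e, 0 ≤ R e := fun e => ge_of_tendsto' (hR e) fun n =>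
    div_nonneg (entropy_reduced_nonneg (hΨ n e)) (Nat.cast_nonneg n)
  obtain ⟨ε, hε0, hε, hκ⟩ : ∃ ε : ℝ, 0 < ε ∧ 64 ^ L * ε ≤ 1 ∧ 16 * 128 ^ L * ε ≤ η ^ 2 := by
    refine ⟨η ^ 2 / (16 * 128 ^ L), by positivity, ?_, ?_⟩
    · rw [← mul_div_assoc, div_le_one (by positivity)]
      have h1 : (64 : ℝ) ^ L ≤ 128 ^ L := pow_le_pow_left₀ (by norm_num) (by norm_num) L
      have h2 : (0 : ℝ) < 64 ^ L := by positivity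
      have h3 : η ^ 2 ≤ 1 := pow_le_one₀ hη.le hη1
      nlinarith
    · rw [mul_div_cancel₀ _ (by positivity)]
  have hF' : ∀ᶠ n in atTop, 1 - ε / 2 ^ L < entanglementFidelity (Ψ n) (route l n d (T n)) :=
    hF.eventually (lt_mem_nhds (sub_lt_self _ (by positivity)))
  have hQ' : ∀ᶠ n in atTop, ∀ e, typicalWeight (reduced (Ψ n e)) n (R e) η > 1 - 1 / 2 :=
    eventually_all.2 fun e => hQ e η hη (1 / 2) (by norm_num)
  have hstep : ∀ᶠ n : ℕ in atTop, ∀ e, 2 * η ≤ R e →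
      4 * ((3 * (L * 2 ^ L + 2 : ℕ) * ((⌊(2 : ℝ) ^ (n * (R e - 2 * η))⌋₊ : ℕ) + 1) : ℝ) ^
        (2 * ⌊(2 : ℝ) ^ (n * (R e - 2 * η))⌋₊)) ^ (L + 1) <
      Real.exp (ε / (4 * 64 ^ L) / (2 * (2 : ℝ) ^ (-(n * (R e - η))))) :=
    eventually_all.2 fun e => by
      by_cases h : 2 * η ≤ R e
      · filter_upwards [eventually_net_lt_exp hη h (L * 2 ^ L + 2) (by omega) L
          (show 0 < ε / (4 * 64 ^ L) by positivity)] with n hn _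
        exact hn
      · exact Eventually.of_forall fun n h' => absurd h' h
  -- a block length from `10 / η` on makes the loss of a factor `2 ^ 10` in dimension irrelevant
  filter_upwards [hF', hQ', hstep, eventually_ge_atTop ⌈10 / η⌉₊] with n hFn hQn hn hn10
  obtain ⟨r, K, hK, hTP⟩ := exists_kraus hΛ (hT n)
  rw [hK] at hFn ⊢
  have hz1 : ∀ e, 2 * η ≤ R e → 1 ≤ ⌊(2 : ℝ) ^ (n * (R e - 2 * η))⌋₊ := fun e he =>
    Nat.le_floor (by
      rw [Nat.cast_one]
      exact Real.one_le_rpow (by norm_num) (mul_nonneg (Nat.cast_nonneg _) (by linarith)))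
  obtain ⟨H, hH, hle, hge, hfid⟩ := exists_subspaces_of_entanglementFidelity hTP (hΨ n) hε0.le hε
    hFn.le hη.le hη1 hκ (t := fun e => (2 : ℝ) ^ (-(n * (R e - η))))
    (fun e => by
      have h1 := typicalWeight_le (reduced_isHermitian (Ψ n e))
        (eigenvalues_reduced_nonneg (Ψ n e)) n (R e) η
      linarith [hQn e])
    (D := fun e => if 2 * η ≤ R e then ⌊(2 : ℝ) ^ (n * (R e - 2 * η))⌋₊ else 1)
    (fun e => by
      split_ifs with h
      exacts [hz1 e h, le_rfl])
    (s := L * 2 ^ L + 2) le_rfl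
    (fun e => by
      split_ifs with h
      · refine Or.inr ⟨by positivity, ?_⟩
        rw [← div_div]
        exact hn e h
      · exact Or.inl rfl)
  refine ⟨H, hH, fun e => ?_, hfid⟩
  have h1 := hle e
  have h2 := hge e
  by_cases h : 2 * η ≤ R e
  · simp only [if_pos h] at h1 h2
    exact abs_logb_div_sub_le hη h (Nat.ceil_le.1 hn10) rfl h1 h2
  · simp only [if_neg h] at h1 h2
    have h3 : Module.finrank ℂ (H e) = 1 := by omega
    rw [h3, Nat.cast_one, Real.logb_one, zero_div, zero_sub, abs_neg, abs_of_nonneg (hR0 e)]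
    linarith

theorem entanglementRates_subset (l : Layout k m L) (hΛ : IsChannel Λ) (C : Comm)
    (d : Fin L → ℕ) : entanglementRates l C Λ d ⊆ subspaceRates l C Λ d := by
  classical
  rintro R ⟨T, c, Ψ, hT, hΨ, hR, hQ, hF⟩
  have hlim : Tendsto (fun j : ℕ => 1 / ((j : ℝ) + 1)) atTop (𝓝 0) :=
    tendsto_one_div_add_atTop_nhds_zero_nat
  obtain ⟨g, hg, hgood⟩ := exists_tendsto_atTop_of_forall_eventually fun j : ℕ =>
    eventually_exists_subspaces hΛ hT hΨ hR hQ hF (η := 1 / ((j : ℝ) + 1)) (by positivity)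
      ((div_le_one (by positivity)).2 (by linarith [Nat.cast_nonneg (α := ℝ) j]))
  -- for the finitely many remaining `n` the whole space serves as subspace
  have hbot : ∀ n e, (⊤ : Submodule ℂ (EuclideanSpace ℂ (Blk n (d e)))) ≠ ⊥ := by
    intro n e
    have : Nonempty (Blk n (d e)) := by
      by_contra h
      rw [not_nonempty_iff] at h
      have h1 := hΨ n e
      rw [Subsingleton.elim (Ψ n e) 0, norm_zero] at h1
      exact zero_ne_one h1
    exact top_ne_bot
  let good : ℕ → Prop := fun n => ∃ H : ∀ e, Submodule ℂ (EuclideanSpace ℂ (Blk n (d e))),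
      (∀ e, H e ≠ ⊥) ∧ (∀ e, |Real.logb 2 (Module.finrank ℂ (H e)) / n - R e| ≤
        3 * (1 / ((g n : ℝ) + 1))) ∧
      1 - 2 * (1 / ((g n : ℝ) + 1)) ≤ subspaceFidelity H (route l n d (T n))
  have hH : ∀ n, ∃ H : ∀ e, Submodule ℂ (EuclideanSpace ℂ (Blk n (d e))), (∀ e, H e ≠ ⊥) ∧
      (good n → (∀ e, |Real.logb 2 (Module.finrank ℂ (H e)) / n - R e| ≤
        3 * (1 / ((g n : ℝ) + 1))) ∧
      1 - 2 * (1 / ((g n : ℝ) + 1)) ≤ subspaceFidelity H (route l n d (T n))) := by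
    intro n
    by_cases h : good n
    · obtain ⟨H, h1, h2⟩ := h
      exact ⟨H, h1, fun _ => h2⟩
    · exact ⟨fun e => ⊤, hbot n, fun h' => absurd h' h⟩
  choose H hHbot hHgood using hH
  have hg0 := hlim.comp hg
  refine ⟨T, H, hT, hHbot, fun e => ?_, ?_⟩
  · rw [tendsto_iff_dist_tendsto_zero]
    refine squeeze_zero' (g := fun n => 3 * (1 / ((g n : ℝ) + 1)))
      (Eventually.of_forall fun n => dist_nonneg) ?_ ?_
    · filter_upwards [hgood] with n hn
      exact (hHgood n hn).1 e
    · simpa using hg0.const_mul 3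
  · refine tendsto_of_tendsto_of_tendsto_of_le_of_le'
      (g := fun n => 1 - 2 * (1 / ((g n : ℝ) + 1))) (h := fun _ => 1) ?_ tendsto_const_nhds ?_ ?_
    · simpa using (hg0.const_mul 2).const_sub 1
    · filter_upwards [hgood] with n hn
      exact (hHgood n hn).2
    · refine Eventually.of_forall fun n => ?_
      obtain ⟨r, K, hK, hTP⟩ := exists_kraus hΛ (hT n)
      choose v hv hv0 using fun e => (H n e).exists_mem_ne_zero_of_ne_bot (hHbot n e)
      rw [hK]
      refine (subspaceFidelity_le (H n) K (ψ := fun e => ((‖v e‖ : ℂ)⁻¹) • v e) fun e =>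
        ⟨(H n e).smul_mem _ (hv e), norm_smul_inv_norm (hv0 e)⟩).trans
        (pow_le_one₀ (norm_nonneg _) (norm_amplitude_le hTP ?_))
      rw [norm_tensorVec]
      exact Finset.prod_eq_one fun e _ => norm_smul_inv_norm (hv0 e)

end Rates

end QNet

end

theorem mainTheorem3 (k m L : ℕ) (a : Fin k → ℕ) (b : Fin m → ℕ) (l : QNet.Layout k m L)
    (Λ : QNet.NetMap a b) (hΛ : QNet.IsChannel Λ) (C : QNet.Comm) :
    QNet.subspaceRegion l C Λ = QNet.entanglementRegion l C Λ ∧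
    ∀ d : Fin L → ℕ, QNet.subspaceRates l C Λ d = QNet.entanglementRates l C Λ d := by
  have h : ∀ d : Fin L → ℕ, QNet.subspaceRates l C Λ d = QNet.entanglementRates l C Λ d :=
    fun d => Set.Subset.antisymm (QNet.subspaceRates_subset l hΛ C d)
      (QNet.entanglementRates_subset l hΛ C d)
  exact ⟨Set.iUnion_congr h, h⟩
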